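/- **Setting.** Let $N\ge 2$. There are $2N$ items with unknown parameters $u_1\ge u_2\ge\dots\ge u_{2N}$ in $(0,1)$. Let $\mathcal M$ be the set of maximal matchings (partitions of $[2N]$ into $N$ pairs). At each time $t=1,\dots,T$ a learner plays $m_t\in\mathcal M$ and observes, for every matched pair $\{i,j\}\in m_t$, the value $X_{i,j,t}=u_iu_j+\varepsilon_{i,j,t}$. The noise variables $\varepsilon_{i,j,t}$ (one for each unordered pair $\{i,j\}$ and each $t$) are independent, zero-mean and sub-Gaussian with variance proxy $1/4$, i.e. $\mathbb E[e^{s\varepsilon}]\le e^{s^2/8}$ for all $s\in\mathbb R$ (this covers $[0,1]$-valued observations). The regret is $$R(T)=T\max_{m\in\mathcal M}\sum_{(i,j)\in m}u_iu_j-\sum_{t=1}^T\sum_{(i,j)\in m_t}u_iu_j .$$ Assume that $u_{2i-1}=u_{2i}$ for all $i\in[N]$ and that there is a unique optimal matching $m^*$, and let $$\Delta_{\min}=\min_{m\in\mathcal M,\ m\ne m^*}\Big\{\sum_{(i,j)\in m^*}u_iu_j-\sum_{(i,j)\in m}u_iu_j\Big\}.$$ **Algorithm** (simple-Adaptive-Matching,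 with the horizon $T$ as input). It maintains an ordered sequence of clusters partitioning $[2N]$, best cluster first, initially the single cluster $[2N]$. For every set $S$ of items of even size a round-robin schedule is fixed: $|S|-1$ rounds, in each of which the items of $S$ are matched among themselves, such that any two items of $S$ meet in exactly one round. At time $t$ every cluster $S$ plays round $t \bmod (|S|-1)$ of its schedule; should some cluster have odd size, an arbitrary fixed maximal matching is played instead. The observations are stored in a buffer. When some item of a cluster $S$ has $|S|-1$ buffered samples against items of $S$ (the tournament of $S$ is complete), the buffered samples of the items of $S$ are added to their recorded samples, and the buffer of $S$ is cleared. At such a time, let $n$ be the number of recorded samples of an item $i\in S$ against items of its own and of the better clusters, and let $\hat x_i$ be their mean. If $n$ has reached one of the levels $k_l=\lceil 4^{l+1}\log T\rceil$, $l\ge 1$, during the tournament just completed, i.e. $k_l\le n<k_l+|S|-1$ for some $l\ge1$, then the confidence bounds of $i$ are set to $$Q_\pm(i)=\hat x_i\pm\sqrt{\log (T)/n};$$ otherwise they remain unchanged (initially $Q_\pm=\pm\infty$). At the end of each iteration the items of each cluster are listed by decreasing $Q_+$, and the cluster is split between consecutive items $a,b$ of this list whenever $Q_+(b)<Q_-(a)$.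 **Theorem.** There is a universal constant $c_{\mathfrak u}>0$ such that for all $N$ and $u$ as above there is a constant $c_{\mathfrak p}$, depending only on $N$ and $u$, such that for every choice of the round-robin schedules (and of the matching played if a cluster is odd), every noise distribution as above and every integer horizon $T>0$, the regret of simple-Adaptive-Matching is integrable and $$\mathbb E[R(T)]\le c_{\mathfrak u}\,\frac{N\log N}{\Delta_{\min}}\,\log T+c_{\mathfrak p}.$$ -/

import Mathlib

open MeasureTheory ProbabilityTheory

noncomputable section

namespace MatchingBandit

/-- The items `1, …, 2N`, numbered from `0`. -/
abbrev Item (N : ℕ) := Fin (2 * N)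

/-! ### Maximal matchings, regret and gap -/

/-- A maximal matching of the `2N` items: `N` disjoint pairs, given by the map that sends every item
to its partner. -/
@[ext]
structure Matching (N : ℕ) where
  mate : Item N → Item N
  mate_mate : ∀ i, mate (mate i) = i
  mate_ne : ∀ i, mate i ≠ i

/-- Expected reward `∑_{(i,j) ∈ m} u_i u_j`; every pair is counted once, through its smaller item. -/
def Matching.value {N : ℕ} (u : Item N → ℝ) (m : Matching N) : ℝ :=
  ∑ i with i < m.mate i, u i * u (m.mate i)

/-- `R(T) = T max_m ∑_{(i,j) ∈ m} u_i u_j - ∑_{t = 1}^T ∑_{(i,j) ∈ m_t} u_i u_j`. There are finitely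
many matchings, so the supremum is a maximum. -/
def regret {N : ℕ} (u : Item N → ℝ) (T : ℕ) (played : ℕ → Matching N) : ℝ :=
  T * (⨆ m : Matching N, m.value u) - ∑ t ∈ Finset.Icc 1 T, (played t).value u

/-- `Δ_min`, the smallest loss of a matching other than `mStar`. The set is finite, and it is
nonempty as soon as `N ≥ 2`, so the infimum is a minimum. -/
def minGap {N : ℕ} (u : Item N → ℝ) (mStar : Matching N) : ℝ :=
  sInf {g : ℝ | ∃ m : Matching N, m ≠ mStar ∧ g = mStar.value u - m.value u}

/-! ### Round-robin tournaments -/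

/-- A round-robin schedule for every set `S` of items of even size: in each of the `|S| - 1` rounds
the items of `S` are matched among themselves, and any two of them meet in exactly one round. -/
structure RoundRobin (N : ℕ) where
  opponent : Finset (Item N) → ℕ → Item N → Item N
  mem : ∀ S, Even S.card → ∀ r < S.card - 1, ∀ i ∈ S, opponent S r i ∈ S
  ne : ∀ S, Even S.card → ∀ r < S.card - 1, ∀ i ∈ S, opponent S r i ≠ i
  invol : ∀ S, Even S.card → ∀ r < S.card - 1, ∀ i ∈ S, opponent S r (opponent S r i) = i
  once : ∀ S, Even S.card → ∀ i ∈ S, ∀ j ∈ S, i ≠ j →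
    ∃! r, r < S.card - 1 ∧ opponent S r i = j

/-! ### The algorithm -/

/-- The variables of the algorithm: total rewards `X` and counts `C` of the completed tournaments,
the same quantities `Xbuf`, `Cbuf` for the tournaments in progress, the upper and lower confidence
bounds `Qhi`, `Qlo`, and the ordered sequence of clusters, best cluster first. -/
structure State (N : ℕ) where
  X : Item N → Item N → ℝ
  C : Item N → Item N → ℕ
  Xbuf : Item N → Item N → ℝ
  Cbuf : Item N → Item N → ℕ
  Qhi : Item N → EReal
  Qlo : Item N → EReal
  clusters : List (Finset (Item N))

/-- One cluster that contains all items, no samples, trivial confidence bounds. -/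
def State.init (N : ℕ) : State N where
  X := fun _ _ => 0
  C := fun _ _ => 0
  Xbuf := fun _ _ => 0
  Cbuf := fun _ _ => 0
  Qhi := fun _ => ⊤
  Qlo := fun _ => ⊥
  clusters := [Finset.univ]

/-- The cluster that contains item `i`. -/
def clusterOf {N : ℕ} (L : List (Finset (Item N))) (i : Item N) : Finset (Item N) :=
  (L.find? (fun S => decide (i ∈ S))).getD ∅

/-- The union of the clusters up to and including the one that contains item `i`. -/
def upTo {N : ℕ} : List (Finset (Item N)) → Item N → Finset (Item N)
  | [], _ => ∅
  | S :: L, i => if i ∈ S then S else S ∪ upTo L i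

open Classical in
/-- `sample_matching`: at time `t` every cluster `S` plays round `t mod (|S| - 1)` of its
tournament. If this is not a matching of all items (some cluster is odd), `fallback` is played. -/
def sampleMatching {N : ℕ} (rr : RoundRobin N) (fallback : Matching N)
    (L : List (Finset (Item N))) (t : ℕ) : Matching N :=
  let f : Item N → Item N := fun i =>
    rr.opponent (clusterOf L i) (t % ((clusterOf L i).card - 1)) i
  if h : (∀ i, f (f i) = i) ∧ (∀ i, f i ≠ i) then ⟨f, h.1, h.2⟩ else fallback

/-- The tournament of cluster `S` is complete: `∃ i ∈ S, ∑_{j ∈ S} Cbuf(i,j) = |S| - 1`. -/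
def Complete {N : ℕ} (Cbuf : Item N → Item N → ℕ) (S : Finset (Item N)) : Prop :=
  ∃ i ∈ S, ∑ j ∈ S, Cbuf i j = S.card - 1

/-- The levels `k_l = ⌈4^(l+1) log T⌉`. -/
def level (T l : ℕ) : ℕ := ⌈(4 : ℝ) ^ (l + 1) * Real.log T⌉₊

/-- The splitting step for one cluster: its items are listed by decreasing `Qhi`, and the list is
cut between consecutive items `a`, `b` if and only if `Qhi b < Qlo a`. -/
def splitCluster {N : ℕ} (Qhi Qlo : Item N → EReal) (S : Finset (Item N)) :
    List (Finset (Item N)) :=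
  ((((List.finRange (2 * N)).filter (fun i => decide (i ∈ S))).mergeSort
    (fun a b => decide (Qhi b ≤ Qhi a))).splitBy
      (fun a b => decide (¬ Qhi b < Qlo a))).map List.toFinset

open Classical in
/-- One iteration with horizon `T`, when matching `m` has been played and `x i j` is the observation
for the pair `(i, j)`; only the entries of `x` at matched pairs are used.

`X`, `C` absorb the buffers of the clusters whose tournament is complete. Then `conf_bound` refreshes
the interval of item `i` when the number `n` of samples of `i` against its own and the better
clusters has reached a level `k_l`, `l > 0`, during the tournament just completed by its cluster.
Such a tournament has `|S| - 1` rounds, so this means `k_l ≤ n < k_l + (|S| - 1)`. Finally the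
clusters are split. -/
def step {N : ℕ} (T : ℕ) (m : Matching N) (x : Item N → Item N → ℝ) (s : State N) : State N :=
  let Xb : Item N → Item N → ℝ := fun i j => s.Xbuf i j + if m.mate i = j then x i j else 0
  let Cb : Item N → Item N → ℕ := fun i j => s.Cbuf i j + if m.mate i = j then 1 else 0
  let done : Item N → Prop := fun i => Complete Cb (clusterOf s.clusters i)
  let X' : Item N → Item N → ℝ := fun i j => if done i then s.X i j + Xb i j else s.X i j
  let C' : Item N → Item N → ℕ := fun i j => if done i then s.C i j + Cb i j else s.C i j
  let n : Item N → ℕ := fun i => ∑ j ∈ upTo s.clusters i, C' i j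
  let mean : Item N → ℝ := fun i => (∑ j ∈ upTo s.clusters i, X' i j) / n i
  let width : Item N → ℝ := fun i => Real.sqrt (Real.log T / n i)
  let refresh : Item N → Prop := fun i => done i ∧ ∃ l : ℕ, 0 < l ∧
    level T l ≤ n i ∧ n i < level T l + ((clusterOf s.clusters i).card - 1)
  let Qhi' : Item N → EReal := fun i =>
    if refresh i then ((mean i + width i : ℝ) : EReal) else s.Qhi i
  let Qlo' : Item N → EReal := fun i =>
    if refresh i then ((mean i - width i : ℝ) : EReal) else s.Qlo i
  { X := X'
    C := C'
    Xbuf := fun i j => if done i then 0 else Xb i j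
    Cbuf := fun i j => if done i then 0 else Cb i j
    Qhi := Qhi'
    Qlo := Qlo'
    clusters := s.clusters.flatMap (splitCluster Qhi' Qlo') }

/-- The state at the end of iteration `t`, when `x t i j` is the observation for the pair `(i, j)` at
time `t`. -/
def stateAt {N : ℕ} (rr : RoundRobin N) (fallback : Matching N) (T : ℕ)
    (x : ℕ → Item N → Item N → ℝ) : ℕ → State N
  | 0 => State.init N
  | t + 1 =>
    let s := stateAt rr fallback T x t
    step T (sampleMatching rr fallback s.clusters (t + 1)) (x (t + 1)) s

/-- The matching `m_t` played at time `t ≥ 1` by simple-Adaptive-Matching with horizon `T`. -/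
def played {N : ℕ} (rr : RoundRobin N) (fallback : Matching N) (T : ℕ)
    (x : ℕ → Item N → Item N → ℝ) (t : ℕ) : Matching N :=
  sampleMatching rr fallback (stateAt rr fallback T x (t - 1)).clusters t

/-- The observations `X_{i,j,t} = u_i u_j + ε_{i,j,t}`; the noise belongs to the unordered pair. -/
def observation {N : ℕ} (u : Item N → ℝ) (ε : Sym2 (Item N) → ℕ → ℝ) :
    ℕ → Item N → Item N → ℝ :=
  fun t i j => u i * u j + ε s(i, j) t

/-! ### Round-robin schedules exist -/

/-- The circle method on a set of even size. -/
theorem exists_schedule {N : ℕ} (S : Finset (Item N)) (hS : Even S.card) :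
    ∃ f : ℕ → Item N → Item N,
      (∀ r < S.card - 1, ∀ i ∈ S, f r i ∈ S) ∧
      (∀ r < S.card - 1, ∀ i ∈ S, f r i ≠ i) ∧
      (∀ r < S.card - 1, ∀ i ∈ S, f r (f r i) = i) ∧
      (∀ i ∈ S, ∀ j ∈ S, i ≠ j → ∃! r, r < S.card - 1 ∧ f r i = j) := by
  classical
  rcases Nat.eq_zero_or_pos S.card with h0 | hpos
  · refine ⟨fun _ i => i, ?_, ?_, ?_, ?_⟩ <;> simp [Finset.card_eq_zero.1 h0]
  obtain ⟨n, hn⟩ : ∃ n, S.card = n + 1 := ⟨S.card - 1, by omega⟩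
  have hodd : Odd n := by
    rw [hn] at hS
    rcases Nat.even_or_odd n with h | h
    · exact absurd hS (by simpa [Nat.even_add_one] using h)
    · exact h
  have : NeZero n := ⟨by rintro rfl; simp at hodd⟩
  rw [hn, Nat.add_sub_cancel]
  obtain ⟨c, hc⟩ : ∃ c : ZMod n, 2 * c = 1 := by
    refine ⟨(2 : ZMod n)⁻¹, ?_⟩
    have := ZMod.coe_mul_inv_eq_one 2 (Nat.coprime_two_left.2 hodd)
    exact_mod_cast this
  have half : ∀ x y : ZMod n, 2 * x = y → x = c * y := by
    intro x y h
    rw [← h, ← mul_assoc, mul_comm c 2, hc, one_mul]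
  have half' : ∀ y : ZMod n, 2 * (c * y) = y := by
    intro y
    rw [← mul_assoc, hc, one_mul]
  let g : ZMod n → Option (ZMod n) → Option (ZMod n) := fun r o =>
    o.elim (some (c * r)) (fun x => if x = c * r then none else some (r - x))
  have gs : ∀ r x, g r (some x) = if x = c * r then none else some (r - x) := fun _ _ => rfl
  have gn : ∀ r, g r none = some (c * r) := fun _ => rfl
  have ginv : ∀ r o, g r (g r o) = o := by
    rintro r (_ | x)
    · simp [gn, gs]
    · by_cases h : x = c * r
      · rw [gs, if_pos h, gn, h]
      · rw [gs, if_neg h, gs, if_neg, sub_sub_cancel]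
        intro h'
        apply h
        have h2 := half' r
        linear_combination (-1 : ZMod n) * h' - h2
  have gne : ∀ r o, g r o ≠ o := by
    rintro r (_ | x)
    · simp [gn]
    · by_cases h : x = c * r
      · rw [gs, if_pos h]; simp
      · rw [gs, if_neg h]
        intro h'
        apply h
        apply half
        have := Option.some.inj h'
        linear_combination (-1 : ZMod n) * this
  have gonce : ∀ o o', o ≠ o' → ∃! r, g r o = o' := by
    rintro (_ | x) (_ | y) hne
    · exact absurd rfl hne
    · refine ⟨2 * y, ?_, ?_⟩
      · simp only [gn]; rw [← half y (2 * y) rfl]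
      · intro r hr
        simp only [gn] at hr
        rw [← Option.some.inj hr, half']
    · refine ⟨2 * x, ?_, ?_⟩
      · simp only [gs]; rw [if_pos (half x _ rfl)]
      · intro r hr
        simp only [gs] at hr
        by_cases h : x = c * r
        · rw [h, half']
        · rw [if_neg h] at hr; simp at hr
    · have hxy : x ≠ y := fun h => hne (by rw [h])
      refine ⟨x + y, ?_, ?_⟩
      · simp only [gs]
        rw [if_neg]
        · congr 1; ring
        · intro h
          apply hxy
          have := half' (x + y)
          rw [← h] at this
          linear_combination this
      · intro r hr
        simp only [gs] at hr
        by_cases h : x = c * r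
        · rw [if_pos h] at hr; simp at hr
        · rw [if_neg h] at hr
          have := Option.some.inj hr
          linear_combination this
  have hcard : Fintype.card S = Fintype.card (Option (ZMod n)) := by
    simp [hn, ZMod.card]
  let e : S ≃ Option (ZMod n) := Fintype.equivOfCardEq hcard
  let f : ℕ → Item N → Item N := fun r i =>
    if h : i ∈ S then (e.symm (g (r : ZMod n) (e ⟨i, h⟩)) : Item N) else i
  have fe : ∀ r i (h : i ∈ S), f r i = (e.symm (g (r : ZMod n) (e ⟨i, h⟩)) : Item N) := by
    intro r i h
    simp only [f, dif_pos h]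
  have fmem : ∀ r, ∀ i ∈ S, f r i ∈ S := by
    intro r i h
    rw [fe r i h]
    exact (e.symm _).2
  have fsub : ∀ r i (h : i ∈ S), (⟨f r i, fmem r i h⟩ : S) = e.symm (g (r : ZMod n) (e ⟨i, h⟩)) :=
    fun r i h => Subtype.ext (fe r i h)
  refine ⟨f, fun r _ => fmem r, ?_, ?_, ?_⟩
  · intro r _ i h heq
    have h1 : (⟨f r i, fmem r i h⟩ : S) = ⟨i, h⟩ := Subtype.ext heq
    rw [fsub r i h, Equiv.symm_apply_eq] at h1
    exact gne _ _ h1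
  · intro r _ i h
    rw [fe r _ (fmem r i h), fsub r i h, Equiv.apply_symm_apply, ginv, Equiv.symm_apply_apply]
  · intro i hi j hj hij
    have key : ∀ r : ℕ, f r i = j ↔ g (r : ZMod n) (e ⟨i, hi⟩) = e ⟨j, hj⟩ := by
      intro r
      rw [← Equiv.symm_apply_eq, ← fsub r i hi, Subtype.mk.injEq]
    obtain ⟨r, hr, hu⟩ := gonce (e ⟨i, hi⟩) (e ⟨j, hj⟩) (by
      intro h
      exact hij (congrArg Subtype.val (e.injective h)))
    refine ⟨r.val, ⟨ZMod.val_lt r, ?_⟩, ?_⟩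
    · rw [key, ZMod.natCast_zmod_val]
      exact hr
    · rintro k ⟨hk, hkj⟩
      rw [key] at hkj
      rw [← hu _ hkj, ZMod.val_cast_of_lt hk]

instance roundRobin_nonempty (N : ℕ) : Nonempty (RoundRobin N) := by
  classical
  choose f h1 h2 h3 h4 using fun (S : Finset (Item N)) (hS : Even S.card) => exists_schedule S hS
  refine ⟨⟨fun S r i => if hS : Even S.card then f S hS r i else i, ?_, ?_, ?_, ?_⟩⟩
  · intro S hS; simpa only [dif_pos hS] using h1 S hS
  · intro S hS; simpa only [dif_pos hS] using h2 S hS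
  · intro S hS; simpa only [dif_pos hS] using h3 S hS
  · intro S hS; simpa only [dif_pos hS] using h4 S hS

end MatchingBandit

end

noncomputable section

namespace MatchingBandit

variable {N : ℕ}

/-! ### Matchings, their values and the gap -/

/-! As the parameters come in equal pairs, the optimal matching joins twins, and four times the loss
of a matching `m` is `∑ i, (u i - u (m.mate i)) ^ 2` (`Matching.loss_eq`). The regret is therefore a
sum of squared differences over all meetings. Exchanging partners between neighbouring pairs costs
at most the square of their difference, so with `δ ^ 2 = Δ_min` distinct parameters are at least `δ`
apart.

Suppose that all sums of noise stay within their radius (`Concentrated`). Then clusters are never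
split wrongly, they keep twins together and hence have even size, and only complete tournaments are
recorded (`Good`). Two items `a`, `b` of a cluster `S` have met every third item equally often, so
their expected means differ by `u a - u b` times an average parameter of opponents, which is at
least of the order of `H / |S|`, where `H` is the sum of the parameters in `S`. If their intervals
overlap after `4 ^ (l + 1) * log T` samples, then `2 ^ l * (u a - u b) * H ≤ 4 * |S|`
(`gap_le_of_overlap`). A cluster that is not cut is held together by such overlaps, so its spread
`d` satisfies `2 ^ l * d * H ≤ 4 * |S| ^ 2`. Since `H ≥ δ * |S| ^ 2 / 16` and `d ≤ H`, both `2 ^ l *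
δ * d ≤ 64` and `2 ^ l * d ^ 2 ≤ 16 * N ^ 2` follow (`narrow_of_linked`).

Each meeting is charged to its worse item. At level `l` an item has of the order of `4 ^ l * log T`
samples against better items, each costing at most `d ^ 2`. The levels end once `2 ^ l` exceeds `64
/ δ ^ 2`. The first bound on `d` gives a contribution of order `log T / δ ^ 2` per level, and the
second makes all but the last `O(log N)` levels a geometric series. This yields `O(log N * log T / δ
^ 2)` per item (`sum_spreadBound_le`).

Concentration fails with probability `O(1 / T)` for fixed `N`, by an exponential supermartingale for
the adaptively chosen samples (`measure_not_concentrated_le`). As the regret is at most `N * T`,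
this adds only a constant. -/

/-- The matching that pairs the items `2k` and `2k + 1`. -/
def twinMatching (N : ℕ) : Matching N where
  mate i := ⟨i.1 + 1 - 2 * (i.1 % 2), by have := i.2; omega⟩
  mate_mate i := by ext; simp only; omega
  mate_ne i h := by have := congrArg Fin.val h; simp only at this; omega

/-- The other item with the same parameter. -/
abbrev twin (i : Item N) : Item N := (twinMatching N).mate i

theorem twin_val (i : Item N) : (twin i).1 = i.1 + 1 - 2 * (i.1 % 2) := rfl

theorem Matching.two_mul_value (u : Item N → ℝ) (m : Matching N) :
    2 * m.value u = ∑ i, u i * u (m.mate i) := by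
  have h1 : ∑ i, u i * u (m.mate i) =
      (∑ i with i < m.mate i, u i * u (m.mate i)) +
        ∑ i with ¬ i < m.mate i, u i * u (m.mate i) :=
    (Finset.sum_filter_add_sum_filter_not _ _ _).symm
  have h2 : ∑ i with ¬ i < m.mate i, u i * u (m.mate i) =
      ∑ i with i < m.mate i, u i * u (m.mate i) := by
    refine Finset.sum_bij' (fun i _ => m.mate i) (fun i _ => m.mate i) ?_ ?_ ?_ ?_ ?_
    · intro i hi
      simp only [Finset.mem_filter, Finset.mem_univ, true_and, m.mate_mate] at hi ⊢
      exact lt_of_le_of_ne (not_lt.1 hi) (m.mate_ne i)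
    · intro i hi
      simp only [Finset.mem_filter, Finset.mem_univ, true_and, m.mate_mate] at hi ⊢
      exact not_lt.2 hi.le
    · intro i _; exact m.mate_mate i
    · intro i _; exact m.mate_mate i
    · intro i _; rw [m.mate_mate, mul_comm]
  rw [h1, h2, Matching.value]; ring

theorem Matching.sum_comp_mate (m : Matching N) (f : Item N → ℝ) :
    ∑ i, f (m.mate i) = ∑ i, f i :=
  Equiv.sum_comp (Function.Involutive.toPerm m.mate m.mate_mate) f

/-- After expanding the squares, each of the two sums of squares is twice the value of the twin
matching, and the cross terms are four times the value of `m`. -/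
theorem Matching.loss_eq (u : Item N → ℝ) (hu : ∀ i, u (twin i) = u i) (m : Matching N) :
    4 * ((twinMatching N).value u - m.value u) = ∑ i, (u i - u (m.mate i)) ^ 2 := by
  have h1 := (twinMatching N).two_mul_value u
  have h2 := m.two_mul_value u
  have h3 := m.sum_comp_mate (fun i => u i ^ 2)
  have h4 : ∑ i, (u i - u (m.mate i)) ^ 2 =
      ∑ i, u i ^ 2 + ∑ i, u (m.mate i) ^ 2 - 2 * ∑ i, u i * u (m.mate i) := by
    rw [Finset.mul_sum, ← Finset.sum_add_distrib, ← Finset.sum_sub_distrib]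
    exact Finset.sum_congr rfl fun i _ => by ring
  have h5 : ∑ i, u i * u ((twinMatching N).mate i) = ∑ i, u i ^ 2 :=
    Finset.sum_congr rfl fun i _ => by rw [hu i]; ring
  rw [h4, h3, ← h2]
  rw [h5] at h1
  linarith

theorem Matching.mate_injective : Function.Injective (Matching.mate (N := N)) :=
  fun _ _ h => Matching.ext h

instance : Finite (Matching N) := Finite.of_injective _ Matching.mate_injective

instance : Nonempty (Matching N) := ⟨twinMatching N⟩

/-- The matching that pairs `2k` with `2k + 2` and `2k + 1` with `2k + 3`. -/
def swapMatching (N k : ℕ) (hk : k + 1 < N) : Matching N where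
  mate i := ⟨if i.1 / 2 = k then i.1 + 2 else if i.1 / 2 = k + 1 then i.1 - 2
    else i.1 + 1 - 2 * (i.1 % 2), by have := i.2; split_ifs <;> omega⟩
  mate_mate i := by
    ext; simp only; split_ifs <;> omega
  mate_ne i h := by
    have := congrArg Fin.val h; simp only at this; split_ifs at this <;> omega

/-- Parameters that come in equal pairs, with distinct values at least `δ` apart. -/
structure Paired (u : Item N → ℝ) (δ : ℝ) : Prop where
  two_le : 2 ≤ N
  pos : ∀ i, 0 < u i
  lt_one : ∀ i, u i < 1
  twin_eq : ∀ i, u (twin i) = u i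
  delta_pos : 0 < δ
  gap : ∀ i j, u j < u i → δ ≤ u i - u j
  index_le : ∀ i : Item N, δ * (N - 1 - (i.1 / 2 : ℕ)) ≤ u i

theorem twin_eq_of_pairs {u : Item N → ℝ}
    (h : ∀ (k : ℕ) (hk : 2 * k + 1 < 2 * N), u ⟨2 * k, Nat.lt_of_succ_lt hk⟩ = u ⟨2 * k + 1, hk⟩)
    (i : Item N) : u (twin i) = u i := by
  have hi := i.2
  have h' := h (i.1 / 2) (by omega)
  rcases Nat.mod_two_eq_zero_or_one i.1 with h0 | h0
  · have e1 : (⟨2 * (i.1 / 2), by omega⟩ : Item N) = i := Fin.ext (by simp only; omega)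
    have e2 : (⟨2 * (i.1 / 2) + 1, by omega⟩ : Item N) = twin i :=
      Fin.ext (by rw [twin_val]; simp only; omega)
    simp only [e1, e2] at h'
    exact h'.symm
  · have e1 : (⟨2 * (i.1 / 2), by omega⟩ : Item N) = twin i :=
      Fin.ext (by rw [twin_val]; simp only; omega)
    have e2 : (⟨2 * (i.1 / 2) + 1, by omega⟩ : Item N) = i := Fin.ext (by simp only; omega)
    simp only [e1, e2] at h'
    exact h'

/-- By `Matching.loss_eq` no matching beats the twin matching, so a strict maximiser can only be the
twin matching itself. -/
theorem eq_twinMatching {u : Item N → ℝ} (hu : ∀ i, u (twin i) = u i) {mStar : Matching N}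
    (hm : ∀ m : Matching N, m ≠ mStar → m.value u < mStar.value u) : mStar = twinMatching N := by
  by_contra hne
  have h1 := hm _ (Ne.symm hne)
  have h2 := mStar.loss_eq u hu
  have h3 : 0 ≤ ∑ i, (u i - u (mStar.mate i)) ^ 2 := Finset.sum_nonneg fun i _ => sq_nonneg _
  linarith

theorem swapMatching_ne (k : ℕ) (hk : k + 1 < N) : swapMatching N k hk ≠ twinMatching N := by
  intro h
  have := congrArg (fun m : Matching N => (m.mate ⟨2 * k, by omega⟩).1) h
  simp [swapMatching, twinMatching] at this

/-- Only the four items of two neighbouring pairs change partners, and each of them contributes the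
same square to four times the loss. -/
theorem swapMatching_loss_le {u : Item N → ℝ} (hu : ∀ i, u (twin i) = u i) (i : Item N)
    (hi : i.1 + 2 < 2 * N) :
    (twinMatching N).value u - (swapMatching N (i.1 / 2) (by omega)).value u ≤
      (u i - u ⟨i.1 + 2, hi⟩) ^ 2 := by
  have h := (swapMatching N (i.1 / 2) (by omega)).loss_eq u hu
  set m := swapMatching N (i.1 / 2) (by omega) with hm
  set k := i.1 / 2 with hk
  have same : ∀ a b : Item N, a.1 / 2 = b.1 / 2 → u a = u b := by
    intro a b hab
    rcases eq_or_ne a b with rfl | hne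
    · rfl
    · have : b = twin a := by
        have h1 : a.1 ≠ b.1 := fun h => hne (Fin.ext h)
        apply Fin.ext; rw [twin_val]; omega
      rw [this, hu]
  let A : Finset (Item N) := Finset.univ.filter fun j => j.1 / 2 = k ∨ j.1 / 2 = k + 1
  have hA : A.card ≤ 4 := by
    have : A.card ≤ (Finset.Ico (2 * k) (2 * k + 4)).card := by
      refine Finset.card_le_card_of_injOn (fun j => j.1) ?_ (fun a _ b _ h => Fin.ext h)
      intro j hj
      simp only [A, Finset.coe_filter, Finset.mem_univ, true_and, Set.mem_ofPred_eq] at hj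
      simp only [Finset.coe_Ico, Set.mem_Ico]
      omega
    simpa using this
  have hsum : ∑ j, (u j - u (m.mate j)) ^ 2 ≤
      ∑ j, if j ∈ A then (u i - u ⟨i.1 + 2, hi⟩) ^ 2 else 0 := by
    refine Finset.sum_le_sum fun j _ => ?_
    by_cases h1 : j.1 / 2 = k
    · have hjA : j ∈ A := by simp [A, h1]
      rw [if_pos hjA, same j i (by omega), same (m.mate j) ⟨i.1 + 2, hi⟩]
      simp only [hm, swapMatching]
      split_ifs <;> omega
    · by_cases h2 : j.1 / 2 = k + 1
      · have hjA : j ∈ A := by simp [A, h2]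
        rw [if_pos hjA, same j ⟨i.1 + 2, hi⟩ (by simp only; omega), same (m.mate j) i]
        · apply le_of_eq; ring
        · simp only [hm, swapMatching]
          split_ifs <;> omega
      · have hjA : j ∉ A := by simp [A, h1, h2]
        rw [if_neg hjA, same j (m.mate j)]
        · simp
        · simp only [hm, swapMatching]
          split_ifs <;> omega
  rw [Finset.sum_ite_mem, Finset.univ_inter, Finset.sum_const, nsmul_eq_mul] at hsum
  have h4 : (A.card : ℝ) ≤ 4 := by exact_mod_cast hA
  nlinarith [sq_nonneg (u i - u ⟨i.1 + 2, hi⟩)]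

theorem minGap_pos {u : Item N → ℝ} (hN : 2 ≤ N) (hu : ∀ i, u (twin i) = u i) {mStar : Matching N}
    (hm : ∀ m : Matching N, m ≠ mStar → m.value u < mStar.value u) : 0 < minGap u mStar := by
  have hfin : {g : ℝ | ∃ m : Matching N, m ≠ mStar ∧ g = mStar.value u - m.value u}.Finite :=
    (Set.finite_range (fun m : Matching N => mStar.value u - m.value u)).subset
      (by rintro _ ⟨m, _, rfl⟩; exact ⟨m, rfl⟩)
  have hne : {g : ℝ | ∃ m : Matching N, m ≠ mStar ∧ g = mStar.value u - m.value u}.Nonempty :=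
    ⟨_, swapMatching N 0 (by omega), by
      rw [eq_twinMatching hu hm]; exact swapMatching_ne 0 _, rfl⟩
  obtain ⟨m, hne', heq⟩ := hne.csInf_mem hfin
  rw [minGap, heq]
  linarith [hm m hne']

theorem minGap_le {u : Item N → ℝ} {mStar : Matching N}
    (hm : ∀ m : Matching N, m ≠ mStar → m.value u < mStar.value u) (m : Matching N)
    (hne : m ≠ mStar) : minGap u mStar ≤ mStar.value u - m.value u := by
  refine csInf_le ⟨0, ?_⟩ ⟨m, hne, rfl⟩
  rintro _ ⟨m', h', rfl⟩
  linarith [hm m' h']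

/-- The swap of neighbouring pairs competes in `minGap`, so these pairs differ by at least `δ`;
monotonicity extends this to all distinct values. Adding up the steps from the last pair gives
`index_le`. -/
theorem paired_of_unique {u : Item N → ℝ} (hN : 2 ≤ N) (h01 : ∀ i, u i ∈ Set.Ioo (0 : ℝ) 1)
    (hanti : Antitone u) (hu : ∀ i, u (twin i) = u i) {mStar : Matching N}
    (hm : ∀ m : Matching N, m ≠ mStar → m.value u < mStar.value u) :
    Paired u (Real.sqrt (minGap u mStar)) := by
  have hgap := minGap_pos hN hu hm
  set δ := Real.sqrt (minGap u mStar) with hδ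
  have hδpos : 0 < δ := Real.sqrt_pos.2 hgap
  have adj : ∀ (i : Item N) (hi : i.1 + 2 < 2 * N), δ ≤ u i - u ⟨i.1 + 2, hi⟩ := by
    intro i hi
    have h1 := swapMatching_loss_le hu i hi
    have h2 := minGap_le hm (swapMatching N (i.1 / 2) (by omega))
      (by rw [eq_twinMatching hu hm]; exact swapMatching_ne _ _)
    rw [eq_twinMatching hu hm] at h2
    have h3 : u ⟨i.1 + 2, hi⟩ ≤ u i := hanti (Fin.le_def.2 (by simp))
    refine (Real.sqrt_le_sqrt ?_).trans (Real.sqrt_sq (sub_nonneg.2 h3)).le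
    rw [eq_twinMatching hu hm]
    exact h2.trans h1
  refine ⟨hN, fun i => (h01 i).1, fun i => (h01 i).2, hu, hδpos, ?_, ?_⟩
  · intro i j hij
    have hij' : i.1 / 2 < j.1 / 2 := by
      by_contra hle
      have hle' : j.1 / 2 ≤ i.1 / 2 := not_lt.1 hle
      have : u i ≤ u j := by
        by_cases hji : j ≤ i
        · exact hanti hji
        · rw [← hu j]
          refine hanti (Fin.le_def.2 ?_)
          rw [twin_val]
          have : ¬ j.1 ≤ i.1 := fun h => hji (Fin.le_def.2 h)
          omega
      linarith
    have hj := j.2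
    have h1 := adj i (by omega)
    by_cases hle : i.1 + 2 ≤ j.1
    · have : u j ≤ u ⟨i.1 + 2, by omega⟩ := hanti (Fin.le_def.2 hle)
      linarith
    -- Here `j = i + 1` opens the next pair, so that its twin is `i + 2`.
    · have : u (twin j) ≤ u ⟨i.1 + 2, by omega⟩ := by
        refine hanti (Fin.le_def.2 ?_)
        rw [twin_val]; simp only; omega
      rw [hu] at this
      linarith
  · have key : ∀ d : ℕ, ∀ i : Item N, i.1 / 2 + d = N - 1 → δ * d ≤ u i := by
      intro d
      induction d with
      | zero => intro i _; simpa using (h01 i).1.le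
      | succ d ih =>
        intro i hi
        have h1 := adj i (by omega)
        have h2 := ih ⟨i.1 + 2, by omega⟩ (by simp only; omega)
        push_cast
        linarith
    intro i
    have hi := i.2
    have h := key (N - 1 - i.1 / 2) i (by omega)
    have e : ((N - 1 - i.1 / 2 : ℕ) : ℝ) = N - 1 - (i.1 / 2 : ℕ) := by
      rw [Nat.cast_sub (by omega), Nat.cast_sub (by omega)]; simp
    rwa [e] at h

theorem regret_eq {u : Item N → ℝ} (hu : ∀ i, u (twin i) = u i) (T : ℕ) (p : ℕ → Matching N) :
    4 * regret u T p = ∑ t ∈ Finset.Icc 1 T, ∑ i, (u i - u ((p t).mate i)) ^ 2 := by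
  have hsup : (⨆ m : Matching N, m.value u) = (twinMatching N).value u := by
    refine le_antisymm (ciSup_le fun m => ?_) (le_ciSup (Set.finite_range _).bddAbove _)
    have h2 := m.loss_eq u hu
    have h3 : 0 ≤ ∑ i, (u i - u (m.mate i)) ^ 2 := Finset.sum_nonneg fun i _ => sq_nonneg _
    linarith
  rw [regret, hsup]
  have h : ∀ t ∈ Finset.Icc 1 T, ∑ i, (u i - u ((p t).mate i)) ^ 2 =
      4 * ((twinMatching N).value u - (p t).value u) := fun t _ => ((p t).loss_eq u hu).symm
  rw [Finset.sum_congr rfl h, ← Finset.mul_sum, Finset.sum_sub_distrib]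
  simp

theorem Paired.abs_sub_le {u : Item N → ℝ} {δ : ℝ} (h : Paired u δ) (i j : Item N) :
    (u i - u j) ^ 2 ≤ 1 := by
  have h1 := h.pos i; have h2 := h.pos j; have h3 := h.lt_one i; have h4 := h.lt_one j
  nlinarith

theorem Paired.regret_le {u : Item N → ℝ} {δ : ℝ} (h : Paired u δ) (T : ℕ) (p : ℕ → Matching N) :
    regret u T p ≤ N * T := by
  have h1 := regret_eq h.twin_eq T p
  have h2 : ∑ t ∈ Finset.Icc 1 T, ∑ i, (u i - u ((p t).mate i)) ^ 2 ≤
      ∑ t ∈ Finset.Icc 1 T, ∑ _i : Item N, (1 : ℝ) :=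
    Finset.sum_le_sum fun t _ => Finset.sum_le_sum fun i _ => h.abs_sub_le _ _
  simp only [Finset.sum_const, Finset.card_univ, Fintype.card_fin, nsmul_eq_mul, mul_one,
    Nat.card_Icc, Nat.add_sub_cancel] at h2
  push_cast at h2
  have : (0 : ℝ) ≤ N * T := by positivity
  nlinarith

theorem Paired.regret_nonneg {u : Item N → ℝ} {δ : ℝ} (h : Paired u δ) (T : ℕ)
    (p : ℕ → Matching N) : 0 ≤ regret u T p := by
  have h1 := regret_eq h.twin_eq T p
  have h2 : 0 ≤ ∑ t ∈ Finset.Icc 1 T, ∑ i, (u i - u ((p t).mate i)) ^ 2 :=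
    Finset.sum_nonneg fun t _ => Finset.sum_nonneg fun i _ => sq_nonneg _
  linarith

/-- A set of items that is closed under `twin` has even size. -/
theorem even_card_of_twin {S : Finset (Item N)} (hS : ∀ i ∈ S, twin i ∈ S) : Even S.card := by
  have h : ∑ i ∈ S, (1 : ZMod 2) = 0 := by
    refine Finset.sum_involution (fun i _ => twin i) ?_ ?_ ?_ ?_
    · intro i _; decide
    · intro i _ _; exact (twinMatching N).mate_ne i
    · intro i hi; exact hS i hi
    · intro i _; exact (twinMatching N).mate_mate i
  rw [Finset.sum_const, nsmul_eq_mul, mul_one] at h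
  exact (ZMod.natCast_eq_zero_iff_even).1 h

/-- The sum of the parameters of `S` is at least of order `δ |S|²`. -/
theorem Paired.le_sum {u : Item N → ℝ} {δ : ℝ} (h : Paired u δ) (S : Finset (Item N))
    (hS : 4 ≤ S.card) : δ * (S.card : ℝ) ^ 2 ≤ 16 * ∑ i ∈ S, u i := by
  -- At most `2 * q ≤ |S| / 2` items lie in the last `q` pairs, and every other item has parameter
  -- at least `δ * q`.
  set q := S.card / 4 with hq
  let B := S.filter fun i => N - 1 - i.1 / 2 < q
  have hB : B.card ≤ 2 * q := by
    have : B.card ≤ (Finset.Ico (2 * N - 2 * q) (2 * N)).card := by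
      refine Finset.card_le_card_of_injOn (fun j => j.1) ?_ (fun a _ b _ h => Fin.ext h)
      intro j hj
      simp only [B, Finset.coe_filter, Set.mem_ofPred_eq] at hj
      simp only [Finset.coe_Ico, Set.mem_Ico]
      have := j.2
      omega
    rw [Nat.card_Ico] at this
    omega
  have hcard : B.card + (S.filter fun i => ¬ N - 1 - i.1 / 2 < q).card = S.card :=
    Finset.card_filter_add_card_filter_not _
  set G := S.filter fun i => ¬ N - 1 - i.1 / 2 < q with hG
  have h1 : ∑ i ∈ G, δ * q ≤ ∑ i ∈ G, u i := by
    refine Finset.sum_le_sum fun i hi => ?_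
    have hi' := (Finset.mem_filter.1 hi).2
    have h2 := h.index_le i
    have h3 : (q : ℝ) ≤ N - 1 - (i.1 / 2 : ℕ) := by
      have hi2 := i.2
      have : q + 1 + i.1 / 2 ≤ N := by omega
      have : ((q + 1 + i.1 / 2 : ℕ) : ℝ) ≤ N := by exact_mod_cast this
      push_cast at this ⊢
      linarith
    have := mul_le_mul_of_nonneg_left h3 h.delta_pos.le
    linarith
  have h2 : ∑ i ∈ G, u i ≤ ∑ i ∈ S, u i :=
    Finset.sum_le_sum_of_subset_of_nonneg (Finset.filter_subset _ _) fun i _ _ => (h.pos i).le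
  rw [Finset.sum_const, nsmul_eq_mul] at h1
  have h3 : (S.card : ℝ) ≤ 2 * G.card := by
    have : S.card ≤ 2 * G.card := by omega
    exact_mod_cast this
  have h4 : (S.card : ℝ) ≤ 8 * q := by
    have : S.card ≤ 8 * q := by omega
    exact_mod_cast this
  have h5 : (S.card : ℝ) ^ 2 ≤ 16 * (G.card * q) := by
    have : (0 : ℝ) ≤ S.card := by positivity
    nlinarith
  have := mul_le_mul_of_nonneg_left h5 h.delta_pos.le
  nlinarith

/-- If every cut of `S` by the value of `f` is bridged by a step of size at most `g`, then `f` varies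
by at most `|S| g` on `S`. -/
theorem sub_le_card_mul {ι : Type*} (S : Finset ι) (f : ι → ℝ) (g : ℝ) (hg : 0 ≤ g)
    (h : ∀ θ : ℝ, (∃ a ∈ S, θ < f a) → (∃ b ∈ S, f b ≤ θ) →
      ∃ a ∈ S, ∃ b ∈ S, θ < f a ∧ f b ≤ θ ∧ f a - f b ≤ g)
    (x y : ι) (hx : x ∈ S) (hy : y ∈ S) : f x - f y ≤ S.card * g := by
  classical
  -- Raise a threshold from `f y` in steps of `g`. As long as it is below `f x`, the bridge across
  -- it puts at least one new item below the next threshold, which can happen fewer than `|S|`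
  -- times.
  have key : ∀ m : ℕ, f x ≤ f y + m * g ∨ m + 1 ≤ (S.filter fun a => f a ≤ f y + m * g).card := by
    intro m
    induction m with
    | zero =>
      right
      exact Finset.card_pos.2 ⟨y, by simp [hy]⟩
    | succ m ih =>
      by_cases hxm : f x ≤ f y + m * g
      · left; push_cast; linarith
      · rcases ih with h' | h'
        · exact absurd h' hxm
        right
        obtain ⟨a, ha, b, hb, h1, h2, h3⟩ := h (f y + m * g) ⟨x, hx, not_le.1 hxm⟩
          ⟨y, hy, by have : 0 ≤ m * g := by positivity
                     linarith⟩
        refine (Nat.succ_le_succ h').trans (Nat.succ_le_of_lt (Finset.card_lt_card ?_))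
        rw [Finset.ssubset_iff_of_subset]
        · refine ⟨a, ?_, ?_⟩
          · simp only [Finset.mem_filter, ha, true_and]; push_cast; linarith
          · simp only [Finset.mem_filter, ha, true_and]; exact not_le.2 h1
        · intro c hc
          simp only [Finset.mem_filter] at hc ⊢
          refine ⟨hc.1, ?_⟩
          push_cast
          linarith [hc.2]
  rcases key S.card with h' | h'
  · linarith
  · exact absurd (h'.trans (Finset.card_filter_le _ _)) (by omega)

/-! ### Ordered sequences of clusters -/

/-- Items of earlier clusters have larger parameters. -/
def Ordered (u : Item N → ℝ) (L : List (Finset (Item N))) : Prop :=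
  L.Pairwise fun A B => ∀ a ∈ A, ∀ b ∈ B, u b < u a

/-- Every item lies in a cluster. -/
def Covers (L : List (Finset (Item N))) : Prop := ∀ i, ∃ S ∈ L, i ∈ S

theorem clusterOf_cons_of_mem {L : List (Finset (Item N))} {S : Finset (Item N)} {i : Item N}
    (h : i ∈ S) : clusterOf (S :: L) i = S := by
  simp [clusterOf, h]

theorem clusterOf_cons_of_notMem {L : List (Finset (Item N))} {S : Finset (Item N)} {i : Item N}
    (h : i ∉ S) : clusterOf (S :: L) i = clusterOf L i := by
  simp [clusterOf, h]

theorem Ordered.clusterOf_eq {u : Item N → ℝ} {L : List (Finset (Item N))} (hL : Ordered u L)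
    {S : Finset (Item N)} (hS : S ∈ L) {i : Item N} (hi : i ∈ S) : clusterOf L i = S := by
  induction L with
  | nil => simp at hS
  | cons S' L ih =>
    rw [Ordered, List.pairwise_cons] at hL
    rcases List.mem_cons.1 hS with rfl | hS
    · exact clusterOf_cons_of_mem hi
    · have : i ∉ S' := fun h => lt_irrefl _ (hL.1 S hS i h i hi)
      rw [clusterOf_cons_of_notMem this]
      exact ih hL.2 hS

theorem Ordered.mem_upTo_iff {u : Item N → ℝ} {L : List (Finset (Item N))} (hL : Ordered u L)
    {i j : Item N} (hi : ∃ S ∈ L, i ∈ S) (hj : ∃ S ∈ L, j ∈ S) :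
    j ∈ upTo L i ↔ j ∈ clusterOf L i ∨ u i < u j := by
  induction L with
  | nil => simp at hi
  | cons S L ih =>
    rw [Ordered, List.pairwise_cons] at hL
    rw [upTo]
    split_ifs with his
    · rw [clusterOf_cons_of_mem his]
      refine ⟨Or.inl, ?_⟩
      rintro (h | h)
      · exact h
      · obtain ⟨S', hS', hj'⟩ := hj
        rcases List.mem_cons.1 hS' with rfl | hS'
        · exact hj'
        · exact absurd (hL.1 S' hS' i his j hj') (not_lt.2 h.le)
    · rw [clusterOf_cons_of_notMem his]
      have hi' : ∃ S ∈ L, i ∈ S := by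
        obtain ⟨S', hS', hi'⟩ := hi
        rcases List.mem_cons.1 hS' with rfl | hS'
        · exact absurd hi' his
        · exact ⟨S', hS', hi'⟩
      rw [Finset.mem_union]
      by_cases hjs : j ∈ S
      · obtain ⟨S', hS', hi''⟩ := hi'
        simp only [hjs, true_or, true_iff]
        exact Or.inr (hL.1 S' hS' j hjs i hi'')
      · have hj' : ∃ S ∈ L, j ∈ S := by
          obtain ⟨S', hS', hj'⟩ := hj
          rcases List.mem_cons.1 hS' with rfl | hS'
          · exact absurd hj' hjs
          · exact ⟨S', hS', hj'⟩
        simp only [hjs, false_or]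
        exact ih hL.2 hi' hj'

/-! ### Splitting a cluster -/

/-- No cut of `S` separates the confidence intervals. -/
def Linked (Qhi Qlo : Item N → EReal) (S : Finset (Item N)) : Prop :=
  ∀ A ⊆ S, A.Nonempty → A ≠ S → ∃ a ∈ A, ∃ b ∈ S, b ∉ A ∧ Qlo a ≤ Qhi b

/-- On `S` the lower bounds are ordered as the upper ones. -/
def Aligned (Qhi Qlo : Item N → EReal) (S : Finset (Item N)) : Prop :=
  ∀ a ∈ S, ∀ b ∈ S, Qhi a ≤ Qhi b → Qlo a ≤ Qlo b

/-- The items of `S` by decreasing upper confidence bound. -/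
def ranking (Qhi : Item N → EReal) (S : Finset (Item N)) : List (Item N) :=
  ((List.finRange (2 * N)).filter (fun i => decide (i ∈ S))).mergeSort
    (fun a b => decide (Qhi b ≤ Qhi a))

theorem mem_ranking {Qhi : Item N → EReal} {S : Finset (Item N)} {i : Item N} :
    i ∈ ranking Qhi S ↔ i ∈ S := by
  simp [ranking, List.mem_mergeSort]

theorem pairwise_ranking (Qhi : Item N → EReal) (S : Finset (Item N)) :
    (ranking Qhi S).Pairwise fun a b => Qhi b ≤ Qhi a := by
  have := List.pairwise_mergeSort (le := fun a b => decide (Qhi b ≤ Qhi a))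
    (by intro a b c h1 h2; simp only [decide_eq_true_eq] at *; exact h2.trans h1)
    (by intro a b; simp only [Bool.or_eq_true, decide_eq_true_eq]; exact le_total _ _)
    ((List.finRange (2 * N)).filter (fun i => decide (i ∈ S)))
  simpa [ranking] using this

/-- The pieces into which the ranking of `S` is cut. -/
def pieces (Qhi Qlo : Item N → EReal) (S : Finset (Item N)) : List (List (Item N)) :=
  (ranking Qhi S).splitBy fun a b => decide (¬ Qhi b < Qlo a)

theorem splitCluster_eq (Qhi Qlo : Item N → EReal) (S : Finset (Item N)) :
    splitCluster Qhi Qlo S = (pieces Qhi Qlo S).map List.toFinset := rfl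

/-- The cut compares only two consecutive items. Upper bounds decrease along the list, and by
`Aligned` the last item of a piece has its smallest lower bound, so the cut separates that piece
from everything that follows. -/
theorem pairwise_of_cuts {Qhi Qlo : Item N → EReal} {S : Finset (Item N)}
    (hS : Aligned Qhi Qlo S) (P : List (List (Item N))) (hP : ∀ c ∈ P, ∀ x ∈ c, x ∈ S)
    (hsort : P.flatten.Pairwise fun a b => Qhi b ≤ Qhi a)
    (hcut : P.IsChain fun a b => ∃ ha hb, decide (¬ Qhi (b.head hb) < Qlo (a.getLast ha)) = false) :
    P.Pairwise fun c d => ∀ x ∈ c, ∀ y ∈ d, Qhi y < Qlo x := by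
  induction P with
  | nil => exact List.Pairwise.nil
  | cons c P ih =>
    have hsort' : P.flatten.Pairwise fun a b => Qhi b ≤ Qhi a := by
      rw [List.flatten_cons, List.pairwise_append] at hsort
      exact hsort.2.1
    refine List.pairwise_cons.2 ⟨?_, ih (fun c' h => hP c' (List.mem_cons_of_mem _ h)) hsort'
      (List.isChain_cons.1 hcut).2⟩
    cases P with
    | nil => simp
    | cons d P =>
      obtain ⟨⟨ha, hb, h⟩, -⟩ := List.isChain_cons_cons.1 hcut
      simp only [decide_eq_false_iff_not, not_not] at h
      intro e he x hx y hy
      have hxc : Qhi (c.getLast ha) ≤ Qhi x := by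
        rw [List.flatten_cons, List.pairwise_append] at hsort
        have h1 := hsort.1
        rw [← List.dropLast_append_getLast ha, List.pairwise_append] at h1
        rw [← List.dropLast_append_getLast ha, List.mem_append] at hx
        rcases hx with hx | hx
        · exact h1.2.2 x hx _ (by simp)
        · rw [List.mem_singleton.1 hx]
      have hyd : Qhi y ≤ Qhi (d.head hb) := by
        have hy' : y ∈ (d :: P).flatten := List.mem_flatten.2 ⟨e, he, hy⟩
        obtain ⟨d0, d', rfl⟩ := List.exists_cons_of_ne_nil hb
        rw [List.flatten_cons, List.cons_append] at hsort' hy'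
        rw [List.pairwise_cons] at hsort'
        rcases List.mem_cons.1 hy' with rfl | hy'
        · exact le_rfl
        · exact hsort'.1 y hy'
      refine lt_of_le_of_lt hyd (lt_of_lt_of_le h (hS _ ?_ _ ?_ hxc))
      · exact hP c (by simp) _ (List.getLast_mem ha)
      · exact hP c (by simp) _ hx

theorem exists_adjacent_of_isChain {α : Type*} {R : α → α → Prop} {P : α → Prop} {l : List α}
    (hl : l.IsChain R) (h0 : ∀ a ∈ l.head?, P a) (h1 : ∃ b ∈ l, ¬ P b) :
    ∃ a ∈ l, ∃ b ∈ l, P a ∧ ¬ P b ∧ R a b := by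
  induction l with
  | nil => simp at h1
  | cons x l ih =>
    have hx : P x := h0 x (by simp)
    cases l with
    | nil => obtain ⟨b, hb, hPb⟩ := h1; simp at hb; exact absurd (hb ▸ hx) hPb
    | cons y l =>
      rw [List.isChain_cons_cons] at hl
      by_cases hy : P y
      · obtain ⟨b, hb, hPb⟩ := h1
        have hb' : b ∈ y :: l := by
          rcases List.mem_cons.1 hb with rfl | hb
          · exact absurd hx hPb
          · exact hb
        obtain ⟨a, ha, b, hb, h⟩ := ih hl.2 (by simpa using hy) ⟨b, hb', hPb⟩
        exact ⟨a, List.mem_cons_of_mem _ ha, b, List.mem_cons_of_mem _ hb, h⟩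
      · exact ⟨x, by simp, y, by simp, hx, hy, hl.1⟩

section Split

variable {Qhi Qlo : Item N → EReal} {S : Finset (Item N)}

theorem exists_piece_iff {i : Item N} : (∃ c ∈ pieces Qhi Qlo S, i ∈ c) ↔ i ∈ S := by
  rw [← List.mem_flatten, pieces, List.flatten_splitBy, mem_ranking]

theorem subset_of_mem_splitCluster {A : Finset (Item N)} (hA : A ∈ splitCluster Qhi Qlo S) :
    A ⊆ S := by
  rw [splitCluster_eq, List.mem_map] at hA
  obtain ⟨c, hc, rfl⟩ := hA
  intro i hi
  exact exists_piece_iff.1 ⟨c, hc, List.mem_toFinset.1 hi⟩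

theorem nonempty_of_mem_splitCluster {A : Finset (Item N)} (hA : A ∈ splitCluster Qhi Qlo S) :
    A.Nonempty := by
  rw [splitCluster_eq, List.mem_map] at hA
  obtain ⟨c, hc, rfl⟩ := hA
  rw [List.toFinset_nonempty_iff]
  exact List.ne_nil_of_mem_splitBy hc

theorem exists_mem_splitCluster {i : Item N} (hi : i ∈ S) :
    ∃ A ∈ splitCluster Qhi Qlo S, i ∈ A := by
  obtain ⟨c, hc, hic⟩ := exists_piece_iff.2 hi
  exact ⟨c.toFinset, List.mem_map.2 ⟨c, hc, rfl⟩, List.mem_toFinset.2 hic⟩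

theorem pairwise_pieces (hS : Aligned Qhi Qlo S) :
    (pieces Qhi Qlo S).Pairwise fun c d => ∀ x ∈ c, ∀ y ∈ d, Qhi y < Qlo x := by
  refine pairwise_of_cuts hS _ (fun c hc x hx => exists_piece_iff.1 ⟨c, hc, hx⟩) ?_
    (List.isChain_getLast_head_splitBy (fun a b => decide (¬ Qhi b < Qlo a)) (ranking Qhi S))
  rw [pieces, List.flatten_splitBy]
  exact pairwise_ranking _ _

theorem pairwise_splitCluster (hS : Aligned Qhi Qlo S) :
    (splitCluster Qhi Qlo S).Pairwise fun A B => ∀ x ∈ A, ∀ y ∈ B, Qhi y < Qlo x := by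
  rw [splitCluster_eq, List.pairwise_map]
  simpa using pairwise_pieces hS

/-- If `A` contains the head of the piece, some consecutive pair leaves `A`, and the list was not
cut there. Otherwise the head, having the largest upper bound, overlaps with every item of `A`. -/
theorem linked_of_mem_splitCluster (hle : ∀ i, Qlo i ≤ Qhi i) {A : Finset (Item N)}
    (hA : A ∈ splitCluster Qhi Qlo S) : Linked Qhi Qlo A := by
  rw [splitCluster_eq, List.mem_map] at hA
  obtain ⟨c, hc, rfl⟩ := hA
  intro A hAc hne hneq
  by_contra hcon
  push Not at hcon
  have hsort : c.Pairwise fun a b => Qhi b ≤ Qhi a := by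
    have h := pairwise_ranking Qhi S
    have hfl : (pieces Qhi Qlo S).flatten = ranking Qhi S := List.flatten_splitBy _ _
    rw [← hfl, List.pairwise_flatten] at h
    exact h.1 c hc
  have hchain := List.isChain_of_mem_splitBy hc
  have hout : ∃ b ∈ c, b ∉ A := by
    by_contra hall
    push Not at hall
    exact hneq (hAc.antisymm fun b hb => hall b (List.mem_toFinset.1 hb))
  obtain ⟨a, -, b, hb, hPa, hPb, hR⟩ := exists_adjacent_of_isChain (P := fun i => i ∈ A) hchain
    (by
      intro x hx
      cases c with
      | nil => simp at hx
      | cons y c =>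
        simp only [List.head?_cons, Option.mem_some_iff] at hx
        subst hx
        by_contra hxA
        obtain ⟨a, ha⟩ := hne
        have h1 := hcon a ha y (by simp) hxA
        have hac := List.mem_toFinset.1 (hAc ha)
        rcases List.mem_cons.1 hac with rfl | hac
        · exact hxA ha
        · have h2 := (List.pairwise_cons.1 hsort).1 a hac
          exact absurd (h1.trans_le ((hle a).trans h2)) (lt_irrefl _)) hout
  simp only [decide_eq_true_eq] at hR
  exact hR (hcon a hPa b (List.mem_toFinset.2 hb) hPb)

/-- With two pieces, the first would be a proper subset without overlap with the rest. Hence a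
cluster can change only when its intervals do. -/
theorem splitCluster_eq_singleton (hle : ∀ i, Qlo i ≤ Qhi i) (hS : Aligned Qhi Qlo S)
    (hlink : Linked Qhi Qlo S) (hne : S.Nonempty) : splitCluster Qhi Qlo S = [S] := by
  have hpw := pairwise_splitCluster hS
  have hsub := fun A => subset_of_mem_splitCluster (Qhi := Qhi) (Qlo := Qlo) (S := S) (A := A)
  have hnon := fun A => nonempty_of_mem_splitCluster (Qhi := Qhi) (Qlo := Qlo) (S := S) (A := A)
  have hcov := fun i => exists_mem_splitCluster (Qhi := Qhi) (Qlo := Qlo) (S := S) (i := i)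
  generalize splitCluster Qhi Qlo S = P at *
  match P with
  | [] => obtain ⟨i, hi⟩ := hne; simpa using hcov i hi
  | [A] =>
    congr
    refine (hsub A (by simp)).antisymm fun i hi => ?_
    simpa using hcov i hi
  | A :: B :: P =>
    exfalso
    rw [List.pairwise_cons] at hpw
    obtain ⟨y, hy⟩ := hnon B (by simp)
    have hyA : y ∉ A := fun h =>
      absurd (hpw.1 B (by simp) y h y hy) (not_lt.2 (hle y))
    obtain ⟨a, ha, b, hb, hbA, hab⟩ := hlink A (hsub A (by simp)) (hnon A (by simp))
      (by rintro rfl; exact hyA (hsub B (by simp) hy))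
    obtain ⟨B', hB', hbB⟩ := hcov b hb
    rcases List.mem_cons.1 hB' with rfl | hB'
    · exact hbA hbB
    · exact absurd (hpw.1 B' hB' a ha b hbB) (not_lt.2 hab)

end Split

/-! ### One iteration -/

section StepFields

variable (T : ℕ) (m : Matching N) (x : Item N → Item N → ℝ) (s : State N)

/-- The buffered counts after `m` has been played. -/
def countBuffer (i j : Item N) : ℕ := s.Cbuf i j + if m.mate i = j then 1 else 0

/-- The tournament of the cluster of `i` is complete after `m` has been played. -/
def Done (i : Item N) : Prop := Complete (countBuffer m s) (clusterOf s.clusters i)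

/-- The number of recorded samples of `i` against its own and the better clusters. -/
def sampleCount (i : Item N) : ℕ := ∑ j ∈ upTo s.clusters i, (step T m x s).C i j

/-- The mean of the recorded samples of `i` against its own and the better clusters. -/
def sampleMean (i : Item N) : ℝ :=
  (∑ j ∈ upTo s.clusters i, (step T m x s).X i j) / sampleCount T m x s i

/-- The confidence interval of `i` is updated. -/
def Refresh (i : Item N) : Prop :=
  Done m s i ∧ ∃ l : ℕ, 0 < l ∧ level T l ≤ sampleCount T m x s i ∧
    sampleCount T m x s i < level T l + ((clusterOf s.clusters i).card - 1)

open Classical in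
theorem step_C (i j : Item N) : (step T m x s).C i j =
    if Done m s i then s.C i j + countBuffer m s i j else s.C i j := rfl

open Classical in
theorem step_Cbuf (i j : Item N) : (step T m x s).Cbuf i j =
    if Done m s i then 0 else countBuffer m s i j := rfl

open Classical in
theorem step_X (i j : Item N) : (step T m x s).X i j =
    if Done m s i then s.X i j + (s.Xbuf i j + if m.mate i = j then x i j else 0)
    else s.X i j := rfl

open Classical in
theorem step_Xbuf (i j : Item N) : (step T m x s).Xbuf i j =
    if Done m s i then 0 else s.Xbuf i j + if m.mate i = j then x i j else 0 := rfl

open Classical in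
theorem step_Qhi (i : Item N) : (step T m x s).Qhi i =
    if Refresh T m x s i then
      ((sampleMean T m x s i + Real.sqrt (Real.log T / sampleCount T m x s i) : ℝ) : EReal)
    else s.Qhi i := by
  by_cases h : Refresh T m x s i
  · rw [if_pos h]; exact if_pos h
  · rw [if_neg h]; exact if_neg h

open Classical in
theorem step_Qlo (i : Item N) : (step T m x s).Qlo i =
    if Refresh T m x s i then
      ((sampleMean T m x s i - Real.sqrt (Real.log T / sampleCount T m x s i) : ℝ) : EReal)
    else s.Qlo i := by
  by_cases h : Refresh T m x s i
  · rw [if_pos h]; exact if_pos h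
  · rw [if_neg h]; exact if_neg h

theorem step_clusters : (step T m x s).clusters =
    s.clusters.flatMap (splitCluster (step T m x s).Qhi (step T m x s).Qlo) := rfl

/-- Completing a tournament only moves samples from the buffer to the record, so the total of both
is a plain sum over time. -/
theorem step_count_total (i j : Item N) : (step T m x s).C i j + (step T m x s).Cbuf i j =
    s.C i j + s.Cbuf i j + if m.mate i = j then 1 else 0 := by
  rw [step_C, step_Cbuf]
  split_ifs <;> simp [countBuffer, *] <;> ring

theorem step_reward_total (i j : Item N) : (step T m x s).X i j + (step T m x s).Xbuf i j =
    s.X i j + s.Xbuf i j + if m.mate i = j then x i j else 0 := by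
  rw [step_X, step_Xbuf]
  split_ifs <;> ring

end StepFields

/-! ### Sums of noise and the concentration event -/

/-- The sum of the noise in all samples of `i` against `U`. -/
def noiseSum (u : Item N → ℝ) (s : State N) (i : Item N) (U : Finset (Item N)) : ℝ :=
  ∑ j ∈ U, (s.X i j + s.Xbuf i j - u i * u j * (s.C i j + s.Cbuf i j : ℕ))

/-- The number of samples of `i` against `U`. -/
def playCount (s : State N) (i : Item N) (U : Finset (Item N)) : ℕ :=
  ∑ j ∈ U, (s.C i j + s.Cbuf i j)

/-- All sums of noise are within their confidence radius. -/
def Concentrated (u : Item N → ℝ) (T : ℕ) (s : State N) : Prop :=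
  ∀ i U, |noiseSum u s i U| ≤ Real.sqrt (playCount s i U * Real.log T)

/-! ### Items of a common cluster -/

theorem Ordered.trichotomy {u : Item N → ℝ} {L : List (Finset (Item N))} (hL : Ordered u L)
    {A B : Finset (Item N)} (hA : A ∈ L) (hB : B ∈ L) :
    A = B ∨ (∀ a ∈ A, ∀ b ∈ B, u b < u a) ∨ (∀ a ∈ A, ∀ b ∈ B, u a < u b) := by
  induction L with
  | nil => simp at hA
  | cons S L ih =>
    rw [Ordered, List.pairwise_cons] at hL
    rcases List.mem_cons.1 hA with rfl | hA' <;> rcases List.mem_cons.1 hB with rfl | hB'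
    · exact Or.inl rfl
    · exact Or.inr (Or.inl (hL.1 B hB'))
    · exact Or.inr (Or.inr fun a ha b hb => hL.1 A hA' b hb a ha)
    · exact ih hL.2 hA' hB'

theorem Ordered.mem_of_eq {u : Item N → ℝ} {L : List (Finset (Item N))} (hL : Ordered u L)
    (hc : Covers L) {S : Finset (Item N)} (hS : S ∈ L) {i j : Item N} (hi : i ∈ S)
    (hij : u j = u i) : j ∈ S := by
  obtain ⟨A, hA, hj⟩ := hc j
  rcases hL.trichotomy hS hA with rfl | h | h
  · exact hj
  · exact absurd (h i hi j hj) (by rw [hij]; exact lt_irrefl _)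
  · exact absurd (h i hi j hj) (by rw [hij]; exact lt_irrefl _)

theorem Ordered.forall_lt {u : Item N → ℝ} {L : List (Finset (Item N))} (hL : Ordered u L)
    (hc : Covers L) {S : Finset (Item N)} (hS : S ∈ L) {i j : Item N} (hi : i ∈ S)
    (hij : u i < u j) (hj : j ∉ S) : ∀ k ∈ S, u k < u j := by
  obtain ⟨A, hA, hjA⟩ := hc j
  rcases hL.trichotomy hS hA with rfl | h | h
  · exact absurd hjA hj
  · exact absurd (h i hi j hjA) (not_lt.2 hij.le)
  · exact fun k hk => h k hk j hjA

theorem Ordered.mem_upTo {u : Item N → ℝ} {L : List (Finset (Item N))} (hL : Ordered u L)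
    (hc : Covers L) {S : Finset (Item N)} (hS : S ∈ L) {i j : Item N} (hi : i ∈ S) :
    j ∈ upTo L i ↔ j ∈ S ∨ u i < u j := by
  rw [hL.mem_upTo_iff (hc i) (hc j), hL.clusterOf_eq hS hi]

theorem Ordered.upTo_eq {u : Item N → ℝ} {L : List (Finset (Item N))} (hL : Ordered u L)
    (hc : Covers L) {S : Finset (Item N)} (hS : S ∈ L) {i j : Item N} (hi : i ∈ S) (hj : j ∈ S) :
    upTo L i = upTo L j := by
  ext k
  rw [hL.mem_upTo hc hS hi, hL.mem_upTo hc hS hj]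
  by_cases hk : k ∈ S
  · simp [hk]
  · simp only [hk, false_or]
    exact ⟨fun h => hL.forall_lt hc hS hi h hk j hj, fun h => hL.forall_lt hc hS hj h hk i hi⟩

/-! ### Symmetry of the recorded counts -/

/-- Counts of meetings with the symmetry of round-robin tournaments on `S`. -/
structure Exchangeable (C : Item N → Item N → ℕ) (S : Finset (Item N)) : Prop where
  symm : ∀ i j, C i j = C j i
  self : ∀ i, C i i = 0
  exch : ∀ i ∈ S, ∀ i' ∈ S, ∀ j, j ≠ i → j ≠ i' → C i j = C i' j

namespace Exchangeable

variable {C : Item N → Item N → ℕ} {S U : Finset (Item N)}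

theorem sum_mul_eq (h : Exchangeable C S) {a b : Item N} (hab : a ≠ b) (ha : a ∈ U) (hb : b ∈ U)
    (f : Item N → ℝ) : ∑ j ∈ U, (C a j : ℝ) * f j =
      ∑ j ∈ (U.erase a).erase b, (C a j : ℝ) * f j + C a b * f b := by
  rw [← Finset.add_sum_erase U _ ha, h.self, Finset.sum_erase_add]
  · simp
  · exact Finset.mem_erase.2 ⟨hab.symm, hb⟩

theorem sum_mul_eq' (h : Exchangeable C S) {a b : Item N} (hab : a ≠ b) (haS : a ∈ S) (hbS : b ∈ S)
    (ha : a ∈ U) (hb : b ∈ U) (f : Item N → ℝ) : ∑ j ∈ U, (C b j : ℝ) * f j =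
      ∑ j ∈ (U.erase a).erase b, (C a j : ℝ) * f j + C a b * f a := by
  rw [h.sum_mul_eq hab.symm hb ha, h.symm b a, Finset.erase_right_comm]
  congr 1
  refine Finset.sum_congr rfl fun j hj => ?_
  simp only [Finset.mem_erase] at hj
  rw [h.exch b hbS a haS j hj.1 hj.2.1]

theorem sum_eq (h : Exchangeable C S) {a b : Item N} (haS : a ∈ S) (hbS : b ∈ S)
    (ha : a ∈ U) (hb : b ∈ U) : ∑ j ∈ U, C a j = ∑ j ∈ U, C b j := by
  rcases eq_or_ne a b with rfl | hab
  · rfl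
  have h1 := h.sum_mul_eq hab ha hb (fun _ => 1)
  have h2 := h.sum_mul_eq' hab haS hbS ha hb (fun _ => 1)
  have : ((∑ j ∈ U, C a j : ℕ) : ℝ) = (∑ j ∈ U, C b j : ℕ) := by
    push_cast
    simp only [mul_one] at h1 h2
    rw [h1, h2]
  exact_mod_cast this

/-- Both items have equal counts against every third item, and the terms of their mutual meetings
cancel. -/
theorem sub_eq (h : Exchangeable C S) {a b : Item N} (hab : a ≠ b) (haS : a ∈ S) (hbS : b ∈ S)
    (ha : a ∈ U) (hb : b ∈ U) (u : Item N → ℝ) :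
    u a * ∑ j ∈ U, (C a j : ℝ) * u j - u b * ∑ j ∈ U, (C b j : ℝ) * u j =
      (u a - u b) * ∑ j ∈ (U.erase a).erase b, (C a j : ℝ) * u j := by
  rw [h.sum_mul_eq hab ha hb, h.sum_mul_eq' hab haS hbS ha hb]
  ring

/-- Expected rewards are ordered as the parameters. -/
theorem mean_mono (h : Exchangeable C S) {u : Item N → ℝ} (hu : ∀ i, 0 < u i) {a b : Item N}
    (haS : a ∈ S) (hbS : b ∈ S) (ha : a ∈ U) (hb : b ∈ U) (hab : u b ≤ u a) :
    u b * ∑ j ∈ U, (C b j : ℝ) * u j ≤ u a * ∑ j ∈ U, (C a j : ℝ) * u j := by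
  rcases eq_or_ne a b with rfl | hne
  · exact le_rfl
  have h1 := h.sub_eq hne haS hbS ha hb u
  have h2 : 0 ≤ ∑ j ∈ (U.erase a).erase b, (C a j : ℝ) * u j :=
    Finset.sum_nonneg fun j _ => mul_nonneg (Nat.cast_nonneg _) (hu j).le
  nlinarith [mul_nonneg (sub_nonneg.2 hab) h2]

theorem const (h : Exchangeable C S) {a j k : Item N} (hj : j ∈ S) (hk : k ∈ S)
    (hja : j ≠ a) (hka : k ≠ a) : C a j = C a k := by
  rw [h.symm a j, h.symm a k, h.exch j hj k hk a hja.symm hka.symm]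

/-- The mean parameter of the opponents of `a`, other than `b`, is at least half of the mean parameter
in `S`. -/
theorem sum_mul_card_le (h : Exchangeable C S) {u : Item N → ℝ} {δ : ℝ} (hu : Paired u δ)
    (hS : ∀ i ∈ S, twin i ∈ S) (hSU : S ⊆ U) (hbetter : ∀ j ∈ U, j ∉ S → ∀ k ∈ S, u k ≤ u j)
    {a b : Item N} (ha : a ∈ S) (hb : b ∈ S) (hab : u b < u a) :
    (∑ i ∈ S, u i) * (∑ j ∈ U, C a j : ℕ) ≤
      2 * S.card * ∑ j ∈ (U.erase a).erase b, (C a j : ℝ) * u j := by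
  have hne : a ≠ b := by rintro rfl; exact lt_irrefl _ hab
  set H := ∑ i ∈ S, u i with hH
  set R := (S.erase a).erase b with hR
  have hsplit : (U.erase a).erase b = R ∪ (U \ S) := by
    ext j
    simp only [hR, Finset.mem_erase, Finset.mem_union, Finset.mem_sdiff]
    by_cases hj : j ∈ S
    · simp [hj, hSU hj]
    · have h1 : j ≠ a := by rintro rfl; exact hj ha
      have h2 : j ≠ b := by rintro rfl; exact hj hb
      simp [hj, h1, h2]
  have hdisj : Disjoint R (U \ S) :=
    Finset.disjoint_of_subset_left ((Finset.erase_subset _ _).trans (Finset.erase_subset _ _))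
      Finset.disjoint_sdiff
  have hconst : ∀ j ∈ R, C a j = C a b := by
    intro j hj
    simp only [hR, Finset.mem_erase] at hj
    exact h.const hj.2.2 hb hj.2.1 hne.symm
  have hHR : H = u a + u b + ∑ j ∈ R, u j := by
    rw [hH, ← Finset.add_sum_erase S u ha,
      ← Finset.add_sum_erase (S.erase a) u (Finset.mem_erase.2 ⟨hne.symm, hb⟩)]
    ring
  have hcard : R.card + 2 = S.card := by
    have h1 := Finset.card_erase_add_one ha
    have h2 := Finset.card_erase_add_one (Finset.mem_erase.2 ⟨hne.symm, hb⟩)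
    rw [← hR] at h2
    omega
  -- The twins of `a` and `b` stay among the opponents, so leaving out `a` and `b` loses at most
  -- half of `H`.
  have htw : u a + u b ≤ ∑ j ∈ R, u j := by
    have ne1 : twin a ≠ b := fun h' => by
      have := hu.twin_eq a; rw [h'] at this; exact hab.ne this
    have ne2 : twin b ≠ a := fun h' => by
      have := hu.twin_eq b; rw [h'] at this; exact hab.ne this.symm
    have ne3 : twin a ≠ twin b := fun h' => by
      have h1 := hu.twin_eq a; have h2 := hu.twin_eq b; rw [h'] at h1; exact hab.ne (h2.symm.trans h1)
    have hsub : ({twin a, twin b} : Finset (Item N)) ⊆ R := by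
      intro j hj
      simp only [Finset.mem_insert, Finset.mem_singleton] at hj
      rcases hj with rfl | rfl
      · exact Finset.mem_erase.2 ⟨ne1, Finset.mem_erase.2 ⟨(twinMatching N).mate_ne a, hS a ha⟩⟩
      · exact Finset.mem_erase.2 ⟨(twinMatching N).mate_ne b, Finset.mem_erase.2 ⟨ne2, hS b hb⟩⟩
    have := Finset.sum_le_sum_of_subset_of_nonneg hsub (f := u) fun i _ _ => (hu.pos i).le
    rwa [Finset.sum_pair ne3, hu.twin_eq, hu.twin_eq] at this
  have e1 : ((∑ j ∈ U, C a j : ℕ) : ℝ) =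
      C a b * (S.card - 1) + ∑ j ∈ U \ S, (C a j : ℝ) := by
    have h1 := h.sum_mul_eq hne (hSU ha) (hSU hb) (fun _ => 1)
    simp only [mul_one] at h1
    have h2 : ∑ j ∈ R, (C a j : ℝ) = R.card * C a b := by
      rw [← nsmul_eq_mul, ← Finset.sum_const]
      exact Finset.sum_congr rfl fun j hj => by rw [hconst j hj]
    rw [hsplit, Finset.sum_union hdisj, h2] at h1
    push_cast
    rw [h1, ← hcard]
    push_cast
    ring
  have e2 : ∑ j ∈ (U.erase a).erase b, (C a j : ℝ) * u j =
      C a b * ∑ j ∈ R, u j + ∑ j ∈ U \ S, (C a j : ℝ) * u j := by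
    rw [hsplit, Finset.sum_union hdisj, Finset.mul_sum]
    congr 1
    exact Finset.sum_congr rfl fun j hj => by rw [hconst j hj]
  have hpos : 0 ≤ H := Finset.sum_nonneg fun i _ => (hu.pos i).le
  -- Opponents outside `S` are at least as good as every item of `S`, hence as the mean `H / |S|`.
  have e3 : H * ∑ j ∈ U \ S, (C a j : ℝ) ≤ S.card * ∑ j ∈ U \ S, (C a j : ℝ) * u j := by
    rw [Finset.mul_sum, Finset.mul_sum]
    refine Finset.sum_le_sum fun j hj => ?_
    obtain ⟨h1, h2⟩ := Finset.mem_sdiff.1 hj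
    have h3 : H ≤ S.card * u j := by
      have := Finset.sum_le_card_nsmul S u (u j) fun k hk => hbetter j h1 h2 k hk
      simpa using this
    have := mul_le_mul_of_nonneg_right h3 (Nat.cast_nonneg (α := ℝ) (C a j))
    linarith
  have e4 : 0 ≤ ∑ j ∈ U \ S, (C a j : ℝ) * u j :=
    Finset.sum_nonneg fun j _ => mul_nonneg (Nat.cast_nonneg _) (hu.pos j).le
  have e5 : H * (C a b * (S.card - 1)) ≤ 2 * S.card * (C a b * ∑ j ∈ R, u j) := by
    have h1 : H ≤ 2 * ∑ j ∈ R, u j := by linarith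
    have h2 : (0 : ℝ) ≤ C a b := Nat.cast_nonneg _
    have h3 : (0 : ℝ) ≤ C a b * S.card := by positivity
    have h4 := mul_le_mul_of_nonneg_left h1 h3
    nlinarith [mul_nonneg hpos h2]
  rw [e1, e2]
  have h6 : (0 : ℝ) ≤ S.card * ∑ j ∈ U \ S, (C a j : ℝ) * u j :=
    mul_nonneg (Nat.cast_nonneg _) e4
  nlinarith

end Exchangeable

/-! ### Levels, overlapping intervals and the spread of a cluster -/

theorem le_level (T l : ℕ) : (4 : ℝ) ^ (l + 1) * Real.log T ≤ level T l := Nat.le_ceil _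

theorem sqrt_mul_log_le {T l n : ℕ} (hn : level T l ≤ n) :
    2 ^ (l + 1) * Real.sqrt (n * Real.log T) ≤ n := by
  have h1 : (4 : ℝ) ^ (l + 1) * Real.log T ≤ n := (le_level T l).trans (by exact_mod_cast hn)
  have h2 : (0 : ℝ) ≤ n := Nat.cast_nonneg _
  have h3 : Real.sqrt (n * Real.log T) ≤ n / 2 ^ (l + 1) := by
    refine Real.sqrt_le_iff.2 ⟨by positivity, ?_⟩
    rw [div_pow, le_div_iff₀ (by positivity), ← pow_mul, mul_comm (l + 1) 2, pow_mul]
    norm_num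
    nlinarith
  rw [le_div_iff₀ (by positivity)] at h3
  linarith

/-- Two items of `S` whose confidence intervals overlap have close parameters. -/
theorem gap_le_of_overlap {u : Item N → ℝ} {δ : ℝ} (hu : Paired u δ) {T l : ℕ}
    (hT : 0 < Real.log T) {C : Item N → Item N → ℕ} {S U : Finset (Item N)}
    (h : Exchangeable C S) (hS : ∀ i ∈ S, twin i ∈ S) (hSU : S ⊆ U)
    (hbetter : ∀ j ∈ U, j ∉ S → ∀ k ∈ S, u k ≤ u j)
    {a b : Item N} (ha : a ∈ S) (hb : b ∈ S) (hab : u b < u a) {n : ℕ}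
    (hn : n = ∑ j ∈ U, C a j) (hl : level T l ≤ n) {Ma Mb : ℝ}
    (hMa : |n * Ma - u a * ∑ j ∈ U, (C a j : ℝ) * u j| ≤ Real.sqrt (n * Real.log T))
    (hMb : |n * Mb - u b * ∑ j ∈ U, (C b j : ℝ) * u j| ≤ Real.sqrt (n * Real.log T))
    (hQ : Ma - Real.sqrt (Real.log T / n) ≤ Mb + Real.sqrt (Real.log T / n)) :
    2 ^ l * ((u a - u b) * ∑ i ∈ S, u i) ≤ 4 * S.card := by
  have hne : a ≠ b := by rintro rfl; exact lt_irrefl _ hab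
  have hn0 : (0 : ℝ) < n := by
    have := (le_level T l).trans (show (level T l : ℝ) ≤ n by exact_mod_cast hl)
    refine lt_of_lt_of_le ?_ this
    positivity
  have hw : n * Real.sqrt (Real.log T / n) = Real.sqrt (n * Real.log T) := by
    have h1 : (n : ℝ) * Real.log T = n ^ 2 * (Real.log T / n) := by field_simp
    rw [h1, Real.sqrt_mul (by positivity), Real.sqrt_sq hn0.le]
  have h1 := h.sum_mul_card_le hu hS hSU hbetter ha hb hab
  rw [← hn] at h1
  have h2 := h.sub_eq hne ha hb (hSU ha) (hSU hb) u
  have h3 := mul_le_mul_of_nonneg_left hQ hn0.le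
  rw [mul_sub, mul_add, hw] at h3
  have h4 := sqrt_mul_log_le hl
  rw [abs_le] at hMa hMb
  set W := ∑ j ∈ (U.erase a).erase b, (C a j : ℝ) * u j
  set q := Real.sqrt (n * Real.log T)
  set H := ∑ i ∈ S, u i
  -- Two radii come from the intervals and two from the errors of the means.
  have h5 : (u a - u b) * W ≤ 4 * q := by linarith
  have h6 : (u a - u b) * (H * n) ≤ (u a - u b) * (2 * S.card * W) :=
    mul_le_mul_of_nonneg_left h1 (by linarith)
  have h7 : (0 : ℝ) ≤ S.card := Nat.cast_nonneg _
  have h8 : (u a - u b) * (H * n) ≤ 8 * S.card * q := by nlinarith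
  have h9 : 2 ^ (l + 1) * ((u a - u b) * (H * n)) ≤ 8 * S.card * n := by
    have := mul_le_mul_of_nonneg_left h8 (show (0 : ℝ) ≤ 2 ^ (l + 1) by positivity)
    nlinarith
  have h10 : (2 ^ (l + 1) * ((u a - u b) * H)) * n ≤ (8 * S.card) * n := by linarith
  have h11 := le_of_mul_le_mul_right h10 hn0
  rw [pow_succ] at h11
  linarith

/-- The spread of the parameters that is still possible at level `l`. -/
def Narrow (N : ℕ) (δ : ℝ) (l : ℕ) (d : ℝ) : Prop :=
  2 ^ l * (δ * d) ≤ 64 ∧ 2 ^ l * d ^ 2 ≤ 16 * (N : ℝ) ^ 2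

/-- Every cut of `A` is bridged by a step of size at most `4 * |S| / (2 ^ l * H)`, so the spread `d`
is at most `|S|` such steps. The two bounds then come from `H ≥ δ * |S| ^ 2 / 16` and from `d ≤ H`.
The former needs four items, which a positive spread supplies as two pairs of twins. -/
theorem narrow_of_linked {u : Item N → ℝ} {δ : ℝ} (hu : Paired u δ) {l : ℕ}
    {S A : Finset (Item N)} (hAS : A ⊆ S) (hS : ∀ i ∈ S, twin i ∈ S)
    (hlink : ∀ θ : ℝ, (∃ a ∈ A, θ < u a) → (∃ b ∈ A, u b ≤ θ) →
      ∃ a ∈ A, ∃ b ∈ A, θ < u a ∧ u b ≤ θ ∧ 2 ^ l * ((u a - u b) * ∑ i ∈ S, u i) ≤ 4 * S.card)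
    {x y : Item N} (hx : x ∈ A) (hy : y ∈ A) (hxy : u y ≤ u x) : Narrow N δ l (u x - u y) := by
  rcases hxy.eq_or_lt with heq | hlt
  · rw [heq, sub_self]
    exact ⟨by simp, by simp⟩
  set H := ∑ i ∈ S, u i with hH
  have hcard : 4 ≤ S.card := by
    have ne1 : x ≠ y := by rintro rfl; exact lt_irrefl _ hlt
    have tx := hu.twin_eq x
    have ty := hu.twin_eq y
    have n1 : twin x ≠ y := fun h => by rw [h] at tx; exact hlt.ne tx
    have n2 : twin y ≠ x := fun h => by rw [h] at ty; exact hlt.ne ty.symm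
    have n3 : twin x ≠ twin y := fun h => by rw [h] at tx; exact hlt.ne (ty.symm.trans tx)
    have : ({x, y, twin x, twin y} : Finset (Item N)) ⊆ S := by
      intro j hj
      simp only [Finset.mem_insert, Finset.mem_singleton] at hj
      rcases hj with rfl | rfl | rfl | rfl
      · exact hAS hx
      · exact hAS hy
      · exact hS _ (hAS hx)
      · exact hS _ (hAS hy)
    have h4 := Finset.card_le_card this
    rwa [Finset.card_insert_of_notMem, Finset.card_insert_of_notMem, Finset.card_pair n3] at h4
    · simp only [Finset.mem_insert, Finset.mem_singleton, not_or]
      exact ⟨n1.symm, ((twinMatching N).mate_ne y).symm⟩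
    · simp only [Finset.mem_insert, Finset.mem_singleton, not_or]
      exact ⟨ne1, ((twinMatching N).mate_ne x).symm, n2.symm⟩
  have hHpos : 0 < H := Finset.sum_pos (fun i _ => hu.pos i) ⟨x, hAS hx⟩
  have hcardN : (S.card : ℝ) ≤ 2 * N := by
    have : S.card ≤ 2 * N := by simpa using Finset.card_le_univ S
    exact_mod_cast this
  have hc4 : (4 : ℝ) ≤ S.card := by exact_mod_cast hcard
  set g : ℝ := 4 * S.card / (2 ^ l * H) with hg
  have hrange := sub_le_card_mul A u g (by positivity) (by
    intro θ h1 h2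
    obtain ⟨a, ha, b, hb, h3, h4, h5⟩ := hlink θ h1 h2
    refine ⟨a, ha, b, hb, h3, h4, ?_⟩
    rw [hg, le_div_iff₀ (by positivity)]
    linarith) x y hx hy
  have hAc : (A.card : ℝ) ≤ S.card := by exact_mod_cast Finset.card_le_card hAS
  have hd : 2 ^ l * ((u x - u y) * H) ≤ 4 * (S.card : ℝ) ^ 2 := by
    have h1 : u x - u y ≤ S.card * g :=
      hrange.trans (mul_le_mul_of_nonneg_right hAc (by positivity))
    have h2 : S.card * g = 4 * (S.card : ℝ) ^ 2 / (2 ^ l * H) := by rw [hg]; ring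
    rw [h2, le_div_iff₀ (by positivity)] at h1
    linarith
  have hdH : u x - u y ≤ H := by
    have h1 : u x ≤ H := Finset.single_le_sum (fun i _ => (hu.pos i).le) (hAS hx)
    linarith [hu.pos y]
  have hd0 : 0 < u x - u y := sub_pos.2 hlt
  have h2l : (0 : ℝ) < 2 ^ l := by positivity
  constructor
  · have h1 := hu.le_sum S hcard
    have h2 : 2 ^ l * ((u x - u y) * (δ * (S.card : ℝ) ^ 2)) ≤ 64 * (S.card : ℝ) ^ 2 := by
      have := mul_le_mul_of_nonneg_left h1 (mul_nonneg h2l.le hd0.le)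
      nlinarith
    have h3 : (2 ^ l * (δ * (u x - u y))) * (S.card : ℝ) ^ 2 ≤ 64 * (S.card : ℝ) ^ 2 := by linarith
    exact le_of_mul_le_mul_right h3 (by positivity)
  · have h1 : 2 ^ l * (u x - u y) ^ 2 ≤ 2 ^ l * ((u x - u y) * H) :=
      mul_le_mul_of_nonneg_left (by nlinarith) h2l.le
    nlinarith

/-! ### Round-robin tournaments -/

/-- Disjoint clusters that are closed under `twin` have even size, so their schedules glue to a
matching and `fb` is never played. -/
theorem mate_sampleMatching {rr : RoundRobin N} {fb : Matching N} {u : Item N → ℝ}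
    {L : List (Finset (Item N))} (hL : Ordered u L) (hc : Covers L)
    (htwin : ∀ S ∈ L, ∀ i ∈ S, twin i ∈ S) (t : ℕ) {S : Finset (Item N)} (hS : S ∈ L)
    {i : Item N} (hi : i ∈ S) :
    (sampleMatching rr fb L t).mate i = rr.opponent S (t % (S.card - 1)) i := by
  have hround : ∀ S ∈ L, ∀ i ∈ S, t % (S.card - 1) < S.card - 1 := by
    intro S hS i hi
    have h2 : 1 < S.card := Finset.one_lt_card.2
      ⟨i, hi, twin i, htwin S hS i hi, ((twinMatching N).mate_ne i).symm⟩
    exact Nat.mod_lt _ (by omega)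
  have hf : ∀ S ∈ L, ∀ i ∈ S, rr.opponent (clusterOf L i) (t % ((clusterOf L i).card - 1)) i =
      rr.opponent S (t % (S.card - 1)) i := by
    intro S hS i hi
    rw [hL.clusterOf_eq hS hi]
  have hcond : (∀ i, rr.opponent
      (clusterOf L (rr.opponent (clusterOf L i) (t % ((clusterOf L i).card - 1)) i))
        (t % ((clusterOf L (rr.opponent (clusterOf L i) (t % ((clusterOf L i).card - 1)) i)).card - 1))
        (rr.opponent (clusterOf L i) (t % ((clusterOf L i).card - 1)) i) = i) ∧
      (∀ i, rr.opponent (clusterOf L i) (t % ((clusterOf L i).card - 1)) i ≠ i) := by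
    constructor
    · intro i
      obtain ⟨S, hS, hi⟩ := hc i
      have hev := even_card_of_twin (htwin S hS)
      rw [hf S hS i hi, hf S hS _ (rr.mem S hev _ (hround S hS i hi) i hi)]
      exact rr.invol S hev _ (hround S hS i hi) i hi
    · intro i
      obtain ⟨S, hS, hi⟩ := hc i
      have hev := even_card_of_twin (htwin S hS)
      rw [hf S hS i hi]
      exact rr.ne S hev _ (hround S hS i hi) i hi
  rw [sampleMatching]
  simp only
  rw [dif_pos hcond]
  exact hf S hS i hi

/-- Any `|S| - 1` consecutive times run through all rounds once, so a tournament may start at any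
phase of the schedule. -/
theorem card_window {rr : RoundRobin N} {S : Finset (Item N)} (hS : Even S.card) {i : Item N}
    (hi : i ∈ S) (j : Item N) (a : ℕ) :
    ((Finset.Ioc a (a + (S.card - 1))).filter
      fun τ => rr.opponent S (τ % (S.card - 1)) i = j).card = if j ∈ S ∧ j ≠ i then 1 else 0 := by
  set p := S.card - 1 with hp
  have hIoc : Finset.Ioc a (a + p) = Finset.Ico (a + 1) (a + 1 + p) := by
    ext τ; simp only [Finset.mem_Ioc, Finset.mem_Ico]; omega
  have himg := Nat.image_Ico_mod (a + 1) p
  have hinj : Set.InjOn (fun τ => τ % p) (Finset.Ico (a + 1) (a + 1 + p) : Finset ℕ) := by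
    rw [← Finset.card_image_iff, himg]; simp
  rw [hIoc]
  have hlt : ∀ τ ∈ Finset.Ico (a + 1) (a + 1 + p), τ % p < p := by
    intro τ hτ
    exact Nat.mod_lt _ (by simp only [Finset.mem_Ico] at hτ; omega)
  split_ifs with h
  · obtain ⟨r, ⟨hr, hrj⟩, huniq⟩ := rr.once S hS i hi j h.1 (Ne.symm h.2)
    have hr' : r ∈ (Finset.Ico (a + 1) (a + 1 + p)).image (· % p) := by
      rw [himg]; exact Finset.mem_range.2 hr
    obtain ⟨τ, hτ, hτr⟩ := Finset.mem_image.1 hr'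
    rw [Finset.card_eq_one]
    refine ⟨τ, ?_⟩
    ext σ
    simp only [Finset.mem_filter, Finset.mem_singleton]
    constructor
    · rintro ⟨hσ, hσj⟩
      exact hinj hσ hτ (by simp only; rw [hτr]; exact huniq _ ⟨hlt σ hσ, hσj⟩)
    · rintro rfl
      exact ⟨hτ, by rw [hτr]; exact hrj⟩
  · rw [Finset.card_eq_zero, Finset.filter_eq_empty_iff]
    intro τ hτ hj
    apply h
    rw [← hj]
    exact ⟨rr.mem S hS _ (hlt τ hτ) i hi, rr.ne S hS _ (hlt τ hτ) i hi⟩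

theorem sum_card_filter_eq {S : Finset (Item N)} {f : ℕ → Item N} {I : Finset ℕ}
    (hf : ∀ τ ∈ I, f τ ∈ S) : ∑ j ∈ S, (I.filter fun τ => f τ = j).card = I.card :=
  (Finset.card_eq_sum_card_fiberwise hf).symm

/-! ### The invariants of a run with concentrated observations -/

/-- A bound for the squared spread at level `l`. -/
def spreadBound (N : ℕ) (δ : ℝ) (l : ℕ) : ℝ :=
  min (16 * (N : ℝ) ^ 2 / 2 ^ l) (64 ^ 2 / (4 ^ l * δ ^ 2))

/-- A bound for the loss of an item after `f` samples against better items. -/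
def potential (N : ℕ) (δ : ℝ) (T L : ℕ) (f : ℝ) : ℝ :=
  ∑ l ∈ Finset.range (L + 1), spreadBound N δ l * min f (level T (l + 1) + 2 * N)

/-- The invariants that survive as long as the noise is concentrated. The current intervals force no
further split (`linked`) and permit no wrong one (`valid`); `aligned` reflects that items of a
cluster are refreshed together with equal radii. The buffer holds the last `r` rounds of an
unfinished tournament, so only complete ones are recorded, which is the source of `exch`. `narrow`
bounds the spread by the level reached, and `pot` bounds the loss charged to the worse item `j` of
each meeting. -/
structure Good (rr : RoundRobin N) (u : Item N → ℝ) (δ : ℝ) (T L t : ℕ) (s : State N) : Prop where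
  covers : Covers s.clusters
  ordered : Ordered u s.clusters
  nonempty : ∀ S ∈ s.clusters, S.Nonempty
  linked : ∀ S ∈ s.clusters, Linked s.Qhi s.Qlo S
  lo_le_hi : ∀ i, s.Qlo i ≤ s.Qhi i
  aligned : ∀ S ∈ s.clusters, Aligned s.Qhi s.Qlo S
  valid : ∀ S ∈ s.clusters, ∀ a ∈ S, ∀ b ∈ S, u a ≤ u b → s.Qlo a ≤ s.Qhi b
  buffer : ∀ S ∈ s.clusters, ∃ r, r + 1 < S.card ∧ r ≤ t ∧ ∀ i ∈ S, ∀ j, s.Cbuf i j =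
    ((Finset.Ioc (t - r) t).filter fun τ => rr.opponent S (τ % (S.card - 1)) i = j).card
  exch : ∀ S ∈ s.clusters, Exchangeable s.C S
  narrow : ∀ S ∈ s.clusters, ∀ i ∈ S, ∀ l, 0 < l → level T l ≤ ∑ j ∈ upTo s.clusters i, s.C i j →
    ∀ x ∈ S, ∀ y ∈ S, u y ≤ u x → Narrow N δ l (u x - u y)
  pot : ∀ j, ∑ i with u j < u i, (u i - u j) ^ 2 * (s.C j i : ℝ) ≤
    potential N δ T L (∑ i with u j < u i, (s.C j i : ℝ))

theorem spreadBound_nonneg (N : ℕ) (δ : ℝ) (l : ℕ) : 0 ≤ spreadBound N δ l :=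
  le_min (by positivity) (by positivity)

theorem sq_le_spreadBound {δ d : ℝ} (hδ : 0 < δ) (hd : 0 ≤ d) {l : ℕ} (h : Narrow N δ l d) :
    d ^ 2 ≤ spreadBound N δ l := by
  have h2 : (0 : ℝ) < 2 ^ l := by positivity
  refine le_min ?_ ?_
  · rw [le_div_iff₀ h2]; linarith [h.2]
  · have h4 : (4 : ℝ) ^ l = 2 ^ l * 2 ^ l := by rw [← mul_pow]; norm_num
    rw [le_div_iff₀ (by positivity), h4]
    have h1 : 0 ≤ 2 ^ l * (δ * d) := by positivity
    have := mul_self_le_mul_self h1 h.1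
    nlinarith

theorem Paired.delta_le_one {u : Item N → ℝ} {δ : ℝ} (hu : Paired u δ) : δ ≤ 1 := by
  have hN := hu.two_le
  have h1 := hu.index_le ⟨0, by omega⟩
  have h2 := hu.lt_one ⟨0, by omega⟩
  have h3 : (2 : ℝ) ≤ N := by exact_mod_cast hN
  simp only [Nat.zero_div, Nat.cast_zero, sub_zero] at h1
  nlinarith [hu.delta_pos]

theorem Paired.sq_le_spreadBound_zero {u : Item N → ℝ} {δ : ℝ} (hu : Paired u δ) (i j : Item N) :
    (u i - u j) ^ 2 ≤ spreadBound N δ 0 := by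
  have h3 : (2 : ℝ) ≤ N := by exact_mod_cast hu.two_le
  have h4 := hu.delta_pos
  have h5 := hu.delta_le_one
  refine (hu.abs_sub_le i j).trans (le_min ?_ ?_)
  · simp only [pow_zero, div_one]; nlinarith
  · rw [pow_zero, one_mul, le_div_iff₀ (by positivity)]; nlinarith

/-- The summand at `l` is not truncated at `f` nor at `f + k`, so it grows by exactly `spreadBound N
δ l * k`, and no other summand decreases. The slack `2 * N` in `potential` makes room for a whole
tournament recorded at once. -/
theorem potential_step {δ : ℝ} {T L l : ℕ} (hl : l ≤ L) {f k B : ℝ} (hk : 0 ≤ k)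
    (hkN : k ≤ 2 * N) (hf : f ≤ level T (l + 1)) (hB : B ≤ spreadBound N δ l) :
    potential N δ T L f + B * k ≤ potential N δ T L (f + k) := by
  have hmem : l ∈ Finset.range (L + 1) := Finset.mem_range.2 (by omega)
  rw [potential, potential, ← Finset.add_sum_erase _ _ hmem, ← Finset.add_sum_erase _ _ hmem]
  have h1 : ∑ i ∈ (Finset.range (L + 1)).erase l,
      spreadBound N δ i * min f (level T (i + 1) + 2 * N) ≤
      ∑ i ∈ (Finset.range (L + 1)).erase l,
        spreadBound N δ i * min (f + k) (level T (i + 1) + 2 * N) :=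
    Finset.sum_le_sum fun i _ => mul_le_mul_of_nonneg_left
      (min_le_min_right _ (by linarith)) (spreadBound_nonneg _ _ _)
  have h2 : (0 : ℝ) ≤ N := Nat.cast_nonneg _
  rw [min_eq_left (by linarith), min_eq_left (by linarith)]
  have h3 := mul_le_mul_of_nonneg_right hB hk
  linarith

theorem exists_level_gt {T : ℕ} (hT : 0 < Real.log T) (f : ℕ) : ∃ l, f < level T (l + 1) := by
  obtain ⟨l, hl⟩ := pow_unbounded_of_one_lt (f / Real.log T) (show (1 : ℝ) < 4 by norm_num)
  refine ⟨l, ?_⟩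
  rw [div_lt_iff₀ hT] at hl
  have h1 := le_level T (l + 1)
  have h2 : (4 : ℝ) ^ l * Real.log T ≤ 4 ^ (l + 1 + 1) * Real.log T :=
    mul_le_mul_of_nonneg_right (pow_le_pow_right₀ (by norm_num) (by omega)) hT.le
  exact_mod_cast hl.trans_le (h2.trans h1)

/-! ### Preservation of the invariants -/

section Step

variable {rr : RoundRobin N} {fb : Matching N} {u : Item N → ℝ} {δ : ℝ} {T L t : ℕ} {s : State N}

theorem Good.twin_mem (h : Good rr u δ T L t s) (hu : Paired u δ) :
    ∀ S ∈ s.clusters, ∀ i ∈ S, twin i ∈ S :=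
  fun _ hS i hi => h.ordered.mem_of_eq h.covers hS hi (hu.twin_eq i)

/-- Every item of `S` meets one opponent in `S` per round, so completeness depends only on the
length of the window and holds for all items of `S` at once. A full window contains each meeting
once, by `card_window`. -/
theorem Good.tournament (h : Good rr u δ T L t s) (hu : Paired u δ) {m : Matching N}
    (hm : m = sampleMatching rr fb s.clusters (t + 1)) {S : Finset (Item N)} (hS : S ∈ s.clusters) :
    ((∀ i ∈ S, ¬ Done m s i) ∧ ∃ r, r + 1 < S.card ∧ r ≤ t + 1 ∧ ∀ i ∈ S, ∀ j,
      countBuffer m s i j = ((Finset.Ioc (t + 1 - r) (t + 1)).filter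
        fun τ => rr.opponent S (τ % (S.card - 1)) i = j).card) ∨
    ((∀ i ∈ S, Done m s i) ∧ ∀ i ∈ S, ∀ j,
      countBuffer m s i j = if j ∈ S ∧ j ≠ i then 1 else 0) := by
  obtain ⟨r, hr, hrt, hbuf⟩ := h.buffer S hS
  have htw := h.twin_mem hu
  have hev := even_card_of_twin (htw S hS)
  have hcb : ∀ i ∈ S, ∀ j, countBuffer m s i j = ((Finset.Ioc (t - r) (t + 1)).filter
        fun τ => rr.opponent S (τ % (S.card - 1)) i = j).card := by
    intro i hi j
    have hIoc : Finset.Ioc (t - r) (t + 1) = insert (t + 1) (Finset.Ioc (t - r) t) := by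
      ext τ; simp only [Finset.mem_Ioc, Finset.mem_insert]; omega
    rw [countBuffer, hbuf i hi j, hm, mate_sampleMatching h.ordered h.covers htw _ hS hi, hIoc,
      Finset.filter_insert]
    split_ifs with h1
    · rw [Finset.card_insert_of_notMem (by simp)]
    · simp
  have hsum : ∀ i ∈ S, ∑ j ∈ S, countBuffer m s i j = r + 1 := by
    intro i hi
    rw [Finset.sum_congr rfl fun j _ => hcb i hi j, sum_card_filter_eq, Nat.card_Ioc]
    · omega
    · intro τ _
      exact rr.mem S hev _ (Nat.mod_lt _ (by omega)) i hi
  have hdone : ∀ i ∈ S, (Done m s i ↔ r + 1 = S.card - 1) := by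
    intro i hi
    rw [Done, Complete, h.ordered.clusterOf_eq hS hi]
    constructor
    · rintro ⟨k, hk, hk'⟩; rw [← hk', hsum k hk]
    · intro h'; exact ⟨i, hi, by rw [hsum i hi, h']⟩
  by_cases hr' : r + 1 = S.card - 1
  · right
    refine ⟨fun i hi => (hdone i hi).2 hr', fun i hi j => ?_⟩
    rw [hcb i hi j, ← card_window hev hi j (t - r)]
    congr 3
    omega
  · left
    refine ⟨fun i hi => fun hd => hr' ((hdone i hi).1 hd), r + 1, by omega, by omega, ?_⟩
    intro i hi j
    rw [hcb i hi j]
    congr 3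
    omega

open Classical in
theorem Good.step_C_eq (h : Good rr u δ T L t s) (hu : Paired u δ) {m : Matching N}
    (hm : m = sampleMatching rr fb s.clusters (t + 1)) (x : Item N → Item N → ℝ)
    {S : Finset (Item N)} (hS : S ∈ s.clusters) {i : Item N} (hi : i ∈ S) (j : Item N) :
    (step T m x s).C i j = s.C i j + if Done m s i ∧ j ∈ S ∧ j ≠ i then 1 else 0 := by
  rw [step_C]
  rcases h.tournament hu hm hS with ⟨h1, -⟩ | ⟨h1, h2⟩
  · simp [h1 i hi]
  · rw [if_pos (h1 i hi), h2 i hi j]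
    simp [h1 i hi]

theorem Done.congr {m : Matching N} {i j : Item N}
    (hij : clusterOf s.clusters i = clusterOf s.clusters j) : Done m s i ↔ Done m s j := by
  rw [Done, Done, hij]

/-- A completed tournament adds one meeting to each pair inside its cluster and nothing else. -/
theorem Good.step_exchangeable (h : Good rr u δ T L t s) (hu : Paired u δ) {m : Matching N}
    (hm : m = sampleMatching rr fb s.clusters (t + 1)) (x : Item N → Item N → ℝ)
    {S : Finset (Item N)} (hS : S ∈ s.clusters) : Exchangeable (step T m x s).C S := by
  classical
  have hE := h.exch S hS
  refine ⟨fun i j => ?_, fun i => ?_, fun i hi k hk j hji hjk => ?_⟩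
  · obtain ⟨A, hA, hiA⟩ := h.covers i
    obtain ⟨B, hB, hjB⟩ := h.covers j
    rw [h.step_C_eq hu hm x hA hiA, h.step_C_eq hu hm x hB hjB, hE.symm i j]
    congr 1
    have key : ∀ {A B : Finset (Item N)}, A ∈ s.clusters → B ∈ s.clusters → ∀ {i j}, i ∈ A →
        j ∈ B → (Done m s i ∧ j ∈ A ∧ j ≠ i) → (Done m s j ∧ i ∈ B ∧ i ≠ j) := by
      intro A B hA hB i j hi hj ⟨h1, h2, h3⟩
      have hAB : A = B := by rw [← h.ordered.clusterOf_eq hA h2, h.ordered.clusterOf_eq hB hj]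
      subst hAB
      refine ⟨(Done.congr ?_).1 h1, hi, h3.symm⟩
      rw [h.ordered.clusterOf_eq hA hi, h.ordered.clusterOf_eq hA h2]
    exact if_congr ⟨key hA hB hiA hjB, key hB hA hjB hiA⟩ rfl rfl
  · obtain ⟨A, hA, hiA⟩ := h.covers i
    rw [h.step_C_eq hu hm x hA hiA, hE.self]
    simp
  · rw [h.step_C_eq hu hm x hS hi, h.step_C_eq hu hm x hS hk, hE.exch i hi k hk j hji hjk]
    have hd : Done m s i ↔ Done m s k :=
      Done.congr (by rw [h.ordered.clusterOf_eq hS hi, h.ordered.clusterOf_eq hS hk])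
    simp [hd, hji, hjk]

theorem Good.sampleCount_eq (h : Good rr u δ T L t s) (hu : Paired u δ) {m : Matching N}
    (hm : m = sampleMatching rr fb s.clusters (t + 1)) (x : Item N → Item N → ℝ)
    {S : Finset (Item N)} (hS : S ∈ s.clusters) {i j : Item N} (hi : i ∈ S) (hj : j ∈ S) :
    sampleCount T m x s i = sampleCount T m x s j := by
  rw [sampleCount, sampleCount, h.ordered.upTo_eq h.covers hS hj hi]
  exact (h.step_exchangeable hu hm x hS).sum_eq hi hj
    ((h.ordered.mem_upTo h.covers hS hi).2 (Or.inl hi))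
    ((h.ordered.mem_upTo h.covers hS hi).2 (Or.inl hj))

theorem Good.sampleCount_of_done (h : Good rr u δ T L t s) (hu : Paired u δ) {m : Matching N}
    (hm : m = sampleMatching rr fb s.clusters (t + 1)) (x : Item N → Item N → ℝ)
    {S : Finset (Item N)} (hS : S ∈ s.clusters) {i : Item N} (hi : i ∈ S) (hd : Done m s i) :
    sampleCount T m x s i = (∑ j ∈ upTo s.clusters i, s.C i j) + (S.card - 1) := by
  classical
  rw [sampleCount, Finset.sum_congr rfl fun j _ => h.step_C_eq hu hm x hS hi j,
    Finset.sum_add_distrib, ← Finset.card_erase_of_mem hi, Finset.sum_boole]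
  congr 1
  rw [Nat.cast_id]
  refine congrArg Finset.card (Finset.ext fun j => ?_)
  simp only [hd, true_and, Finset.mem_filter, Finset.mem_erase,
    h.ordered.mem_upTo h.covers hS hi]
  tauto

/-- All that decides on a refresh, namely the cluster, its completeness and the sample count, is
common to the items of a cluster. -/
theorem Good.refresh_congr (h : Good rr u δ T L t s) (hu : Paired u δ) {m : Matching N}
    (hm : m = sampleMatching rr fb s.clusters (t + 1)) {x : Item N → Item N → ℝ}
    {S : Finset (Item N)} (hS : S ∈ s.clusters) {i j : Item N} (hi : i ∈ S) (hj : j ∈ S)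
    (hr : Refresh T m x s i) : Refresh T m x s j := by
  have hij : clusterOf s.clusters i = clusterOf s.clusters j := by
    rw [h.ordered.clusterOf_eq hS hi, h.ordered.clusterOf_eq hS hj]
  rw [Refresh, ← h.sampleCount_eq hu hm x hS hi hj, ← hij, ← Done.congr hij]
  exact hr

theorem Refresh.count_pos {m : Matching N} {x : Item N → Item N → ℝ} {i : Item N}
    (hT : 0 < Real.log T) (hr : Refresh T m x s i) : 0 < sampleCount T m x s i := by
  obtain ⟨-, l, -, hl, -⟩ := hr
  have h1 := le_level T l
  have h2 : (0 : ℝ) < level T l := lt_of_lt_of_le (by positivity) h1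
  exact lt_of_lt_of_le (by exact_mod_cast h2) hl

/-- The confidence bounds that are set at a refresh are correct. -/
theorem Refresh.abs_mean_sub_le {m : Matching N} {x : Item N → Item N → ℝ} {i : Item N}
    (hT : 0 < Real.log T) (hr : Refresh T m x s i) (hc : Concentrated u T (step T m x s)) :
    |sampleCount T m x s i * sampleMean T m x s i -
      u i * ∑ j ∈ upTo s.clusters i, ((step T m x s).C i j : ℝ) * u j| ≤
      Real.sqrt (sampleCount T m x s i * Real.log T) := by
  have h1 := hc i (upTo s.clusters i)
  have hX : ∀ j, (step T m x s).Xbuf i j = 0 := fun j => by rw [step_Xbuf, if_pos hr.1]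
  have hC : ∀ j, (step T m x s).Cbuf i j = 0 := fun j => by rw [step_Cbuf, if_pos hr.1]
  have hn : (sampleCount T m x s i : ℝ) ≠ 0 := by exact_mod_cast (hr.count_pos hT).ne'
  have e1 : (playCount (step T m x s) i (upTo s.clusters i)) = sampleCount T m x s i := by
    simp only [playCount, hC, add_zero, sampleCount]
  have e2 : noiseSum u (step T m x s) i (upTo s.clusters i) =
      sampleCount T m x s i * sampleMean T m x s i -
      u i * ∑ j ∈ upTo s.clusters i, ((step T m x s).C i j : ℝ) * u j := by
    rw [sampleMean, mul_div_cancel₀ _ hn, noiseSum, Finset.mul_sum, ← Finset.sum_sub_distrib]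
    refine Finset.sum_congr rfl fun j _ => ?_
    rw [hX, hC]; push_cast; ring
  rwa [e1, e2] at h1

variable {m : Matching N} {x : Item N → Item N → ℝ}

theorem Good.step_bounds_of_refresh {i : Item N} (hr : Refresh T m x s i) :
    (step T m x s).Qhi i =
      ((sampleMean T m x s i + Real.sqrt (Real.log T / sampleCount T m x s i) : ℝ) : EReal) ∧
    (step T m x s).Qlo i =
      ((sampleMean T m x s i - Real.sqrt (Real.log T / sampleCount T m x s i) : ℝ) : EReal) := by
  rw [step_Qhi, step_Qlo, if_pos hr, if_pos hr]; exact ⟨rfl, rfl⟩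

theorem Good.step_bounds_of_not_refresh {i : Item N} (hr : ¬ Refresh T m x s i) :
    (step T m x s).Qhi i = s.Qhi i ∧ (step T m x s).Qlo i = s.Qlo i := by
  rw [step_Qhi, step_Qlo, if_neg hr, if_neg hr]; exact ⟨rfl, rfl⟩

theorem Good.step_lo_le_hi (h : Good rr u δ T L t s) (i : Item N) :
    (step T m x s).Qlo i ≤ (step T m x s).Qhi i := by
  by_cases hr : Refresh T m x s i
  · obtain ⟨h1, h2⟩ := Good.step_bounds_of_refresh hr
    rw [h1, h2, EReal.coe_le_coe_iff]
    linarith [Real.sqrt_nonneg (Real.log T / sampleCount T m x s i)]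
  · obtain ⟨h1, h2⟩ := Good.step_bounds_of_not_refresh hr
    rw [h1, h2]; exact h.lo_le_hi i

theorem Good.step_aligned (h : Good rr u δ T L t s) (hu : Paired u δ)
    (hm : m = sampleMatching rr fb s.clusters (t + 1)) {S : Finset (Item N)} (hS : S ∈ s.clusters) :
    Aligned (step T m x s).Qhi (step T m x s).Qlo S := by
  intro a ha b hb
  by_cases hr : Refresh T m x s a
  · obtain ⟨h1, h2⟩ := Good.step_bounds_of_refresh hr
    obtain ⟨h3, h4⟩ := Good.step_bounds_of_refresh (h.refresh_congr hu hm hS ha hb hr)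
    rw [h1, h2, h3, h4, EReal.coe_le_coe_iff, EReal.coe_le_coe_iff,
      h.sampleCount_eq hu hm x hS ha hb]
    intro h5; linarith
  · obtain ⟨h1, h2⟩ := Good.step_bounds_of_not_refresh hr
    obtain ⟨h3, h4⟩ := Good.step_bounds_of_not_refresh
      (fun h' => hr (h.refresh_congr hu hm hS hb ha h'))
    rw [h1, h2, h3, h4]
    exact h.aligned S hS a ha b hb

/-- At a refresh both means have the same sample count, their expectations are ordered as the
parameters by `Exchangeable.mean_mono`, and each error is at most the radius. -/
theorem Good.step_valid (h : Good rr u δ T L t s) (hu : Paired u δ) (hT : 0 < Real.log T)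
    (hm : m = sampleMatching rr fb s.clusters (t + 1)) (hc : Concentrated u T (step T m x s))
    {S : Finset (Item N)} (hS : S ∈ s.clusters) {a b : Item N} (ha : a ∈ S) (hb : b ∈ S)
    (hab : u a ≤ u b) : (step T m x s).Qlo a ≤ (step T m x s).Qhi b := by
  by_cases hr : Refresh T m x s a
  · have hr' := h.refresh_congr hu hm hS ha hb hr
    rw [(Good.step_bounds_of_refresh hr).2, (Good.step_bounds_of_refresh hr').1,
      EReal.coe_le_coe_iff]
    have h1 := hr.abs_mean_sub_le hT hc
    have h2 := hr'.abs_mean_sub_le hT hc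
    have hU := h.ordered.upTo_eq h.covers hS ha hb
    have h3 := (h.step_exchangeable hu hm x hS).mean_mono (U := upTo s.clusters a) hu.pos hb ha
      ((h.ordered.mem_upTo h.covers hS ha).2 (Or.inl hb))
      ((h.ordered.mem_upTo h.covers hS ha).2 (Or.inl ha)) hab
    rw [← hU, ← h.sampleCount_eq hu hm x hS ha hb] at h2
    rw [← h.sampleCount_eq hu hm x hS ha hb]
    have hn : (0 : ℝ) < sampleCount T m x s a := by exact_mod_cast hr.count_pos hT
    set n : ℝ := ((sampleCount T m x s a : ℕ) : ℝ)
    have hw : n * Real.sqrt (Real.log T / n) = Real.sqrt (n * Real.log T) := by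
      have e1 : n * Real.log T = n ^ 2 * (Real.log T / n) := by field_simp
      rw [e1, Real.sqrt_mul (by positivity), Real.sqrt_sq hn.le]
    rw [abs_le] at h1 h2
    refine le_of_mul_le_mul_left ?_ hn
    rw [mul_sub, mul_add, hw]
    linarith
  · rw [(Good.step_bounds_of_not_refresh hr).2, (Good.step_bounds_of_not_refresh
      (fun h' => hr (h.refresh_congr hu hm hS hb ha h'))).1]
    exact h.valid S hS a ha b hb hab

theorem Good.split_eq_of_not_refresh (h : Good rr u δ T L t s) (hu : Paired u δ)
    (hm : m = sampleMatching rr fb s.clusters (t + 1)) {S : Finset (Item N)} (hS : S ∈ s.clusters)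
    (hr : ∀ i ∈ S, ¬ Refresh T m x s i) :
    splitCluster (step T m x s).Qhi (step T m x s).Qlo S = [S] := by
  refine splitCluster_eq_singleton h.step_lo_le_hi (h.step_aligned hu hm hS) ?_ (h.nonempty S hS)
  intro A hA hne hneq
  obtain ⟨a, ha, b, hb, hbA, hab⟩ := h.linked S hS A hA hne hneq
  refine ⟨a, ha, b, hb, hbA, ?_⟩
  rwa [(Good.step_bounds_of_not_refresh (hr a (hA ha))).2,
    (Good.step_bounds_of_not_refresh (hr b hb)).1]

theorem mem_step_clusters {A : Finset (Item N)} : A ∈ (step T m x s).clusters ↔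
    ∃ S ∈ s.clusters, A ∈ splitCluster (step T m x s).Qhi (step T m x s).Qlo S := by
  rw [step_clusters, List.mem_flatMap]

theorem Good.step_covers (h : Good rr u δ T L t s) : Covers (step T m x s).clusters := by
  intro i
  obtain ⟨S, hS, hi⟩ := h.covers i
  obtain ⟨A, hA, hiA⟩ := exists_mem_splitCluster (Qhi := (step T m x s).Qhi)
    (Qlo := (step T m x s).Qlo) hi
  exact ⟨A, mem_step_clusters.2 ⟨S, hS, hA⟩, hiA⟩

theorem Good.step_ordered (h : Good rr u δ T L t s) (hu : Paired u δ) (hT : 0 < Real.log T)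
    (hm : m = sampleMatching rr fb s.clusters (t + 1)) (hc : Concentrated u T (step T m x s)) :
    Ordered u (step T m x s).clusters := by
  rw [step_clusters, Ordered, List.pairwise_flatMap]
  constructor
  · intro S hS
    refine (pairwise_splitCluster (h.step_aligned hu hm hS)).imp_of_mem ?_
    intro A B hA hB hAB a ha b hb
    by_contra hle
    exact absurd (hAB a ha b hb) (not_lt.2 (h.step_valid hu hT hm hc hS
      (subset_of_mem_splitCluster hA ha) (subset_of_mem_splitCluster hB hb) (not_lt.1 hle)))
  · refine h.ordered.imp ?_
    intro S S' hSS' A hA B hB a ha b hb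
    exact hSS' a (subset_of_mem_splitCluster hA ha) b (subset_of_mem_splitCluster hB hb)

/-- A split needs a refresh, hence a complete tournament. So an unfinished tournament keeps its
cluster, and after a finished one every piece starts with an empty buffer. -/
theorem Good.step_buffer (h : Good rr u δ T L t s) (hu : Paired u δ) (hT : 0 < Real.log T)
    (hm : m = sampleMatching rr fb s.clusters (t + 1)) (hc : Concentrated u T (step T m x s))
    {A : Finset (Item N)} (hA : A ∈ (step T m x s).clusters) :
    ∃ r, r + 1 < A.card ∧ r ≤ t + 1 ∧ ∀ i ∈ A, ∀ j, (step T m x s).Cbuf i j =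
      ((Finset.Ioc (t + 1 - r) (t + 1)).filter
        fun τ => rr.opponent A (τ % (A.card - 1)) i = j).card := by
  obtain ⟨S, hS, hAS⟩ := mem_step_clusters.1 hA
  rcases h.tournament hu hm hS with ⟨h1, r, hr, hrt, hbuf⟩ | ⟨h1, -⟩
  · rw [h.split_eq_of_not_refresh hu hm hS fun i hi hr => h1 i hi hr.1] at hAS
    rw [List.mem_singleton.1 hAS]
    refine ⟨r, hr, hrt, fun i hi j => ?_⟩
    rw [step_Cbuf, if_neg (h1 i hi), hbuf i hi j]
  · refine ⟨0, ?_, by omega, fun i hi j => ?_⟩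
    · obtain ⟨i, hi⟩ := nonempty_of_mem_splitCluster hAS
      have := (h.step_ordered hu hT hm hc).mem_of_eq h.step_covers hA hi (hu.twin_eq i)
      exact Finset.one_lt_card.2 ⟨i, hi, twin i, this, ((twinMatching N).mate_ne i).symm⟩
    · rw [step_Cbuf, if_pos (h1 i (subset_of_mem_splitCluster hAS hi))]
      simp

/-- Cutting `A` at a value `θ` of `u` gives a subset to which `Linked` applies; the overlap across
the cut is a small difference by `gap_le_of_overlap`. -/
theorem Good.step_narrow_of_refresh (h : Good rr u δ T L t s) (hu : Paired u δ)
    (hT : 0 < Real.log T) (hm : m = sampleMatching rr fb s.clusters (t + 1))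
    (hc : Concentrated u T (step T m x s)) {S A : Finset (Item N)} (hS : S ∈ s.clusters)
    (hA : A ∈ splitCluster (step T m x s).Qhi (step T m x s).Qlo S) {i : Item N} (hi : i ∈ S)
    (hr : Refresh T m x s i) {l : ℕ} (hl : level T l ≤ sampleCount T m x s i)
    {a b : Item N} (ha : a ∈ A) (hb : b ∈ A) (hba : u b ≤ u a) : Narrow N δ l (u a - u b) := by
  have hAS := subset_of_mem_splitCluster hA
  refine narrow_of_linked hu hAS (h.twin_mem hu S hS) ?_ ha hb hba
  rintro θ ⟨a₀, ha₀, hθa⟩ ⟨b₀, hb₀, hθb⟩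
  obtain ⟨a, ha, b, hb, hbA, hQ⟩ := linked_of_mem_splitCluster h.step_lo_le_hi hA
    (A.filter fun k => θ < u k) (Finset.filter_subset _ _)
    ⟨a₀, Finset.mem_filter.2 ⟨ha₀, hθa⟩⟩ (by
      intro heq
      rw [← heq] at hb₀
      exact absurd (Finset.mem_filter.1 hb₀).2 (not_lt.2 hθb))
  obtain ⟨haA, hθa⟩ := Finset.mem_filter.1 ha
  have hθb : u b ≤ θ := by
    by_contra hcon
    exact hbA (Finset.mem_filter.2 ⟨hb, not_le.1 hcon⟩)
  refine ⟨a, haA, b, hb, hθa, hθb, ?_⟩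
  have hra := h.refresh_congr hu hm hS hi (hAS haA) hr
  have hrb := h.refresh_congr hu hm hS hi (hAS hb) hr
  have hUa := fun k => h.ordered.mem_upTo h.covers hS (hAS haA) (j := k)
  have h1 := hra.abs_mean_sub_le hT hc
  have h2 := hrb.abs_mean_sub_le hT hc
  have hnab := h.sampleCount_eq hu hm x hS (hAS haA) (hAS hb)
  rw [← hnab, ← h.ordered.upTo_eq h.covers hS (hAS haA) (hAS hb)] at h2
  rw [(Good.step_bounds_of_refresh hra).2, (Good.step_bounds_of_refresh hrb).1,
    EReal.coe_le_coe_iff, ← hnab] at hQ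
  rw [h.sampleCount_eq hu hm x hS hi (hAS haA)] at hl
  exact gap_le_of_overlap hu hT (h.step_exchangeable hu hm x hS) (h.twin_mem hu S hS)
    (fun k hk => (hUa k).2 (Or.inl hk))
    (fun j hj hjS k hk => (h.ordered.forall_lt h.covers hS (hAS haA)
      (((hUa j).1 hj).resolve_left hjS) hjS k hk).le)
    (hAS haA) (hAS hb) (hθb.trans_lt hθa) rfl hl h1 h2 hQ

/-- Splitting only removes opponents from the count. If level `l` had been reached before, the
parent cluster was already narrow. Otherwise it was crossed by the `|S| - 1` samples just recorded,
which is exactly the condition for a refresh. -/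
theorem Good.step_narrow (h : Good rr u δ T L t s) (hu : Paired u δ) (hT : 0 < Real.log T)
    (hm : m = sampleMatching rr fb s.clusters (t + 1)) (hc : Concentrated u T (step T m x s))
    {A : Finset (Item N)} (hA : A ∈ (step T m x s).clusters) {i : Item N} (hi : i ∈ A) {l : ℕ}
    (hl0 : 0 < l)
    (hl : level T l ≤ ∑ j ∈ upTo (step T m x s).clusters i, (step T m x s).C i j)
    {a b : Item N} (ha : a ∈ A) (hb : b ∈ A) (hba : u b ≤ u a) : Narrow N δ l (u a - u b) := by
  obtain ⟨S, hS, hAS⟩ := mem_step_clusters.1 hA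
  have hsub := subset_of_mem_splitCluster hAS
  have hord := h.step_ordered hu hT hm hc
  have hcov := h.step_covers (m := m) (x := x)
  have hcount : level T l ≤ sampleCount T m x s i := by
    refine hl.trans (Finset.sum_le_sum_of_subset ?_)
    intro j hj
    rw [hord.mem_upTo hcov hA hi] at hj
    rw [h.ordered.mem_upTo h.covers hS (hsub hi)]
    exact hj.imp (fun h' => hsub h') id
  by_cases hold : level T l ≤ ∑ j ∈ upTo s.clusters i, s.C i j
  · exact h.narrow S hS i (hsub hi) l hl0 hold a (hsub ha) b (hsub hb) hba
  by_cases hd : Done m s i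
  · refine h.step_narrow_of_refresh hu hT hm hc hS hAS (hsub hi) ⟨hd, l, hl0, hcount, ?_⟩ hcount
      ha hb hba
    rw [h.sampleCount_of_done hu hm x hS (hsub hi) hd, h.ordered.clusterOf_eq hS (hsub hi)]
    omega
  · refine absurd (hcount.trans_eq ?_) hold
    rw [sampleCount]
    exact Finset.sum_congr rfl fun j _ => by rw [step_C, if_neg hd]

/-- Let `f` be the recorded samples of `j` against better items and `l` the level they have reached.
The count used by the algorithm is at least `f`, so for `l > 0` the cluster is narrow at level `l`,
while for `l = 0` the trivial bound serves. A strictly better item in the cluster forces `2 ^ l * δ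
^ 2 ≤ 64`, so `l` is among the levels of the potential. -/
theorem Good.step_pot (h : Good rr u δ T L t s) (hu : Paired u δ) (hT : 0 < Real.log T)
    (hL : ∀ l : ℕ, 2 ^ l * δ ^ 2 ≤ 64 → l ≤ L)
    (hm : m = sampleMatching rr fb s.clusters (t + 1)) (j : Item N) :
    ∑ i with u j < u i, (u i - u j) ^ 2 * ((step T m x s).C j i : ℝ) ≤
      potential N δ T L (∑ i with u j < u i, ((step T m x s).C j i : ℝ)) := by
  classical
  obtain ⟨S, hS, hj⟩ := h.covers j
  by_cases hd : Done m s j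
  swap
  · have : ∀ i, (step T m x s).C j i = s.C j i := fun i => by rw [step_C, if_neg hd]
    simp only [this]
    exact h.pot j
  have hC : ∀ i, u j < u i → ((step T m x s).C j i : ℝ) = s.C j i + if i ∈ S then 1 else 0 := by
    intro i hi
    have hne : i ≠ j := by rintro rfl; exact lt_irrefl _ hi
    rw [h.step_C_eq hu hm x hS hj]
    simp [hd, hne]
  set G := S.filter fun i => u j < u i with hG
  have hGf : (Finset.univ.filter fun i => u j < u i).filter (fun i => i ∈ S) = G := by
    ext i; simp [hG, and_comm]
  set f := ∑ i with u j < u i, s.C j i with hf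
  have e1 : ∑ i with u j < u i, ((step T m x s).C j i : ℝ) = f + G.card := by
    rw [Finset.sum_congr rfl fun i hi => hC i (Finset.mem_filter.1 hi).2, Finset.sum_add_distrib,
      Finset.sum_boole, hGf, hf]
    push_cast; rfl
  have e2 : ∑ i with u j < u i, (u i - u j) ^ 2 * ((step T m x s).C j i : ℝ) =
      ∑ i with u j < u i, (u i - u j) ^ 2 * (s.C j i : ℝ) + ∑ i ∈ G, (u i - u j) ^ 2 := by
    rw [← hGf, Finset.sum_filter (fun i => i ∈ S), ← Finset.sum_add_distrib]
    refine Finset.sum_congr rfl fun i hi => ?_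
    rw [hC i (Finset.mem_filter.1 hi).2]
    split_ifs <;> ring
  have hpot := h.pot j
  have e3 : ∑ i with u j < u i, (s.C j i : ℝ) = f := by rw [hf]; push_cast; rfl
  rw [e3] at hpot
  rw [e1, e2]
  rcases G.eq_empty_or_nonempty with hGe | ⟨k, hk⟩
  · rw [hGe]; simpa using hpot
  have hex := exists_level_gt hT f
  set l := Nat.find hex with hl
  have hlt : f < level T (l + 1) := Nat.find_spec hex
  have hfn : f ≤ ∑ i ∈ upTo s.clusters j, s.C j i := by
    refine Finset.sum_le_sum_of_subset ?_
    intro i hi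
    exact (h.ordered.mem_upTo h.covers hS hj).2 (Or.inr (Finset.mem_filter.1 hi).2)
  have hnar : 0 < l → ∀ i ∈ G, Narrow N δ l (u i - u j) := by
    intro hl0 i hi
    have h1 : ¬ f < level T (l - 1 + 1) := Nat.find_min hex (by omega)
    rw [Nat.sub_add_cancel hl0, not_lt] at h1
    obtain ⟨hiS, hij⟩ := Finset.mem_filter.1 hi
    exact h.narrow S hS j hj l hl0 (h1.trans hfn) i hiS j hj hij.le
  have hlL : l ≤ L := by
    rcases Nat.eq_zero_or_pos l with h0 | h0
    · omega
    · refine hL l ?_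
      have h1 := (hnar h0 k hk).1
      have h2 := hu.gap k j (Finset.mem_filter.1 hk).2
      have h3 : 2 ^ l * (δ * δ) ≤ 2 ^ l * (δ * (u k - u j)) :=
        mul_le_mul_of_nonneg_left (mul_le_mul_of_nonneg_left h2 hu.delta_pos.le) (by positivity)
      nlinarith
  have hsq : ∀ i ∈ G, (u i - u j) ^ 2 ≤ spreadBound N δ l := by
    intro i hi
    rcases Nat.eq_zero_or_pos l with h0 | h0
    · rw [h0]; exact hu.sq_le_spreadBound_zero i j
    · exact sq_le_spreadBound hu.delta_pos (sub_pos.2 (Finset.mem_filter.1 hi).2).le (hnar h0 i hi)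
  have hcard : (G.card : ℝ) ≤ 2 * N := by
    have : G.card ≤ 2 * N := by simpa using Finset.card_le_univ G
    exact_mod_cast this
  have h5 := potential_step (f := f) hlL (Nat.cast_nonneg G.card) hcard
    (by exact_mod_cast hlt.le) le_rfl (δ := δ)
  have h6 := Finset.sum_le_card_nsmul G _ _ hsq
  rw [nsmul_eq_mul] at h6
  linarith

theorem Good.step (h : Good rr u δ T L t s) (hu : Paired u δ) (hT : 0 < Real.log T)
    (hL : ∀ l : ℕ, 2 ^ l * δ ^ 2 ≤ 64 → l ≤ L)
    (hm : m = sampleMatching rr fb s.clusters (t + 1))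
    (hc : Concentrated u T (MatchingBandit.step T m x s)) :
    Good rr u δ T L (t + 1) (MatchingBandit.step T m x s) where
  covers := h.step_covers
  ordered := h.step_ordered hu hT hm hc
  nonempty A hA := by
    obtain ⟨S, hS, hAS⟩ := mem_step_clusters.1 hA
    exact nonempty_of_mem_splitCluster hAS
  linked A hA := by
    obtain ⟨S, hS, hAS⟩ := mem_step_clusters.1 hA
    exact linked_of_mem_splitCluster h.step_lo_le_hi hAS
  lo_le_hi := h.step_lo_le_hi
  aligned A hA a ha b hb := by
    obtain ⟨S, hS, hAS⟩ := mem_step_clusters.1 hA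
    have hsub := subset_of_mem_splitCluster hAS
    exact h.step_aligned hu hm hS a (hsub ha) b (hsub hb)
  valid A hA a ha b hb hab := by
    obtain ⟨S, hS, hAS⟩ := mem_step_clusters.1 hA
    have hsub := subset_of_mem_splitCluster hAS
    exact h.step_valid hu hT hm hc hS (hsub ha) (hsub hb) hab
  buffer A hA := h.step_buffer hu hT hm hc hA
  exch A hA := by
    obtain ⟨S, hS, hAS⟩ := mem_step_clusters.1 hA
    have hsub := subset_of_mem_splitCluster hAS
    have hE := h.step_exchangeable hu hm x hS
    exact ⟨hE.symm, hE.self, fun i hi k hk => hE.exch i (hsub hi) k (hsub hk)⟩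
  narrow A hA i hi l hl0 hl a ha b hb hba := h.step_narrow hu hT hm hc hA hi hl0 hl ha hb hba
  pot j := h.step_pot hu hT hL hm j

theorem potential_zero (N : ℕ) (δ : ℝ) (T L : ℕ) : potential N δ T L 0 = 0 := by
  refine Finset.sum_eq_zero fun l _ => ?_
  rw [min_eq_left (by positivity), mul_zero]

theorem Good.init (rr : RoundRobin N) (hu : Paired u δ) (hT : 0 < Real.log T) (L : ℕ) :
    Good rr u δ T L 0 (State.init N) where
  covers i := ⟨Finset.univ, by simp [State.init], Finset.mem_univ _⟩
  ordered := List.pairwise_singleton _ _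
  nonempty S hS := by
    have := hu.two_le
    rw [List.mem_singleton.1 hS]
    exact ⟨⟨0, by omega⟩, Finset.mem_univ _⟩
  linked S hS A hA hne hneq := by
    obtain ⟨a, ha⟩ := hne
    have : ∃ b ∈ S, b ∉ A := by
      by_contra hcon
      push Not at hcon
      exact hneq (hA.antisymm hcon)
    obtain ⟨b, hb, hbA⟩ := this
    exact ⟨a, ha, b, hb, hbA, bot_le⟩
  lo_le_hi i := bot_le
  aligned S _ a _ b _ _ := bot_le
  valid S _ a _ b _ _ := bot_le
  buffer S hS := by
    have := hu.two_le
    rw [List.mem_singleton.1 hS]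
    refine ⟨0, by rw [Finset.card_univ, Fintype.card_fin]; omega, le_rfl, fun i _ j => ?_⟩
    simp [State.init]
  exch S _ := ⟨fun _ _ => rfl, fun _ => rfl, fun _ _ _ _ _ _ _ => rfl⟩
  narrow S _ i _ l _ hl := by
    exfalso
    have h1 := le_level T l
    have h2 : (0 : ℝ) < level T l := lt_of_lt_of_le (by positivity) h1
    simp only [State.init, Finset.sum_const_zero, nonpos_iff_eq_zero] at hl
    rw [hl] at h2
    simp at h2
  pot j := by simp [State.init, potential_zero]

theorem good_stateAt (hu : Paired u δ) (hT : 0 < Real.log T)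
    (hL : ∀ l : ℕ, 2 ^ l * δ ^ 2 ≤ 64 → l ≤ L) (x : ℕ → Item N → Item N → ℝ) (t : ℕ)
    (hc : ∀ t' ≤ t, Concentrated u T (stateAt rr fb T x t')) :
    Good rr u δ T L t (stateAt rr fb T x t) := by
  induction t with
  | zero => exact Good.init rr hu hT L
  | succ t ih => exact (ih fun t' ht' => hc t' (by omega)).step hu hT hL rfl (hc (t + 1) le_rfl)

end Step

/-! ### The regret of a good run -/

section Regret

variable {rr : RoundRobin N} {fb : Matching N} {u : Item N → ℝ} {δ : ℝ} {T L : ℕ}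

theorem sum_loss_eq (x : ℕ → Item N → Item N → ℝ) (t : ℕ) :
    ∑ τ ∈ Finset.Icc 1 t, ∑ i, (u i - u ((played rr fb T x τ).mate i)) ^ 2 =
      ∑ i, ∑ j, (u i - u j) ^ 2 *
        (((stateAt rr fb T x t).C i j + (stateAt rr fb T x t).Cbuf i j : ℕ) : ℝ) := by
  induction t with
  | zero => simp [stateAt, State.init]
  | succ t ih =>
    rw [Finset.sum_Icc_succ_top (by omega), ih, ← Finset.sum_add_distrib]
    refine Finset.sum_congr rfl fun i _ => ?_
    have hC : ∀ j, (stateAt rr fb T x (t + 1)).C i j + (stateAt rr fb T x (t + 1)).Cbuf i j =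
        (stateAt rr fb T x t).C i j + (stateAt rr fb T x t).Cbuf i j +
        if (played rr fb T x (t + 1)).mate i = j then 1 else 0 := fun j =>
      step_count_total _ _ _ _ i j
    simp only [hC]
    push_cast
    simp only [mul_add, Finset.sum_add_distrib]
    simp

theorem Good.buffer_le {t : ℕ} {s : State N} (h : Good rr u δ T L t s) (i j : Item N) :
    s.Cbuf i j ≤ 2 * N := by
  obtain ⟨S, hS, hi⟩ := h.covers i
  obtain ⟨r, hr, hrt, hb⟩ := h.buffer S hS
  rw [hb i hi j]
  refine (Finset.card_filter_le _ _).trans ?_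
  rw [Nat.card_Ioc]
  have : S.card ≤ 2 * N := by simpa using Finset.card_le_univ S
  omega

/-- Each unordered pair occurs twice on the left and is assigned to its worse item on the right;
ties contribute nothing. -/
theorem sum_sq_mul_eq (C : Item N → Item N → ℕ) (hC : ∀ i j, C i j = C j i) :
    ∑ i, ∑ j, (u i - u j) ^ 2 * (C i j : ℝ) =
      2 * ∑ j, ∑ i with u j < u i, (u i - u j) ^ 2 * (C j i : ℝ) := by
  have h1 : ∀ i j, (u i - u j) ^ 2 * (C i j : ℝ) =
      (if u i < u j then (u j - u i) ^ 2 * (C i j : ℝ) else 0) +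
        (if u j < u i then (u i - u j) ^ 2 * (C j i : ℝ) else 0) := by
    intro i j
    rcases lt_trichotomy (u i) (u j) with h | h | h
    · rw [if_pos h, if_neg h.not_gt]; ring
    · simp [h]
    · rw [if_pos h, if_neg h.not_gt, hC i j]; ring
  simp only [h1, Finset.sum_add_distrib, Finset.sum_filter]
  rw [Finset.sum_comm (f := fun i j => if u j < u i then (u i - u j) ^ 2 * (C j i : ℝ) else 0)]
  ring

theorem level_le (hT : 0 ≤ Real.log T) (l : ℕ) :
    (level T l : ℝ) ≤ 4 ^ (l + 1) * Real.log T + 1 :=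
  (Nat.ceil_lt_add_one (mul_nonneg (by positivity) hT)).le

theorem potential_le (N : ℕ) (δ : ℝ) (hT : 0 ≤ Real.log T) (L : ℕ) (f : ℝ) :
    potential N δ T L f ≤
      16 * Real.log T * ∑ l ∈ Finset.range (L + 1), 4 ^ l * spreadBound N δ l +
        (2 * N + 1) * ∑ l ∈ Finset.range (L + 1), spreadBound N δ l := by
  rw [Finset.mul_sum, Finset.mul_sum, ← Finset.sum_add_distrib, potential]
  refine Finset.sum_le_sum fun l _ => ?_
  have h1 := spreadBound_nonneg N δ l
  have h2 := level_le hT (l + 1)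
  have h3 : min f (level T (l + 1) + 2 * N) ≤ 4 ^ (l + 1 + 1) * Real.log T + 1 + 2 * N :=
    (min_le_right _ _).trans (by linarith)
  have h4 := mul_le_mul_of_nonneg_left h3 h1
  refine h4.trans (le_of_eq ?_)
  rw [pow_succ, pow_succ]
  ring

/-- The summands are at most `min (16 * N ^ 2 * 2 ^ l) (4096 / δ ^ 2)`. The two bounds cross about
`2 * log₂ N` levels below `L`, which is where the factor `log N` arises. -/
theorem sum_spreadBound_le (hN : 2 ≤ N) (hδ : 0 < δ) (hL : 2 ^ L * δ ^ 2 ≤ 64) :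
    ∑ l ∈ Finset.range (L + 1), 4 ^ l * spreadBound N δ l ≤ 40960 * Real.log N / δ ^ 2 := by
  set J := 2 * (Nat.log 2 N + 1) with hJ
  have hNJ : (N : ℝ) ^ 2 ≤ 2 ^ J := by
    have h1 : N < 2 ^ (Nat.log 2 N + 1) := Nat.lt_pow_succ_log_self (by norm_num) N
    have h2 : (N : ℝ) ≤ 2 ^ (Nat.log 2 N + 1) := by exact_mod_cast h1.le
    rw [hJ, mul_comm 2, pow_mul]
    exact pow_le_pow_left₀ (Nat.cast_nonneg _) h2 2
  have h4 : ∀ l : ℕ, (4 : ℝ) ^ l = 2 ^ l * 2 ^ l := fun l => by rw [← mul_pow]; norm_num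
  have hA : ∀ l, 4 ^ l * spreadBound N δ l ≤ 16 * (N : ℝ) ^ 2 * 2 ^ l := by
    intro l
    refine (mul_le_mul_of_nonneg_left (min_le_left _ _) (by positivity)).trans (le_of_eq ?_)
    rw [h4]; field_simp
  have hB : ∀ l, 4 ^ l * spreadBound N δ l ≤ 4096 / δ ^ 2 := by
    intro l
    refine (mul_le_mul_of_nonneg_left (min_le_right _ _) (by positivity)).trans (le_of_eq ?_)
    field_simp; norm_num
  rw [← Finset.sum_filter_add_sum_filter_not _ (fun l => l + J ≤ L)]
  -- Low levels: a geometric sum dominated by `32 * 2 ^ L ≤ 2048 / δ ^ 2`, because `N ^ 2 ≤ 2 ^ J`.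
  have h1 : ∑ l ∈ (Finset.range (L + 1)).filter (fun l => l + J ≤ L), 4 ^ l * spreadBound N δ l ≤
      2048 / δ ^ 2 := by
    have e : (Finset.range (L + 1)).filter (fun l => l + J ≤ L) = Finset.range (L + 1 - J) := by
      ext l; simp only [Finset.mem_filter, Finset.mem_range]; omega
    rw [e]
    refine (Finset.sum_le_sum fun l _ => hA l).trans ?_
    rw [← Finset.mul_sum]
    rcases le_or_gt J L with hJL | hJL
    · have hgeom : ∑ l ∈ Finset.range (L + 1 - J), (2 : ℝ) ^ l ≤ 2 ^ (L + 1 - J) := by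
        rw [geom_sum_eq (by norm_num)]; norm_num
      have h5 : (N : ℝ) ^ 2 * 2 ^ (L + 1 - J) ≤ 2 ^ (L + 1) := by
        have : (2 : ℝ) ^ (L + 1) = 2 ^ J * 2 ^ (L + 1 - J) := by rw [← pow_add]; congr 1; omega
        rw [this]
        exact mul_le_mul_of_nonneg_right hNJ (by positivity)
      rw [le_div_iff₀ (by positivity)]
      have h6 : 16 * (N : ℝ) ^ 2 * ∑ l ∈ Finset.range (L + 1 - J), (2 : ℝ) ^ l ≤ 32 * 2 ^ L := by
        have := mul_le_mul_of_nonneg_left hgeom (show (0 : ℝ) ≤ 16 * (N : ℝ) ^ 2 by positivity)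
        have e2 : (2 : ℝ) ^ (L + 1) = 2 ^ L * 2 := pow_succ _ _
        linarith
      have := mul_le_mul_of_nonneg_right h6 (show (0 : ℝ) ≤ δ ^ 2 by positivity)
      linarith
    · have : L + 1 - J = 0 := by omega
      rw [this, Finset.range_zero, Finset.sum_empty, mul_zero]
      positivity
  have h2 : ∑ l ∈ (Finset.range (L + 1)).filter (fun l => ¬ l + J ≤ L), 4 ^ l * spreadBound N δ l ≤
      J * (4096 / δ ^ 2) := by
    refine (Finset.sum_le_card_nsmul _ _ _ fun l _ => hB l).trans ?_
    rw [nsmul_eq_mul]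
    refine mul_le_mul_of_nonneg_right ?_ (by positivity)
    have : ((Finset.range (L + 1)).filter (fun l => ¬ l + J ≤ L)).card ≤
        (Finset.Ico (L + 1 - J) (L + 1)).card := by
      refine Finset.card_le_card fun l hl => ?_
      simp only [Finset.mem_filter, Finset.mem_range, Finset.mem_Ico] at hl ⊢
      omega
    rw [Nat.card_Ico] at this
    exact_mod_cast this.trans (by omega)
  refine (add_le_add h1 h2).trans ?_
  have h3 : (J : ℝ) + 1 ≤ 10 * Real.log N := by
    have hlog1 : 1 ≤ Nat.log 2 N := Nat.log_pos (by norm_num) hN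
    have h5 : (J : ℝ) + 1 ≤ 5 * Nat.log 2 N := by
      have : J + 1 ≤ 5 * Nat.log 2 N := by omega
      exact_mod_cast this
    have h6 : Nat.log 2 N * Real.log 2 ≤ Real.log N := by
      rw [← Real.log_pow]
      refine Real.log_le_log (by positivity) ?_
      exact_mod_cast Nat.pow_log_le_self 2 (by omega)
    have h7 := Real.log_two_gt_d9
    have h8 : (1 : ℝ) ≤ Nat.log 2 N := by exact_mod_cast hlog1
    nlinarith
  have e : 2048 / δ ^ 2 + J * (4096 / δ ^ 2) = (2048 + 4096 * J) / δ ^ 2 := by ring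
  rw [e]
  refine div_le_div_of_nonneg_right ?_ (by positivity)
  linarith

/-- The part of the regret of a good run that does not depend on the horizon. -/
def goodConstant (N : ℕ) (δ : ℝ) (L : ℕ) : ℝ :=
  N * ((2 * N + 1) * ∑ l ∈ Finset.range (L + 1), spreadBound N δ l) + 2 * N ^ 3

/-- A quarter of the sum over ordered pairs is half of the sum of the `2 * N` potentials, which
gives `655360 = 16 * 40960`. The unrecorded samples, at most `2 * N` for each of `4 * N ^ 2` ordered
pairs, add `2 * N ^ 3`. -/
theorem regret_le_of_concentrated (hu : Paired u δ) (hT : 0 < Real.log T)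
    (hL : ∀ l : ℕ, 2 ^ l * δ ^ 2 ≤ 64 → l ≤ L) (hL' : 2 ^ L * δ ^ 2 ≤ 64)
    (x : ℕ → Item N → Item N → ℝ)
    (hc : ∀ t ≤ T, Concentrated u T (stateAt rr fb T x t)) :
    regret u T (played rr fb T x) ≤
      655360 * (N * Real.log N / δ ^ 2) * Real.log T + goodConstant N δ L := by
  have hgood : Good rr u δ T L T (stateAt rr fb T x T) := good_stateAt hu hT hL x T hc
  have h1 := regret_eq hu.twin_eq T (played rr fb T x)
  rw [sum_loss_eq] at h1
  set s := stateAt rr fb T x T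
  have hsymm : ∀ i j, s.C i j = s.C j i := by
    obtain ⟨S, hS, -⟩ := hgood.covers ⟨0, by have := hu.two_le; omega⟩
    exact (hgood.exch S hS).symm
  have h2 : ∑ i, ∑ j, (u i - u j) ^ 2 * ((s.C i j + s.Cbuf i j : ℕ) : ℝ) =
      ∑ i, ∑ j, (u i - u j) ^ 2 * (s.C i j : ℝ) + ∑ i, ∑ j, (u i - u j) ^ 2 * (s.Cbuf i j : ℝ) := by
    rw [← Finset.sum_add_distrib]
    refine Finset.sum_congr rfl fun i _ => ?_
    rw [← Finset.sum_add_distrib]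
    exact Finset.sum_congr rfl fun j _ => by push_cast; ring
  have h3 : ∑ i, ∑ j, (u i - u j) ^ 2 * (s.Cbuf i j : ℝ) ≤ ∑ _i : Item N, ∑ _j : Item N,
      (1 * (2 * N) : ℝ) := by
    refine Finset.sum_le_sum fun i _ => Finset.sum_le_sum fun j _ => ?_
    have : (s.Cbuf i j : ℝ) ≤ 2 * N := by exact_mod_cast hgood.buffer_le i j
    exact mul_le_mul (hu.abs_sub_le i j) this (Nat.cast_nonneg _) zero_le_one
  simp only [Finset.sum_const, Finset.card_univ, Fintype.card_fin, nsmul_eq_mul] at h3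
  push_cast at h3
  rw [h2, sum_sq_mul_eq s.C hsymm] at h1
  set P := 16 * Real.log T * ∑ l ∈ Finset.range (L + 1), 4 ^ l * spreadBound N δ l +
        (2 * N + 1) * ∑ l ∈ Finset.range (L + 1), spreadBound N δ l with hP
  have h4 : ∑ j, ∑ i with u j < u i, (u i - u j) ^ 2 * (s.C j i : ℝ) ≤ ∑ _j : Item N, P :=
    Finset.sum_le_sum fun j _ => (hgood.pot j).trans (potential_le N δ hT.le L _)
  simp only [Finset.sum_const, Finset.card_univ, Fintype.card_fin, nsmul_eq_mul] at h4
  push_cast at h4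
  have h5 := mul_le_mul_of_nonneg_left (sum_spreadBound_le hu.two_le hu.delta_pos hL')
    (show 0 ≤ 16 * N * Real.log T by positivity)
  have h6 : 16 * N * Real.log T * (40960 * Real.log N / δ ^ 2) =
      655360 * (N * Real.log N / δ ^ 2) * Real.log T := by ring
  rw [h6] at h5
  rw [goodConstant]
  have h7 : (N : ℝ) * P = 16 * N * Real.log T *
      ∑ l ∈ Finset.range (L + 1), 4 ^ l * spreadBound N δ l +
      N * ((2 * N + 1) * ∑ l ∈ Finset.range (L + 1), spreadBound N δ l) := by rw [hP]; ring
  nlinarith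

end Regret

/-! ### Measurability of the run -/

/-- All fibres of `k` are measurable. -/
def FibreMeasurable {Ω κ : Type*} [MeasurableSpace Ω] (k : Ω → κ) : Prop :=
  ∀ d, MeasurableSet {ω | k ω = d}

section Fibre

variable {Ω κ κ' : Type*} [MeasurableSpace Ω]

theorem FibreMeasurable.measurableSet [Countable κ] {k : Ω → κ} (h : FibreMeasurable k)
    (p : κ → Prop) : MeasurableSet {ω | p (k ω)} := by
  have : {ω | p (k ω)} = ⋃ d : {d // p d}, {ω | k ω = d} := by
    ext ω
    simp
  rw [this]
  exact MeasurableSet.iUnion fun d => h d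

theorem FibreMeasurable.comp [Countable κ] {k : Ω → κ} (h : FibreMeasurable k) (F : κ → κ') :
    FibreMeasurable fun ω => F (k ω) := fun d => h.measurableSet fun e => F e = d

theorem FibreMeasurable.prodMk {k : Ω → κ} {k' : Ω → κ'} (h : FibreMeasurable k)
    (h' : FibreMeasurable k') : FibreMeasurable fun ω => (k ω, k' ω) := by
  rintro ⟨d, d'⟩
  simp only [Prod.mk.injEq]
  exact (h d).inter (h' d')

theorem FibreMeasurable.pi {ι : Type*} [Countable ι] {k : Ω → ι → κ}
    (h : ∀ i, FibreMeasurable fun ω => k ω i) : FibreMeasurable k := by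
  intro d
  have : {ω | k ω = d} = ⋂ i, {ω | k ω i = d i} := by
    ext ω; simp [funext_iff]
  rw [this]
  exact MeasurableSet.iInter fun i => h i (d i)

theorem FibreMeasurable.of_measurableSet {p : Ω → Prop} [∀ ω, Decidable (p ω)]
    (h : MeasurableSet {ω | p ω}) : FibreMeasurable fun ω => decide (p ω) := by
  intro d
  cases d
  · have : {ω | decide (p ω) = false} = {ω | p ω}ᶜ := by ext ω; simp
    rw [this]
    exact h.compl
  · have : {ω | decide (p ω) = true} = {ω | p ω} := by ext ω; simp
    rw [this]
    exact h

/-- `Ω` is cut into countably many measurable fibres, and on each of them `g` agrees with a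
measurable function. -/
theorem FibreMeasurable.measurable_of_eq {β : Type*} [MeasurableSpace β] [Countable κ] {k : Ω → κ}
    (hk : FibreMeasurable k) {g : Ω → β} (h : κ → Ω → β) (hh : ∀ d, Measurable (h d))
    (hg : ∀ ω, g ω = h (k ω) ω) : Measurable g := by
  intro B hB
  have : g ⁻¹' B = ⋃ d, {ω | k ω = d} ∩ h d ⁻¹' B := by
    ext ω
    simp [hg]
  rw [this]
  exact MeasurableSet.iUnion fun d => (hk d).inter (hh d hB)

theorem FibreMeasurable.measurable {β : Type*} [MeasurableSpace β] [Countable κ] {k : Ω → κ}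
    (hk : FibreMeasurable k) (F : κ → β) : Measurable fun ω => F (k ω) :=
  hk.measurable_of_eq (fun d _ => F d) (fun _ => measurable_const) fun _ => rfl

end Fibre

/-- The part of a state that takes countably many values. -/
abbrev Skeleton (N : ℕ) : Type :=
  (Item N → Item N → ℕ) × (Item N → Item N → ℕ) × List (Finset (Item N))

def State.skeleton (s : State N) : Skeleton N := (s.C, s.Cbuf, s.clusters)

/-- A state with a given skeleton. -/
def Skeleton.toState (d : Skeleton N) : State N :=
  ⟨fun _ _ => 0, d.1, fun _ _ => 0, d.2.1, fun _ => ⊤, fun _ => ⊥, d.2.2⟩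

structure StateMeasurable {Ω : Type*} [MeasurableSpace Ω] (f : Ω → State N) : Prop where
  X : ∀ i j, Measurable fun ω => (f ω).X i j
  Xbuf : ∀ i j, Measurable fun ω => (f ω).Xbuf i j
  Qhi : ∀ i, Measurable fun ω => (f ω).Qhi i
  Qlo : ∀ i, Measurable fun ω => (f ω).Qlo i
  skeleton : FibreMeasurable fun ω => (f ω).skeleton

/-- The splitting step, in terms of the comparisons between confidence bounds. -/
def splitByTable (r : (Item N → Item N → Bool) × (Item N → Item N → Bool)) (S : Finset (Item N)) :
    List (Finset (Item N)) :=
  ((((List.finRange (2 * N)).filter (fun i => decide (i ∈ S))).mergeSort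
    (fun a b => r.1 a b)).splitBy (fun a b => !(r.2 a b))).map List.toFinset

theorem splitCluster_eq_splitByTable (Qhi Qlo : Item N → EReal) (S : Finset (Item N)) :
    splitCluster Qhi Qlo S = splitByTable
      (fun a b => decide (Qhi b ≤ Qhi a), fun a b => decide (Qhi b < Qlo a)) S := by
  simp only [splitCluster, splitByTable, decide_not]

/-- For a fixed skeleton the matching and the completed and refreshed clusters are fixed, and
rewards and bounds are measurable formulas. The new clusters depend on the bounds only through
finitely many comparisons. Zero rewards may stand in wherever only counts matter. -/
theorem StateMeasurable.step {Ω : Type*} [MeasurableSpace Ω] {f : Ω → State N}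
    (hf : StateMeasurable f) (T : ℕ) (M : List (Finset (Item N)) → Matching N)
    {x : Ω → Item N → Item N → ℝ} (hx : ∀ i j, Measurable fun ω => x ω i j) :
    StateMeasurable fun ω => step T (M (f ω).clusters) (x ω) (f ω) := by
  classical
  have hX : ∀ i j, Measurable fun ω => (MatchingBandit.step T (M (f ω).clusters) (x ω) (f ω)).X i j := by
    intro i j
    refine hf.skeleton.measurable_of_eq
      (fun d ω => if Done (M d.2.2) d.toState i then (f ω).X i j + ((f ω).Xbuf i j +
        if (M d.2.2).mate i = j then x ω i j else 0) else (f ω).X i j) ?_ ?_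
    · intro d
      split_ifs
      · exact (hf.X i j).add ((hf.Xbuf i j).add (hx i j))
      · exact (hf.X i j).add ((hf.Xbuf i j).add measurable_const)
      · exact hf.X i j
    · intro ω; exact step_X _ _ _ _ _ _
  have hXb : ∀ i j, Measurable fun ω =>
      (MatchingBandit.step T (M (f ω).clusters) (x ω) (f ω)).Xbuf i j := by
    intro i j
    refine hf.skeleton.measurable_of_eq
      (fun d ω => if Done (M d.2.2) d.toState i then 0 else (f ω).Xbuf i j +
        if (M d.2.2).mate i = j then x ω i j else 0) ?_ ?_
    · intro d
      split_ifs
      · exact measurable_const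
      · exact (hf.Xbuf i j).add (hx i j)
      · exact (hf.Xbuf i j).add measurable_const
    · intro ω; exact step_Xbuf _ _ _ _ _ _
  have hmean : ∀ i, Measurable fun ω => sampleMean T (M (f ω).clusters) (x ω) (f ω) i := by
    intro i
    refine hf.skeleton.measurable_of_eq
      (fun d ω => (∑ j ∈ upTo d.2.2 i,
        (MatchingBandit.step T (M (f ω).clusters) (x ω) (f ω)).X i j) /
          sampleCount T (M d.2.2) (fun _ _ => 0) d.toState i) ?_ ?_
    · intro d
      exact (Finset.measurable_fun_sum _ fun j _ => hX i j).div_const _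
    · intro ω; rfl
  have hQhi : ∀ i, Measurable fun ω =>
      (MatchingBandit.step T (M (f ω).clusters) (x ω) (f ω)).Qhi i := by
    intro i
    refine hf.skeleton.measurable_of_eq
      (fun d ω => if Refresh T (M d.2.2) (fun _ _ => 0) d.toState i then
        ((sampleMean T (M (f ω).clusters) (x ω) (f ω) i + Real.sqrt (Real.log T /
          sampleCount T (M d.2.2) (fun _ _ => 0) d.toState i) : ℝ) : EReal) else (f ω).Qhi i) ?_ ?_
    · intro d
      split_ifs
      · exact measurable_coe_real_ereal.comp ((hmean i).add measurable_const)
      · exact hf.Qhi i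
    · intro ω; exact step_Qhi _ _ _ _ _
  have hQlo : ∀ i, Measurable fun ω =>
      (MatchingBandit.step T (M (f ω).clusters) (x ω) (f ω)).Qlo i := by
    intro i
    refine hf.skeleton.measurable_of_eq
      (fun d ω => if Refresh T (M d.2.2) (fun _ _ => 0) d.toState i then
        ((sampleMean T (M (f ω).clusters) (x ω) (f ω) i - Real.sqrt (Real.log T /
          sampleCount T (M d.2.2) (fun _ _ => 0) d.toState i) : ℝ) : EReal) else (f ω).Qlo i) ?_ ?_
    · intro d
      split_ifs
      · exact measurable_coe_real_ereal.comp ((hmean i).sub measurable_const)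
      · exact hf.Qlo i
    · intro ω; exact step_Qlo _ _ _ _ _
  refine ⟨hX, hXb, hQhi, hQlo, ?_⟩
  have htable : FibreMeasurable fun ω =>
      ((fun a b => decide ((MatchingBandit.step T (M (f ω).clusters) (x ω) (f ω)).Qhi b ≤
          (MatchingBandit.step T (M (f ω).clusters) (x ω) (f ω)).Qhi a),
        fun a b => decide ((MatchingBandit.step T (M (f ω).clusters) (x ω) (f ω)).Qhi b <
          (MatchingBandit.step T (M (f ω).clusters) (x ω) (f ω)).Qlo a)) :
        (Item N → Item N → Bool) × (Item N → Item N → Bool)) := by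
    refine FibreMeasurable.prodMk (.pi fun a => .pi fun b => .of_measurableSet ?_)
      (.pi fun a => .pi fun b => .of_measurableSet ?_)
    · exact measurableSet_le (hQhi b) (hQhi a)
    · exact measurableSet_lt (hQhi b) (hQlo a)
  have hboth := hf.skeleton.prodMk htable
  have hfin := hboth.comp (fun p => (((MatchingBandit.step T (M p.1.2.2) (fun _ _ => 0) p.1.toState).C,
    (MatchingBandit.step T (M p.1.2.2) (fun _ _ => 0) p.1.toState).Cbuf,
    p.1.2.2.flatMap (splitByTable p.2)) : Skeleton N))
  convert hfin using 2 with ω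
  rw [State.skeleton, step_clusters]
  refine Prod.ext rfl (Prod.ext rfl ?_)
  refine congrArg (fun F => List.flatMap F (f ω).clusters) (funext fun S => ?_)
  rw [splitCluster_eq_splitByTable]

theorem stateMeasurable_stateAt {Ω : Type*} [MeasurableSpace Ω] (rr : RoundRobin N)
    (fb : Matching N) (T : ℕ) {x : Ω → ℕ → Item N → Item N → ℝ} (t : ℕ)
    (hx : ∀ τ ≤ t, ∀ i j, Measurable fun ω => x ω τ i j) :
    StateMeasurable fun ω => stateAt rr fb T (x ω) t := by
  induction t with
  | zero =>
    refine ⟨fun _ _ => measurable_const, fun _ _ => measurable_const, fun _ => measurable_const,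
      fun _ => measurable_const, fun d => ?_⟩
    exact MeasurableSet.const ((State.init N).skeleton = d)
  | succ t ih =>
    exact (ih fun τ hτ => hx τ (by omega)).step T
      (fun L => sampleMatching rr fb L (t + 1)) (hx (t + 1) le_rfl)

theorem fibreMeasurable_played {Ω : Type*} [MeasurableSpace Ω] (rr : RoundRobin N)
    (fb : Matching N) (T : ℕ) {x : Ω → ℕ → Item N → Item N → ℝ} (t : ℕ)
    (hx : ∀ τ < t, ∀ i j, Measurable fun ω => x ω τ i j) (ht : 0 < t) :
    FibreMeasurable fun ω => played rr fb T (x ω) t :=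
  (stateMeasurable_stateAt rr fb T (t - 1) fun τ hτ => hx τ (by omega)).skeleton.comp
    fun d => sampleMatching rr fb d.2.2 t

/-! ### Adaptively sampled sub-Gaussian noise -/

section Sampling

variable {Ω E : Type*}

/-- The information in the noise up to time `t`. -/
abbrev past (ε : E → ℕ → Ω → ℝ) (t : ℕ) : MeasurableSpace Ω :=
  ⨆ p ∈ {p : E × ℕ | p.2 ≤ t}, MeasurableSpace.comap (ε p.1 p.2) inferInstance

theorem measurable_past (ε : E → ℕ → Ω → ℝ) {τ t : ℕ} (h : τ ≤ t) (e : E) :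
    Measurable[past ε t] (ε e τ) :=
  Measurable.of_comap_le (le_biSup (fun p : E × ℕ =>
    MeasurableSpace.comap (ε p.1 p.2) inferInstance) (show (e, τ) ∈ {p : E × ℕ | p.2 ≤ t} from h))

theorem past_mono (ε : E → ℕ → Ω → ℝ) {t t' : ℕ} (h : t ≤ t') : past ε t ≤ past ε t' :=
  biSup_mono fun _ hp => le_trans hp h

theorem past_le [mΩ : MeasurableSpace Ω] {ε : E → ℕ → Ω → ℝ} (hε : ∀ e t, Measurable (ε e t))
    (t : ℕ) : past ε t ≤ mΩ :=
  iSup₂_le fun p _ => (hε p.1 p.2).comap_le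

theorem FibreMeasurable.mono {κ : Type*} {m m' : MeasurableSpace Ω} (h : m ≤ m') {k : Ω → κ}
    (hk : @FibreMeasurable Ω κ m k) : @FibreMeasurable Ω κ m' k := fun d => h _ (hk d)

theorem indep_past [mΩ : MeasurableSpace Ω] {μ : Measure Ω} {ε : E → ℕ → Ω → ℝ}
    (hε : ∀ e t, Measurable (ε e t)) (hi : iIndepFun (fun p : E × ℕ => ε p.1 p.2) μ)
    (t : ℕ) (e : E) :
    Indep (past ε t) (MeasurableSpace.comap (ε e (t + 1)) inferInstance) μ := by
  rw [iIndepFun_iff_iIndep] at hi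
  have h := indep_iSup_of_disjoint (fun p : E × ℕ => (hε p.1 p.2).comap_le) hi
    (S := {p : E × ℕ | p.2 ≤ t}) (T := {(e, t + 1)}) (by
      rw [Set.disjoint_singleton_right]
      simp)
  simpa [past] using h

/-- The exponential weight of the sample `o` at time `τ`. -/
def weight (ε : E → ℕ → Ω → ℝ) (s : ℝ) (o : Option E) (τ : ℕ) (ω : Ω) : ENNReal :=
  o.elim 1 fun e => ENNReal.ofReal (Real.exp (s * ε e τ ω - s ^ 2 / 8))

/-- The exponential supermartingale of the samples chosen by `q`. -/
def expProd (ε : E → ℕ → Ω → ℝ) (s : ℝ) (q : ℕ → Ω → Option E) (t : ℕ) (ω : Ω) : ENNReal :=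
  ∏ τ ∈ Finset.Ioc 0 t, weight ε s (q τ ω) τ ω

/-- The number of samples chosen by `q` up to time `t`. -/
def chosenCount (q : ℕ → Ω → Option E) (t : ℕ) (ω : Ω) : ℕ :=
  ∑ τ ∈ Finset.Ioc 0 t, (q τ ω).elim 0 fun _ => 1

/-- The sum of the noise in the samples chosen by `q` up to time `t`. -/
def chosenNoise (ε : E → ℕ → Ω → ℝ) (q : ℕ → Ω → Option E) (t : ℕ) (ω : Ω) : ℝ :=
  ∑ τ ∈ Finset.Ioc 0 t, (q τ ω).elim 0 fun e => ε e τ ω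

/-- The choice `q`, stopped after `m` samples. -/
def stopped (q : ℕ → Ω → Option E) (m τ : ℕ) (ω : Ω) : Option E :=
  if chosenCount q (τ - 1) ω < m then q τ ω else none

variable {ε : E → ℕ → Ω → ℝ} {q : ℕ → Ω → Option E}

theorem expProd_eq (s : ℝ) (t : ℕ) (ω : Ω) : expProd ε s q t ω = ENNReal.ofReal
    (Real.exp (s * chosenNoise ε q t ω - s ^ 2 / 8 * chosenCount q t ω)) := by
  have h : ∀ τ, weight ε s (q τ ω) τ ω = ENNReal.ofReal (Real.exp
      (s * (q τ ω).elim 0 (fun e => ε e τ ω) -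
        s ^ 2 / 8 * (((q τ ω).elim 0 fun _ => 1 : ℕ) : ℝ))) := by
    intro τ
    cases q τ ω <;> simp [weight]
  rw [expProd, Finset.prod_congr rfl fun τ _ => h τ,
    ← ENNReal.ofReal_prod_of_nonneg fun τ _ => (Real.exp_pos _).le, ← Real.exp_sum,
    Finset.sum_sub_distrib, ← Finset.mul_sum, ← Finset.mul_sum, chosenNoise, chosenCount]
  push_cast
  rfl

theorem chosenCount_mono (ω : Ω) : Monotone fun t => chosenCount q t ω := fun _ _ h =>
  Finset.sum_le_sum_of_subset (Finset.Ioc_subset_Ioc_right h)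

/-- The `m`-th sample is chosen no later than `t`, so stopping changes no factor up to `t` and
leaves only factors `1` afterwards. Thus an event at a random time can be read off at the fixed time
`T`. -/
theorem expProd_stopped (s : ℝ) {m t T : ℕ} {ω : Ω} (htT : t ≤ T) (hm : chosenCount q t ω = m) :
    expProd ε s (stopped q m) T ω = expProd ε s q t ω := by
  rw [expProd, expProd, ← Finset.prod_subset (Finset.Ioc_subset_Ioc_right htT)]
  · refine Finset.prod_congr rfl fun τ hτ => ?_
    rw [Finset.mem_Ioc] at hτ
    rw [stopped]
    split_ifs with h
    · rfl
    · cases hq : q τ ω with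
      | none => rfl
      | some e =>
        exfalso
        apply h
        have h1 : chosenCount q τ ω = chosenCount q (τ - 1) ω + 1 := by
          obtain ⟨σ, rfl⟩ : ∃ σ, τ = σ + 1 := ⟨τ - 1, by omega⟩
          rw [chosenCount, Finset.sum_Ioc_succ_top (Nat.zero_le _), hq]
          rfl
        have h2 : chosenCount q τ ω ≤ chosenCount q t ω := chosenCount_mono ω hτ.2
        omega
  · intro τ hτ hτ'
    rw [Finset.mem_Ioc] at hτ hτ'
    have h2 : chosenCount q t ω ≤ chosenCount q (τ - 1) ω := chosenCount_mono ω (by omega)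
    rw [stopped, if_neg (by omega)]
    rfl

theorem measurable_weight {mΩ : MeasurableSpace Ω} (s : ℝ) {τ : ℕ}
    (hε : ∀ e, Measurable (ε e τ)) (o : Option E) : Measurable (weight ε s o τ) := by
  cases o with
  | none => exact measurable_const
  | some e =>
    exact (Real.measurable_exp.comp (((hε e).const_mul s).sub_const _)).ennreal_ofReal

theorem lintegral_weight_le [MeasurableSpace Ω] {μ : Measure Ω} [IsProbabilityMeasure μ]
    (hsub : ∀ e t, HasSubgaussianMGF (ε e t) (1 / 4) μ) (s : ℝ)
    (o : Option E) (τ : ℕ) : ∫⁻ ω, weight ε s o τ ω ∂μ ≤ 1 := by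
  cases o with
  | none => simp [weight]
  | some e =>
    have h1 := (hsub e τ).mgf_le s
    have h2 := (hsub e τ).integrable_exp_mul s
    have e1 : ∀ ω, weight ε s (some e) τ ω = ENNReal.ofReal (Real.exp (s * ε e τ ω)) *
        ENNReal.ofReal (Real.exp (-(s ^ 2 / 8))) := by
      intro ω
      rw [← ENNReal.ofReal_mul (Real.exp_pos _).le, ← Real.exp_add]
      rfl
    simp only [e1]
    rw [lintegral_mul_const' _ _ ENNReal.ofReal_ne_top,
      ← ofReal_integral_eq_lintegral_ofReal h2 (Filter.Eventually.of_forall fun _ =>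
        (Real.exp_pos _).le), ← ENNReal.ofReal_mul (integral_nonneg fun _ => (Real.exp_pos _).le),
      ENNReal.ofReal_le_one]
    have h3 : ∫ ω, Real.exp (s * ε e τ ω) ∂μ ≤ Real.exp (s ^ 2 / 8) := by
      refine h1.trans (le_of_eq ?_)
      congr 1
      push_cast
      ring
    calc _ ≤ Real.exp (s ^ 2 / 8) * Real.exp (-(s ^ 2 / 8)) :=
          mul_le_mul_of_nonneg_right h3 (Real.exp_pos _).le
      _ = 1 := by rw [← Real.exp_add]; simp

variable [Countable E]

theorem fibreMeasurable_chosenCount (hq : ∀ t, @FibreMeasurable Ω _ (past ε t) (q (t + 1)))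
    (t : ℕ) : @FibreMeasurable Ω _ (past ε t) (chosenCount q t) := by
  induction t with
  | zero => exact fun d => @MeasurableSet.const Ω (past ε 0) (0 = d)
  | succ t ih =>
    have h := @FibreMeasurable.comp Ω _ _ (past ε t) _ _
      (@FibreMeasurable.prodMk Ω _ _ (past ε t) _ _ ih (hq t))
      (fun p => p.1 + p.2.elim 0 fun _ => 1)
    have e : chosenCount q (t + 1) = fun ω => chosenCount q t ω + (q (t + 1) ω).elim 0 fun _ => 1 := by
      funext ω
      rw [chosenCount, Finset.sum_Ioc_succ_top (Nat.zero_le _)]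
      rfl
    rw [e]
    exact h.mono (past_mono ε (Nat.le_succ t))

theorem fibreMeasurable_stopped (hq : ∀ t, @FibreMeasurable Ω _ (past ε t) (q (t + 1)))
    (m t : ℕ) : @FibreMeasurable Ω _ (past ε t) (stopped q m (t + 1)) :=
  @FibreMeasurable.comp Ω _ _ (past ε t) _ _
    (@FibreMeasurable.prodMk Ω _ _ (past ε t) _ _ (fibreMeasurable_chosenCount hq t) (hq t))
    (fun p => if p.1 < m then p.2 else none)

theorem measurable_expProd (hq : ∀ t, @FibreMeasurable Ω _ (past ε t) (q (t + 1))) (s : ℝ)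
    (t : ℕ) : Measurable[past ε t] (expProd ε s q t) := by
  refine @Finset.measurable_fun_prod _ _ _ _ _ _ (past ε t) _ _ fun τ hτ => ?_
  rw [Finset.mem_Ioc] at hτ
  obtain ⟨σ, rfl⟩ : ∃ σ, τ = σ + 1 := ⟨τ - 1, by omega⟩
  exact @FibreMeasurable.measurable_of_eq Ω _ (past ε t) _ _ _ _
    ((hq σ).mono (past_mono ε (by omega))) _ (fun o => weight ε s o (σ + 1))
    (fun o => measurable_weight (mΩ := past ε t) s (fun e => measurable_past ε hτ.2 e) o)
    (fun _ => rfl)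

variable [mΩ : MeasurableSpace Ω] {μ : Measure Ω} [IsProbabilityMeasure μ]

/-- The choice `q (t + 1)` is determined by the past, while the noise at time `t + 1` is independent
of it. Splitting by the value of the choice, each new factor has integral at most `1`. -/
theorem lintegral_expProd_le [Fintype E] (hε : ∀ e t, Measurable (ε e t))
    (hi : iIndepFun (fun p : E × ℕ => ε p.1 p.2) μ)
    (hsub : ∀ e t, HasSubgaussianMGF (ε e t) (1 / 4) μ)
    (hq : ∀ t, @FibreMeasurable Ω _ (past ε t) (q (t + 1))) (s : ℝ) (t : ℕ) :
    ∫⁻ ω, expProd ε s q t ω ∂μ ≤ 1 := by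
  classical
  induction t with
  | zero => simp [expProd]
  | succ t ih =>
    let g : Option E → Ω → ENNReal := fun o ω => expProd ε s q t ω * if q (t + 1) ω = o then 1 else 0
    have hg : ∀ o, Measurable[past ε t] (g o) := by
      intro o
      exact @FibreMeasurable.measurable_of_eq Ω _ (past ε t) _ _ _ _ (hq t) _
        (fun p ω => expProd ε s q t ω * if p = o then 1 else 0)
        (fun p => (measurable_expProd hq s t).mul_const _) (fun _ => rfl)
    have hgm : ∀ o, Measurable (g o) := fun o => (hg o).mono (past_le hε t) le_rfl
    have hsum : ∀ ω, ∑ o, g o ω = expProd ε s q t ω := by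
      intro ω
      simp [g]
    have hsucc : ∀ ω, expProd ε s q (t + 1) ω = ∑ o, g o ω * weight ε s o (t + 1) ω := by
      intro ω
      rw [expProd, Finset.prod_Ioc_succ_top (Nat.zero_le _)]
      simp only [g, mul_assoc, ← Finset.mul_sum]
      simp [expProd]
    have hle : ∀ o, ∫⁻ ω, g o ω * weight ε s o (t + 1) ω ∂μ ≤ ∫⁻ ω, g o ω ∂μ := by
      intro o
      cases o with
      | none => simp [weight]
      | some e =>
        have hw : Measurable[MeasurableSpace.comap (ε e (t + 1)) inferInstance]
            (weight ε s (some e) (t + 1)) := by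
          have h1 : Measurable[MeasurableSpace.comap (ε e (t + 1)) inferInstance] (ε e (t + 1)) :=
            comap_measurable _
          have h2 : Measurable fun y : ℝ => ENNReal.ofReal (Real.exp (s * y - s ^ 2 / 8)) := by
            fun_prop
          exact h2.comp h1
        rw [lintegral_mul_eq_lintegral_mul_lintegral_of_independent_measurableSpace (past_le hε t)
          (hε e (t + 1)).comap_le (indep_past hε hi t e) (hg _) hw]
        exact (mul_le_mul_right (lintegral_weight_le hsub s (some e) (t + 1)) _).trans (mul_one _).le
    calc ∫⁻ ω, expProd ε s q (t + 1) ω ∂μ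
        = ∑ o, ∫⁻ ω, g o ω * weight ε s o (t + 1) ω ∂μ := by
          simp only [hsucc]
          rw [lintegral_finsetSum]
          intro o _
          exact (hgm o).mul (measurable_weight s (fun e => hε e _) o)
      _ ≤ ∑ o, ∫⁻ ω, g o ω ∂μ := Finset.sum_le_sum fun o _ => hle o
      _ = ∫⁻ ω, expProd ε s q t ω ∂μ := by
          rw [← lintegral_finsetSum _ fun o _ => hgm o]
          simp only [hsum]
      _ ≤ 1 := ih

theorem measure_chosenNoise_gt_le [Fintype E] (hε : ∀ e t, Measurable (ε e t))
    (hi : iIndepFun (fun p : E × ℕ => ε p.1 p.2) μ)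
    (hsub : ∀ e t, HasSubgaussianMGF (ε e t) (1 / 4) μ)
    (hq : ∀ t, @FibreMeasurable Ω _ (past ε t) (q (t + 1))) {m T : ℕ} (hm : 0 < m) (hT : 1 < T) :
    μ {ω | ∃ t ≤ T, chosenCount q t ω = m ∧
      Real.sqrt (m * Real.log T) < |chosenNoise ε q t ω|} ≤
      2 * (ENNReal.ofReal ((T : ℝ) ^ 2))⁻¹ := by
  have hT0 : (0 : ℝ) < T := by positivity
  have hlog : 0 < Real.log T := Real.log_pos (by exact_mod_cast hT)
  have hm0 : (0 : ℝ) < m := by exact_mod_cast hm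
  have markov : ∀ s : ℝ, μ {ω | ENNReal.ofReal ((T : ℝ) ^ 2) ≤ expProd ε s (stopped q m) T ω} ≤
      (ENNReal.ofReal ((T : ℝ) ^ 2))⁻¹ := by
    intro s
    have hq' := fibreMeasurable_stopped hq m
    have h1 := mul_meas_ge_le_lintegral
      ((measurable_expProd hq' s T).mono (past_le hε T) le_rfl) (μ := μ)
      (ENNReal.ofReal ((T : ℝ) ^ 2))
    have h2 := h1.trans (lintegral_expProd_le hε hi hsub hq' s T)
    rwa [mul_comm, ← ENNReal.le_inv_iff_mul_le] at h2
  -- This `s` maximises `s * √(m log T) - s ^ 2 / 8 * m`; the maximum is `2 * log T`, hence the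
  -- probability `T ^ (-2)` for each sign.
  set s := 4 * Real.sqrt (Real.log T / m) with hs
  have hs0 : 0 ≤ s := by positivity
  have hs1 : s * Real.sqrt (m * Real.log T) = 4 * Real.log T := by
    rw [hs, mul_assoc, ← Real.sqrt_mul (by positivity)]
    have : Real.log T / m * (m * Real.log T) = Real.log T ^ 2 := by field_simp
    rw [this, Real.sqrt_sq hlog.le]
  have hs2 : s ^ 2 / 8 * m = 2 * Real.log T := by
    rw [hs, mul_pow, Real.sq_sqrt (by positivity)]
    field_simp
    norm_num
  have hexp : (T : ℝ) ^ 2 = Real.exp (2 * Real.log T) := by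
    rw [two_mul, Real.exp_add, Real.exp_log hT0]; ring
  have hsubset : {ω | ∃ t ≤ T, chosenCount q t ω = m ∧
      Real.sqrt (m * Real.log T) < |chosenNoise ε q t ω|} ⊆
      {ω | ENNReal.ofReal ((T : ℝ) ^ 2) ≤ expProd ε s (stopped q m) T ω} ∪
      {ω | ENNReal.ofReal ((T : ℝ) ^ 2) ≤ expProd ε (-s) (stopped q m) T ω} := by
    rintro ω ⟨t, htT, hcm, hlt⟩
    rcases lt_abs.1 hlt with h | h
    · left
      rw [Set.mem_ofPred_eq]
      rw [expProd_stopped s htT hcm, expProd_eq, hcm, hexp]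
      refine ENNReal.ofReal_le_ofReal (Real.exp_le_exp.2 ?_)
      have := mul_le_mul_of_nonneg_left h.le hs0
      linarith
    · right
      rw [Set.mem_ofPred_eq]
      rw [expProd_stopped (-s) htT hcm, expProd_eq, hcm, hexp]
      refine ENNReal.ofReal_le_ofReal (Real.exp_le_exp.2 ?_)
      have := mul_le_mul_of_nonneg_left h.le hs0
      rw [neg_sq]
      linarith
  refine (measure_mono hsubset).trans ((measure_union_le _ _).trans ?_)
  rw [two_mul]
  exact add_le_add (markov s) (markov (-s))

end Sampling

/-! ### The observations concentrate -/

section Concentration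

variable {Ω : Type*} {rr : RoundRobin N} {fb : Matching N} {u : Item N → ℝ} {T : ℕ}
  {ε : Sym2 (Item N) → ℕ → Ω → ℝ}

/-- The pair in which item `i` is observed at time `τ`, if its opponent lies in `U`. -/
def sampledPair (rr : RoundRobin N) (fb : Matching N) (u : Item N → ℝ) (T : ℕ)
    (ε : Sym2 (Item N) → ℕ → Ω → ℝ) (i : Item N) (U : Finset (Item N)) (τ : ℕ) (ω : Ω) :
    Option (Sym2 (Item N)) :=
  if (played rr fb T (observation u fun e t => ε e t ω) τ).mate i ∈ U then
    some s(i, (played rr fb T (observation u fun e t => ε e t ω) τ).mate i) else none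

theorem chosenCount_sampledPair (i : Item N) (U : Finset (Item N)) (t : ℕ) (ω : Ω) :
    chosenCount (sampledPair rr fb u T ε i U) t ω =
      playCount (stateAt rr fb T (observation u fun e t => ε e t ω) t) i U := by
  induction t with
  | zero => simp [chosenCount, playCount, stateAt, State.init]
  | succ t ih =>
    have h1 : chosenCount (sampledPair rr fb u T ε i U) (t + 1) ω =
        chosenCount (sampledPair rr fb u T ε i U) t ω +
          (sampledPair rr fb u T ε i U (t + 1) ω).elim 0 fun _ => 1 := by
      rw [chosenCount, Finset.sum_Ioc_succ_top (Nat.zero_le _)]; rfl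
    rw [h1, ih, playCount, playCount]
    set x := observation u fun e t => ε e t ω with hx
    have h2 : ∀ j, (stateAt rr fb T x (t + 1)).C i j + (stateAt rr fb T x (t + 1)).Cbuf i j =
        (stateAt rr fb T x t).C i j + (stateAt rr fb T x t).Cbuf i j +
        if (played rr fb T x (t + 1)).mate i = j then 1 else 0 := fun j =>
      step_count_total _ _ _ _ i j
    simp only [h2, Finset.sum_add_distrib, Finset.sum_ite_eq]
    rw [sampledPair, ← hx]
    split_ifs <;> rfl

theorem chosenNoise_sampledPair (i : Item N) (U : Finset (Item N)) (t : ℕ) (ω : Ω) :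
    chosenNoise ε (sampledPair rr fb u T ε i U) t ω =
      noiseSum u (stateAt rr fb T (observation u fun e t => ε e t ω) t) i U := by
  induction t with
  | zero => simp [chosenNoise, noiseSum, stateAt, State.init]
  | succ t ih =>
    have h1 : chosenNoise ε (sampledPair rr fb u T ε i U) (t + 1) ω =
        chosenNoise ε (sampledPair rr fb u T ε i U) t ω +
          (sampledPair rr fb u T ε i U (t + 1) ω).elim 0 fun e => ε e (t + 1) ω := by
      rw [chosenNoise, Finset.sum_Ioc_succ_top (Nat.zero_le _)]; rfl
    rw [h1, ih, noiseSum, noiseSum]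
    set x := observation u fun e t => ε e t ω with hx
    have h2 : ∀ j, (stateAt rr fb T x (t + 1)).X i j + (stateAt rr fb T x (t + 1)).Xbuf i j -
        u i * u j * ((stateAt rr fb T x (t + 1)).C i j + (stateAt rr fb T x (t + 1)).Cbuf i j : ℕ) =
        (stateAt rr fb T x t).X i j + (stateAt rr fb T x t).Xbuf i j -
        u i * u j * ((stateAt rr fb T x t).C i j + (stateAt rr fb T x t).Cbuf i j : ℕ) +
        if (played rr fb T x (t + 1)).mate i = j then ε s(i, j) (t + 1) ω else 0 := by
      intro j
      have e1 : (stateAt rr fb T x (t + 1)).C i j + (stateAt rr fb T x (t + 1)).Cbuf i j =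
        (stateAt rr fb T x t).C i j + (stateAt rr fb T x t).Cbuf i j +
        if (played rr fb T x (t + 1)).mate i = j then 1 else 0 := step_count_total _ _ _ _ i j
      have e2 : (stateAt rr fb T x (t + 1)).X i j + (stateAt rr fb T x (t + 1)).Xbuf i j =
        (stateAt rr fb T x t).X i j + (stateAt rr fb T x t).Xbuf i j +
        if (played rr fb T x (t + 1)).mate i = j then x (t + 1) i j else 0 :=
          step_reward_total _ _ _ _ i j
      rw [e1, e2]
      split_ifs
      · rw [hx, observation]; push_cast; ring
      · push_cast; ring
    simp only [h2, Finset.sum_add_distrib, Finset.sum_ite_eq]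
    rw [sampledPair, ← hx]
    split_ifs <;> rfl

theorem playCount_le (x : ℕ → Item N → Item N → ℝ) (i : Item N) (U : Finset (Item N)) (t : ℕ) :
    playCount (stateAt rr fb T x t) i U ≤ t := by
  induction t with
  | zero => simp [playCount, stateAt, State.init]
  | succ t ih =>
    have h2 : ∀ j, (stateAt rr fb T x (t + 1)).C i j + (stateAt rr fb T x (t + 1)).Cbuf i j =
        (stateAt rr fb T x t).C i j + (stateAt rr fb T x t).Cbuf i j +
        if (played rr fb T x (t + 1)).mate i = j then 1 else 0 := fun j =>
      step_count_total _ _ _ _ i j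
    rw [playCount] at ih ⊢
    simp only [h2, Finset.sum_add_distrib, Finset.sum_ite_eq] at ih ⊢
    split_ifs <;> omega

theorem chosenNoise_eq_zero {E : Type*} {ε : E → ℕ → Ω → ℝ} {q : ℕ → Ω → Option E} {t : ℕ} {ω : Ω}
    (h : chosenCount q t ω = 0) : chosenNoise ε q t ω = 0 := by
  rw [chosenCount, Finset.sum_eq_zero_iff] at h
  refine Finset.sum_eq_zero fun τ hτ => ?_
  have := h τ hτ
  cases hq : q τ ω with
  | none => rfl
  | some e => rw [hq] at this; exact absurd this one_ne_zero

theorem fibreMeasurable_sampledPair (i : Item N) (U : Finset (Item N)) (t : ℕ) :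
    @FibreMeasurable Ω _ (past ε t) (sampledPair rr fb u T ε i U (t + 1)) := by
  have h : @FibreMeasurable Ω _ (past ε t) fun ω =>
      played rr fb T (observation u fun e t => ε e t ω) (t + 1) := by
    refine @fibreMeasurable_played N Ω (past ε t) rr fb T _ (t + 1) (fun τ hτ a b => ?_) (by omega)
    exact (measurable_past ε (Nat.lt_succ_iff.1 hτ) s(a, b)).const_add _
  exact @FibreMeasurable.comp Ω _ _ (past ε t) _ _ h fun M =>
    if M.mate i ∈ U then some s(i, M.mate i) else none

/-- The set of opponents and the number of samples used by the algorithm are random, so the union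
bound runs over all `2 * N` items, all `4 ^ N` sets and all counts from `1` to `T`, each failing
with probability at most `2 / T ^ 2`. A count of zero leaves no noise. -/
theorem measure_not_concentrated_le [MeasurableSpace Ω] {μ : Measure Ω} [IsProbabilityMeasure μ]
    (hε : ∀ e t, Measurable (ε e t))
    (hi : iIndepFun (fun p : Sym2 (Item N) × ℕ => ε p.1 p.2) μ)
    (hsub : ∀ e t, HasSubgaussianMGF (ε e t) (1 / 4) μ) (hT : 1 < T) :
    μ {ω | ¬ ∀ t ≤ T, Concentrated u T (stateAt rr fb T (observation u fun e t => ε e t ω) t)} ≤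
      ENNReal.ofReal (4 * N * 4 ^ N / T) := by
  let I : Finset (Item N × Finset (Item N) × ℕ) :=
    Finset.univ ×ˢ Finset.univ ×ˢ Finset.Icc 1 T
  let B : Item N × Finset (Item N) × ℕ → Set Ω := fun p =>
    {ω | ∃ t ≤ T, chosenCount (sampledPair rr fb u T ε p.1 p.2.1) t ω = p.2.2 ∧
      Real.sqrt (p.2.2 * Real.log T) < |chosenNoise ε (sampledPair rr fb u T ε p.1 p.2.1) t ω|}
  have hsubset : {ω | ¬ ∀ t ≤ T, Concentrated u T
      (stateAt rr fb T (observation u fun e t => ε e t ω) t)} ⊆ ⋃ p ∈ I, B p := by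
    intro ω hω
    rw [Set.mem_ofPred_eq] at hω
    simp only [Concentrated] at hω
    push Not at hω
    obtain ⟨t, ht, i, U, hlt⟩ := hω
    rw [← chosenNoise_sampledPair, ← chosenCount_sampledPair] at hlt
    simp only [Set.mem_iUnion]
    refine ⟨(i, U, chosenCount (sampledPair rr fb u T ε i U) t ω), ?_, ?_⟩
    · simp only [I, Finset.mem_product, Finset.mem_univ, true_and, Finset.mem_Icc]
      constructor
      · by_contra h0
        have h0' : chosenCount (sampledPair rr fb u T ε i U) t ω = 0 := by omega
        rw [chosenNoise_eq_zero h0', h0'] at hlt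
        simp at hlt
      · rw [chosenCount_sampledPair]
        exact (playCount_le _ i U t).trans ht
    · exact ⟨t, ht, rfl, hlt⟩
  have hB : ∀ p ∈ I, μ (B p) ≤ 2 * (ENNReal.ofReal ((T : ℝ) ^ 2))⁻¹ := by
    rintro ⟨i, U, m⟩ hp
    simp only [I, Finset.mem_product, Finset.mem_univ, true_and, Finset.mem_Icc] at hp
    exact measure_chosenNoise_gt_le hε hi hsub (fibreMeasurable_sampledPair i U) hp.1 hT
  refine (measure_mono hsubset).trans ((measure_biUnion_finset_le I B).trans
    ((Finset.sum_le_sum hB).trans (le_of_eq ?_)))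
  have hT0 : (0 : ℝ) < T := by positivity
  have hcard : I.card = 2 * N * (4 ^ N * T) := by
    simp only [I, Finset.card_product, Finset.card_univ, Fintype.card_finset, Fintype.card_fin,
      Nat.card_Icc, Nat.add_sub_cancel, pow_mul]
    norm_num
  rw [Finset.sum_const, hcard, nsmul_eq_mul, ← ENNReal.ofReal_inv_of_pos (by positivity),
    ← ENNReal.ofReal_natCast, show (2 : ENNReal) = ENNReal.ofReal 2 by simp,
    ← ENNReal.ofReal_mul (by norm_num), ← ENNReal.ofReal_mul (by positivity)]
  congr 1
  push_cast
  field_simp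
  ring

end Concentration

/-! ### The expected regret -/

theorem integrable_regret {Ω : Type*} [MeasurableSpace Ω] {μ : Measure Ω} [IsProbabilityMeasure μ]
    {u : Item N → ℝ} {δ : ℝ} (hu : Paired u δ) (rr : RoundRobin N) (fb : Matching N)
    {ε : Sym2 (Item N) → ℕ → Ω → ℝ} (hε : ∀ e t, Measurable (ε e t)) (T : ℕ) :
    Integrable (fun ω => regret u T (played rr fb T (observation u fun e t => ε e t ω))) μ := by
  have hmeas : Measurable fun ω =>
      regret u T (played rr fb T (observation u fun e t => ε e t ω)) := by
    refine measurable_const.sub (Finset.measurable_fun_sum _ fun t ht => ?_)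
    refine FibreMeasurable.measurable (fibreMeasurable_played rr fb T t (fun τ _ a b => ?_)
      (Finset.mem_Icc.1 ht).1) fun M : Matching N => M.value u
    exact (hε s(a, b) τ).const_add _
  refine Integrable.of_bound hmeas.aestronglyMeasurable (N * T) (Filter.Eventually.of_forall ?_)
  intro ω
  rw [Real.norm_eq_abs, abs_of_nonneg (hu.regret_nonneg T _)]
  exact hu.regret_le T _

theorem exists_last_level {δ : ℝ} (h0 : 0 < δ) (h1 : δ ≤ 1) :
    ∃ L : ℕ, (∀ l : ℕ, 2 ^ l * δ ^ 2 ≤ 64 → l ≤ L) ∧ 2 ^ L * δ ^ 2 ≤ 64 := by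
  have hex : ∃ l : ℕ, ¬ (2 : ℝ) ^ l * δ ^ 2 ≤ 64 := by
    obtain ⟨l, hl⟩ := pow_unbounded_of_one_lt (64 / δ ^ 2) (show (1 : ℝ) < 2 by norm_num)
    rw [div_lt_iff₀ (by positivity)] at hl
    exact ⟨l, not_le.2 hl⟩
  have hpos : Nat.find hex ≠ 0 := by
    intro h
    have h2 := Nat.find_spec hex
    rw [h] at h2
    apply h2
    nlinarith
  refine ⟨Nat.find hex - 1, fun l hl => ?_, not_not.1 (Nat.find_min hex (by omega))⟩
  by_contra hlt
  have h2 := Nat.find_spec hex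
  apply h2
  refine le_trans (mul_le_mul_of_nonneg_right ?_ (by positivity)) hl
  exact pow_le_pow_right₀ (by norm_num) (by omega)

theorem integral_regret_le {Ω : Type*} [MeasurableSpace Ω] {μ : Measure Ω} [IsProbabilityMeasure μ]
    {u : Item N → ℝ} {δ : ℝ} (hu : Paired u δ) (rr : RoundRobin N) (fb : Matching N)
    {ε : Sym2 (Item N) → ℕ → Ω → ℝ} (hε : ∀ e t, Measurable (ε e t))
    (hi : iIndepFun (fun p : Sym2 (Item N) × ℕ => ε p.1 p.2) μ)
    (hsub : ∀ e t, HasSubgaussianMGF (ε e t) (1 / 4) μ) {T L : ℕ} (hT : 1 < T)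
    (hL : ∀ l : ℕ, 2 ^ l * δ ^ 2 ≤ 64 → l ≤ L) (hL' : 2 ^ L * δ ^ 2 ≤ 64) :
    ∫ ω, regret u T (played rr fb T (observation u fun e t => ε e t ω)) ∂μ ≤
      655360 * (N * Real.log N / δ ^ 2) * Real.log T + goodConstant N δ L + 4 * N ^ 2 * 4 ^ N := by
  have hlog : 0 < Real.log T := Real.log_pos (by exact_mod_cast hT)
  have hT0 : (0 : ℝ) < T := by positivity
  set G := 655360 * (N * Real.log N / δ ^ 2) * Real.log T + goodConstant N δ L with hG
  have hG0 : 0 ≤ G := by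
    have h1 : 0 ≤ ∑ l ∈ Finset.range (L + 1), spreadBound N δ l :=
      Finset.sum_nonneg fun l _ => spreadBound_nonneg N δ l
    have h2 : 0 ≤ Real.log N := Real.log_natCast_nonneg N
    rw [hG, goodConstant]
    positivity
  set F : Set Ω := {ω | ¬ ∀ t ≤ T, Concentrated u T
    (stateAt rr fb T (observation u fun e t => ε e t ω) t)} with hF
  have hFle : μ F ≤ ENNReal.ofReal (4 * N * 4 ^ N / T) := measure_not_concentrated_le hε hi hsub hT
  -- A measurable hull of the same measure replaces the bad event, whose measurability is then not
  -- needed.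
  set F' := toMeasurable μ F with hF'
  have hF'm : MeasurableSet F' := measurableSet_toMeasurable μ F
  have hpoint : ∀ ω, regret u T (played rr fb T (observation u fun e t => ε e t ω)) ≤
      G + F'.indicator (fun _ => (N * T : ℝ)) ω := by
    intro ω
    by_cases hω : ω ∈ F'
    · rw [Set.indicator_of_mem hω]
      linarith [hu.regret_le T (played rr fb T (observation u fun e t => ε e t ω))]
    · rw [Set.indicator_of_notMem hω, add_zero]
      have hωF : ω ∉ F := fun h => hω (subset_toMeasurable μ F h)
      rw [hF, Set.mem_ofPred_eq, not_not] at hωF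
      exact regret_le_of_concentrated hu hlog hL hL' _ hωF
  have hint : Integrable (F'.indicator fun _ => (N * T : ℝ)) μ :=
    (integrable_const _).indicator hF'm
  have hreal : μ.real F' ≤ 4 * N * 4 ^ N / T := by
    rw [Measure.real, measure_toMeasurable]
    exact ENNReal.toReal_le_of_le_ofReal (by positivity) hFle
  calc ∫ ω, regret u T (played rr fb T (observation u fun e t => ε e t ω)) ∂μ
      ≤ ∫ ω, (G + F'.indicator (fun _ => (N * T : ℝ)) ω) ∂μ :=
        integral_mono (integrable_regret hu rr fb hε T) ((integrable_const G).add hint) hpoint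
    _ = G + μ.real F' * (N * T) := by
        rw [integral_add (integrable_const G) hint, integral_indicator_const _ hF'm]
        simp
    _ ≤ G + 4 * N * 4 ^ N / T * (N * T) := by
        have := mul_le_mul_of_nonneg_right hreal (show (0 : ℝ) ≤ N * T by positivity)
        linarith
    _ = G + 4 * N ^ 2 * 4 ^ N := by field_simp

end MatchingBandit

end

theorem theorem8 :
    ∃ c : ℝ, 0 < c ∧ ∀ (N : ℕ), 2 ≤ N →
      ∀ (u : MatchingBandit.Item N → ℝ),
        (∀ i, u i ∈ Set.Ioo (0 : ℝ) 1) →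
        Antitone u →
        (∀ k : Fin N, u ⟨2 * (k : ℕ), by omega⟩ = u ⟨2 * (k : ℕ) + 1, by omega⟩) →
      ∀ (mStar : MatchingBandit.Matching N),
        (∀ m : MatchingBandit.Matching N, m ≠ mStar → m.value u < mStar.value u) →
      ∃ C : ℝ,
      ∀ (rr : MatchingBandit.RoundRobin N) (fallback : MatchingBandit.Matching N)
        {Ω : Type*} [MeasurableSpace Ω] (μ : Measure Ω) [IsProbabilityMeasure μ]
        (ε : Sym2 (MatchingBandit.Item N) → ℕ → Ω → ℝ),
        (∀ e t, Measurable (ε e t)) →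
        (∀ e t, ∫ ω, ε e t ω ∂μ = 0) →
        (∀ e t, HasSubgaussianMGF (ε e t) (1 / 4) μ) →
        iIndepFun (fun p : Sym2 (MatchingBandit.Item N) × ℕ => ε p.1 p.2) μ →
      ∀ T : ℕ, 0 < T →
        Integrable (fun ω => MatchingBandit.regret u T
          (MatchingBandit.played rr fallback T
            (MatchingBandit.observation u (fun e t => ε e t ω)))) μ ∧
        ∫ ω, MatchingBandit.regret u T
          (MatchingBandit.played rr fallback T
            (MatchingBandit.observation u (fun e t => ε e t ω))) ∂μ ≤
          c * (N * Real.log N / MatchingBandit.minGap u mStar) * Real.log T + C := by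
  refine ⟨655360, by norm_num, fun N hN u h01 hanti hpairs mStar hm => ?_⟩
  have htw := MatchingBandit.twin_eq_of_pairs fun k hk => hpairs ⟨k, by omega⟩
  have hgap := MatchingBandit.minGap_pos hN htw hm
  have hu := MatchingBandit.paired_of_unique hN h01 hanti htw hm
  have hsq : Real.sqrt (MatchingBandit.minGap u mStar) ^ 2 = MatchingBandit.minGap u mStar :=
    Real.sq_sqrt hgap.le
  obtain ⟨L, hL, hL'⟩ := MatchingBandit.exists_last_level hu.delta_pos hu.delta_le_one
  set δ := Real.sqrt (MatchingBandit.minGap u mStar)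
  refine ⟨max (MatchingBandit.goodConstant N δ L + 4 * N ^ 2 * 4 ^ N) N, ?_⟩
  intro rr fallback Ω _ μ _ ε hε _ hsub hi T hT
  refine ⟨MatchingBandit.integrable_regret hu rr fallback hε T, ?_⟩
  -- At `T = 1` the logarithm vanishes and the radii degenerate; the trivial bound `N` is absorbed
  -- in the constant.
  rcases Nat.lt_or_ge 1 T with hT1 | hT1
  · have h := MatchingBandit.integral_regret_le hu rr fallback hε hi hsub hT1 hL hL'
    rw [hsq] at h
    linarith [le_max_left (MatchingBandit.goodConstant N δ L + 4 * N ^ 2 * 4 ^ N) (N : ℝ)]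
  · obtain rfl : T = 1 := by omega
    have h : ∫ ω, MatchingBandit.regret u 1 (MatchingBandit.played rr fallback 1
        (MatchingBandit.observation u (fun e t => ε e t ω))) ∂μ ≤ ∫ _ω, (N : ℝ) ∂μ := by
      refine integral_mono (MatchingBandit.integrable_regret hu rr fallback hε 1)
        (integrable_const _) fun ω => ?_
      have := hu.regret_le 1 (MatchingBandit.played rr fallback 1
        (MatchingBandit.observation u (fun e t => ε e t ω)))
      simpa using this
    rw [integral_const] at h
    simp only [probReal_univ, smul_eq_mul, one_mul] at h
    simp only [Nat.cast_one, Real.log_one, mul_zero, zero_add]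
    exact h.trans (le_max_right _ _)
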